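/- **Model.** An observation is $Z=(X,Y)$ with $Y$ in a standard Borel space. Parameters are $\alpha=(\theta,h)\in\mathcal A=\Theta\times\mathcal H$, where $\Theta\subset\mathbb R^{d_\theta}$ is compact and $\mathcal H$ is a real normed space; $\|\alpha\|_s=\|\theta\|_e+\|h\|_{\mathcal H}$. The linear sieves $\mathcal H_1\subset\mathcal H_2\subset\cdots$ are finite dimensional subspaces of $\mathcal H$ with dense union, $k(n)\to\infty$, $\mathcal A_{k(n)}=\Theta\times\mathcal H_{k(n)}$ and $\mathbf V_{k(n)}=\mathbb R^{d_\theta}\times\mathcal H_{k(n)}$. The penalty $Pen:\mathcal H\to[0,\infty)$ has compact sublevel sets. The residual $\rho(\cdot;\alpha)\in\mathbb R^{d_\rho}$ is measurable. Under a law $P$ of $Z$, $m_P(X,\alpha)=E_P[\rho(Z;\alpha)\mid X]$. We say that $P$ is a law *of the model at* $\bar\alpha\in\mathcal A$ if, for all $\alpha\in\mathcal A$, $\rho(Z;\alpha)$ is $P$-integrable, $m_P(X,\alpha)\in L^2(P)$, and $m_P(X,\alpha)=0$ a.s. iff $\alpha=\bar\alpha$. Let $P_0$ be a law of the model at $\alpha_0=(\theta_0,h_0)$,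 with $\theta_0\in\mathrm{int}\,\Theta$ and $\rho(Z;\alpha_0)\in L^2(P_0)$; let $\Pi_nh_0\in\mathcal H_{k(n)}$ with $\Pi_nh_0\to h_0$. Let $\mathbf V$ be the linear span of $\{\alpha-\alpha_0:\alpha\in\mathbb R^{d_\theta}\times\bigcup_k\mathcal H_k\}$. For $v\in\mathbf V$ the pathwise derivative $\frac{dm(X,\alpha_0)}{d\alpha}[v]=\frac{d}{d\tau}m_{P_0}(X,\alpha_0+\tau v)|_{\tau=0}$ exists a.s., is a.s. linear in $v$ and square integrable. The functional $\phi$ is a continuous real function with, at $\alpha_0$, pathwise derivative $\frac{d\phi(\alpha_0)}{d\alpha}[\cdot]$, a bounded linear functional. The hypothesized value is $\phi_0=\phi(\alpha_0)$. Let $\Sigma_0(x)=\mathrm{Var}_{P_0}(\rho(Z;\alpha_0)\mid X=x)$. **Objects attached to a weighting matrix.** Let $\Sigma(x)$ be measurable, symmetric, with eigenvalues in a fixed compact subset of $(0,\infty)$, and let $\hat\Sigma$ be an estimator of it. Put $Q_P(\alpha)=E_P[m_P(X,\alpha)'\Sigma(X)^{-1}m_P(X,\alpha)]$ and $\langle v,w\rangle=E_{P_0}\big[(\frac{dm(X,\alpha_0)}{d\alpha}[v])'\Sigma(X)^{-1}\frac{dm(X,\alpha_0)}{d\alpha}[w]\big]$,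 $\|v\|=\langle v,v\rangle^{1/2}$, where $\|\cdot\|$ is a norm on $\mathbf V_{k(n)}$. The sieve Riesz representer $v_n^*\in\mathbf V_{k(n)}$ satisfies $\frac{d\phi(\alpha_0)}{d\alpha}[v]=\langle v_n^*,v\rangle$ on $\mathbf V_{k(n)}$; $\|v\|_{sd}^2=\mathrm{Var}_{P_0}\big((\frac{dm(X,\alpha_0)}{d\alpha}[v])'\Sigma(X)^{-1}\rho(Z;\alpha_0)\big)$; $u_n^*=v_n^*/\|v_n^*\|_{sd}$ (and $u_n^*=0$ if $\|v_n^*\|_{sd}=0$). Let $\alpha_{0,n}$ minimize $\|\alpha-\alpha_0\|$ over $\mathbb R^{d_\theta}\times\mathcal H_{k(n)}$. Given a sample $Z_1,\dots,Z_n$, let $\hat m(x,\alpha)=\sum_i\rho(Z_i;\alpha)A_n(X_i,x)$ be a linear smoother (weights depending on $X_1,\dots,X_n$ only), $\hat Q_n(\alpha)=\frac1n\sum_i\hat m(X_i,\alpha)'\hat\Sigma(X_i)^{-1}\hat m(X_i,\alpha)$ and $\lambda_n>0$. The estimator $\hat\alpha_n\in\mathcal A_{k(n)}$ and the restricted estimator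 $\hat\alpha_n^R\in\{\alpha\in\mathcal A_{k(n)}:\phi(\alpha)=\phi_0\}$ minimize $\hat Q_n(\alpha)+\lambda_nPen(h)$ over these sets up to $o_P(n^{-1})$, and $\widehat{QLR}_n(\phi_0)=n(\hat Q_n(\hat\alpha_n^R)-\hat Q_n(\hat\alpha_n))$. Rates: $0<\delta_n\to0$, $\bar\delta_{m,n}\to0$; $\tau_n=\sup\{\|v\|_s/\|v\|:v\in\mathbf V_{k(n)},\|v\|\ne0\}$; $\delta_{s,n}=\|h_0-\Pi_nh_0\|_{\mathcal H}+\tau_n\delta_n\to0$; $M_n=\min\{\log\log(n+1),\log(\delta_{s,n}^{-1}+1)\}$; $\mathcal T_n=\{t:|t|\le4M_n^2\delta_n\}$; for a constant $M_0$, $\mathcal A_{k(n)}^{M_0}=\{\alpha\in\mathcal A_{k(n)}:Pen(h)\le M_0\}$ and $\mathcal N_{osn}=\{\alpha\in\mathcal A_{k(n)}^{M_0}:\|\alpha-\alpha_0\|\le M_n\delta_n,\ \|\alpha-\alpha_0\|_s\le M_n\delta_{s,n}\}$. **Local alternatives.** Let $\boldsymbol\alpha_n=\alpha_0+d_n\Delta_n$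 with $\Delta_n\in\mathbf V_{k(n)}$ and $\frac{d\phi(\alpha_0)}{d\alpha}[\Delta_n]\to\kappa\ne0$. For the sample size $n$ the data are i.i.d. from a law $P_n$ which, for all large $n$, is a law of the model at $\boldsymbol\alpha_n$. For some $c<1$ and all large $n$, $d_n\|\Delta_n\|\le cM_n\delta_n$, $d_n\|\Delta_n\|_s\le cM_n\delta_{s,n}$, and $Pen(\boldsymbol h_n)\le M_0$, where $\boldsymbol h_n$ is the $h$-component of $\boldsymbol\alpha_n$. Put $\Pi_n\boldsymbol\alpha_n=(\theta_0,\Pi_nh_0)+d_n\Delta_n$. **Conditions** (probabilities, $o_P$, $O_P$ and "wpa1" are under $P_n$; conditions displayed for each $n$ are for all large $n$). 1. *Rates.* $Pen(\hat h_n)\le M_0$ wpa1; $\Pi_n\boldsymbol\alpha_n\in\mathcal A_{k(n)}^{M_0}$. For every $a\in\mathcal A$ and $\varepsilon>0$ there is $r>0$ such that for all large $n$, $Q_{P_n}(\alpha)\ge Q_{P_0}(a)-\varepsilon$ for all $\alpha\in\mathcal A$ with $\|\alpha-a\|_s<r$. For constants $c_0,c,c'>0$: $\hat Q_n(\Pi_n\boldsymbol\alpha_n)\le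 c_0Q_{P_n}(\Pi_n\boldsymbol\alpha_n)+O_P(\delta_n^2)+o_P(n^{-1})$; $\hat Q_n(\alpha)\ge cQ_{P_n}(\alpha)-O_P(\bar\delta_{m,n}^2)$ uniformly over $\mathcal A_{k(n)}^{M_0}$; and, for some $r>0$ with $\mathcal A_{osn}=\{\alpha\in\mathcal A^{M_0}_{k(n)}:\|\alpha-\alpha_0\|_s<r\}$, $\hat Q_n(\alpha)\ge c'Q_{P_n}(\alpha)-O_P(\delta_n^2)$ uniformly over $\mathcal A_{osn}$ and $c_1\|\alpha-\boldsymbol\alpha_n\|^2\le Q_{P_n}(\alpha)\le c_2\|\alpha-\boldsymbol\alpha_n\|^2$ on $\mathcal A_{osn}$ with constants $c_1>0$, $c_2$. Moreover $Q_{P_n}(\Pi_n\boldsymbol\alpha_n)=O(\delta_n^2)$, $\lambda_n=O(\delta_n^2)$, and $\lambda_n\sup\{|Pen(h+tu^*_{n,h})-Pen(g)|\}=o(n^{-1})$, the supremum over $t\in\mathcal T_n$ and over $h$- and $g$-components of elements of $\mathcal N_{osn}$, with $u^*_{n,h}$ the $h$-component of $u_n^*$. 2. *Restricted estimator.* $\hat\alpha_n^R\in\mathcal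 N_{osn}$ wpa1. 3. *Functional.* $\|v_n^*\|/\sqrt n\to0$; $\sup_{\alpha\in\mathcal N_{osn},t\in\mathcal T_n}\sqrt n\,\big|\phi(\alpha+tu_n^*)-\phi(\alpha_0)-\frac{d\phi(\alpha_0)}{d\alpha}[\alpha+tu_n^*-\alpha_0]\big|=o(\|v_n^*\|)$; $\sqrt n\,\big|\frac{d\phi(\alpha_0)}{d\alpha}[\alpha_{0,n}-\alpha_0]\big|/\|v_n^*\|\to0$. 4. *Local quadratic approximation.* $\alpha+tu_n^*\in\mathcal A_{k(n)}$ for $\alpha\in\mathcal N_{osn}$, $t\in\mathcal T_n$. With $\mathbb Z_n(\alpha)=\frac1n\sum_i(\frac{dm(X_i,\alpha_0)}{d\alpha}[u_n^*])'\Sigma(X_i)^{-1}\rho(Z_i;\alpha)$, there are positive statistics $B_n=\|u_n^*\|^2+o_P(1)$ and $0\le s_n=o(n^{-1})$ such that, uniformly over $(\alpha,t)\in\mathcal N_{osn}\times\mathcal T_n$, $$\tfrac12\{\hat Q_n(\alpha+tu_n^*)-\hat Q_n(\alpha)\}=t\{\mathbb Z_n(\boldsymbol\alpha_n)+\langle u_n^*,\alpha-\boldsymbol\alpha_n\rangle\}+\tfrac{B_n}2t^2+o_P\big(\max\{t^2,|t|n^{-1/2},s_n\}\big),$$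 and $\sqrt n\,\mathbb Z_n(\boldsymbol\alpha_n)\Rightarrow N(0,1)$. **Proposition.** Suppose everything above holds for a weighting matrix $\Sigma$, with statistic $\widehat{QLR}_n(\phi_0)$, and also for the optimal weighting matrix $\Sigma_0$ (up to a null set of $x$; with its own estimator of the weighting matrix and its own $\lambda_n$, $M_0$, rates, constants and other attached objects), with statistic $\widehat{QLR}{}^0_n(\phi_0)$, along the same local alternatives with $$d_n=n^{-1/2}\|v_n^*\|_{sd},$$ where $v_n^*$, $\|\cdot\|_{sd}$ and $u_n^*$ below are those of $\Sigma$. Then for every $t\in\mathbb R$ the limit on the left exists and $$\lim_{n\to\infty}P_n\big(\|u_n^*\|^2\,\widehat{QLR}_n(\phi_0)\ge t\big)\ \le\ \liminf_{n\to\infty}P_n\big(\widehat{QLR}{}_n^0(\phi_0)\ge t\big).$$ (If statistics are not measurable, probabilities are outer probabilities.) -/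

import Mathlib

open MeasureTheory ProbabilityTheory Filter Topology
open scoped NNReal ENNReal Matrix

namespace SieveQLR

/-! ### Stochastic order notation along a sequence of data generating processes -/

section StochasticOrder

variable {Z : Type*} [MeasurableSpace Z]

/-- The joint law of an i.i.d. sample of size `n` from `P`. -/
noncomputable def sampleLaw (P : ProbabilityMeasure Z) (n : ℕ) : Measure (Fin n → Z) :=
  Measure.pi fun _ => (P : Measure Z)

/-- `R n = o_P(a n)` when the sample of size `n` is i.i.d. from `P n` (outer probabilities, so
that no measurability of `R n` is needed). -/
def LittleOP (P : ℕ → ProbabilityMeasure Z) (R : (n : ℕ) → (Fin n → Z) → ℝ) (a : ℕ → ℝ) : Prop :=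
  ∀ ε : ℝ, 0 < ε →
    Tendsto (fun n => sampleLaw (P n) n {z | ε * a n < |R n z|}) atTop (𝓝 0)

/-- `R n = O_P(a n)` when the sample of size `n` is i.i.d. from `P n`. -/
def BigOP (P : ℕ → ProbabilityMeasure Z) (R : (n : ℕ) → (Fin n → Z) → ℝ) (a : ℕ → ℝ) : Prop :=
  ∀ ε : ℝ, 0 < ε → ∃ C : ℝ, ∀ᶠ n in atTop,
    sampleLaw (P n) n {z | C * a n < |R n z|} ≤ ENNReal.ofReal ε

/-- The events `S n` hold with probability approaching one. -/
def WPA1 (P : ℕ → ProbabilityMeasure Z) (S : (n : ℕ) → Set (Fin n → Z)) : Prop :=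
  Tendsto (fun n => sampleLaw (P n) n (S n)ᶜ) atTop (𝓝 0)

/-- Convergence in distribution to the standard normal law, through distribution functions. -/
def TendstoStdNormal (P : ℕ → ProbabilityMeasure Z) (R : (n : ℕ) → (Fin n → Z) → ℝ) : Prop :=
  ∀ x : ℝ, Tendsto (fun n => sampleLaw (P n) n {z | R n z ≤ x}) atTop
    (𝓝 (gaussianReal 0 1 (Set.Iic x)))

end StochasticOrder

/-! ### The semi/nonparametric conditional moment model -/

/-- Parameters `α = (θ, h)`. -/
abbrev Param (dθ : ℕ) (H : Type*) : Type _ := EuclideanSpace ℝ (Fin dθ) × H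

/-- The strong norm `‖α‖_s = ‖θ‖_e + ‖h‖_H`. -/
noncomputable def strongNorm {dθ : ℕ} {H : Type*} [NormedAddCommGroup H] (v : Param dθ H) : ℝ :=
  ‖v.1‖ + ‖v.2‖

/-- The weighted product `a' W⁻¹ b`. -/
noncomputable def wprod {dρ : ℕ} (W : Matrix (Fin dρ) (Fin dρ) ℝ) (a b : Fin dρ → ℝ) : ℝ :=
  a ⬝ᵥ (W⁻¹ *ᵥ b)

/-- The ingredients of the model and of the testing problem that do not depend on the weighting
matrix. An observation is `z = (x, y)`. -/
structure Model (dθ dρ : ℕ) (X Y H : Type*) [MeasurableSpace X] [MeasurableSpace Y]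
    [NormedAddCommGroup H] [NormedSpace ℝ H] where
  /-- the generalized residual `ρ(z; α)` -/
  residual : X × Y → Param dθ H → (Fin dρ → ℝ)
  /-- the finite-dimensional parameter space `Θ` -/
  Θ : Set (EuclideanSpace ℝ (Fin dθ))
  /-- the linear sieves `H_k` -/
  sieve : ℕ → Submodule ℝ H
  /-- the sieve dimension index `k(n)` -/
  k : ℕ → ℕ
  /-- the penalty -/
  Pen : H → ℝ≥0
  /-- the functional of interest -/
  φ : Param dθ H → ℝ
  /-- its pathwise derivative at `α₀` -/
  dφ : Param dθ H →L[ℝ] ℝ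
  /-- the law of one observation at `α₀` -/
  law : ProbabilityMeasure (X × Y)
  /-- the parameter around which local alternatives are taken -/
  α₀ : Param dθ H
  /-- a version of the pathwise derivative of the conditional mean function at `α₀`:
  `dm v x` is `dm(x, α₀)/dα [v]` -/
  dm : Param dθ H → X → (Fin dρ → ℝ)
  /-- the sieve approximations `Π_n h₀` -/
  proj : ℕ → H
  /-- the weights `A_n(X_i, x)` of the linear smoother which estimates the conditional mean
  function; they depend on the sample of the `X_j` -/
  smoother : (n : ℕ) → (Fin n → X) → Fin n → X → ℝ

/-- The ingredients that come with one choice of the weighting matrix. -/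
structure Weighting (dθ dρ : ℕ) (X Y H : Type*) where
  /-- the population weighting matrix `Σ(x)` -/
  Sig : X → Matrix (Fin dρ) (Fin dρ) ℝ
  /-- its estimator -/
  SigHat : (n : ℕ) → (Fin n → X × Y) → X → Matrix (Fin dρ) (Fin dρ) ℝ
  /-- the penalization parameter `λ_n` -/
  lam : ℕ → ℝ
  /-- the bound `M₀` on the penalty -/
  M₀ : ℝ
  /-- the rate `δ_n` -/
  δ : ℕ → ℝ
  /-- the preliminary rate `δ̄_{m,n}` -/
  δbar : ℕ → ℝ
  /-- the penalized sieve minimum distance estimator -/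
  est : (n : ℕ) → (Fin n → X × Y) → Param dθ H
  /-- the restricted penalized sieve minimum distance estimator -/
  estR : (n : ℕ) → (Fin n → X × Y) → Param dθ H
  /-- the sieve Riesz representer `v_n^*` -/
  riesz : ℕ → Param dθ H
  /-- the best sieve approximation `α_{0,n}` of `α₀` in the weak norm -/
  approx : ℕ → Param dθ H
  /-- the coefficient `B_n` of the local quadratic approximation -/
  B : (n : ℕ) → (Fin n → X × Y) → ℝ
  /-- the `o(n⁻¹)` sequence in the rate of the local quadratic approximation -/
  s : ℕ → ℝ

/-- A sequence of data generating processes `P n` with true parameters `α₀ + d n • dir n`. -/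
structure LocalAlt (dθ : ℕ) (X Y H : Type*) [MeasurableSpace X] [MeasurableSpace Y] where
  /-- the law of one observation when the sample size is `n` -/
  P : ℕ → ProbabilityMeasure (X × Y)
  /-- the size `d_n` of the deviation -/
  d : ℕ → ℝ
  /-- the direction `Δ_n` of the deviation -/
  dir : ℕ → Param dθ H
  /-- the local parameter `κ` -/
  κ : ℝ

section

variable {dθ dρ : ℕ} {X Y H : Type*} [MeasurableSpace X] [MeasurableSpace Y]
  [StandardBorelSpace Y] [Nonempty Y] [NormedAddCommGroup H] [NormedSpace ℝ H]
variable (M : Model dθ dρ X Y H) (W : Weighting dθ dρ X Y H) (L : LocalAlt dθ X Y H)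

/-- The parameter space `A = Θ × H`. -/
def Model.space : Set (Param dθ H) := {α | α.1 ∈ M.Θ}

/-- The sieve space `A_{k(n)} = Θ × H_{k(n)}`. -/
def Model.sieveSpace (n : ℕ) : Set (Param dθ H) := {α | α.1 ∈ M.Θ ∧ α.2 ∈ M.sieve (M.k n)}

/-- The restricted sieve space `{α ∈ A_{k(n)} : φ(α) = φ₀}` with `φ₀ = φ(α₀)`. -/
def Model.sieveSpaceR (n : ℕ) : Set (Param dθ H) := {α ∈ M.sieveSpace n | M.φ α = M.φ M.α₀}

/-- The sieve tangent space `V_{k(n)} = ℝ^{dθ} × H_{k(n)}`. -/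
def Model.tangent (n : ℕ) : Submodule ℝ (Param dθ H) :=
  (⊤ : Submodule ℝ (EuclideanSpace ℝ (Fin dθ))).prod (M.sieve (M.k n))

/-- The linear span `V` of the differences `α - α₀`, with `α` in some `ℝ^{dθ} × H_k`. -/
def Model.V : Submodule ℝ (Param dθ H) :=
  Submodule.span ℝ {v | ∃ α : Param dθ H, (∃ j, α.2 ∈ M.sieve j) ∧ v = α - M.α₀}

/-- The conditional mean function `m(x, α) = E[ρ(Z; α) | X = x]` when `Z` has law `P`. -/
noncomputable def Model.condMean (P : ProbabilityMeasure (X × Y)) (α : Param dθ H) (x : X) :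
    Fin dρ → ℝ :=
  ∫ y, M.residual (x, y) α ∂((P : Measure (X × Y)).condKernel x)

/-- The conditional variance `Σ₀(x) = Var(ρ(Z; α₀) | X = x)` under the law at `α₀`. -/
noncomputable def Model.Sig₀ (x : X) : Matrix (Fin dρ) (Fin dρ) ℝ :=
  Matrix.of fun i j =>
    ∫ y, (M.residual (x, y) M.α₀ i - M.condMean M.law M.α₀ x i) *
      (M.residual (x, y) M.α₀ j - M.condMean M.law M.α₀ x j)
      ∂((M.law : Measure (X × Y)).condKernel x)

/-- The conditional moment restrictions hold under `P` exactly at `α`, within the parameter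
space (and the conditional mean functions are square integrable). -/
def Model.IdentifiedAt (P : ProbabilityMeasure (X × Y)) (α : Param dθ H) : Prop :=
  α ∈ M.space ∧
  (∀ β ∈ M.space, Integrable (fun z => M.residual z β) (P : Measure (X × Y)) ∧
    MemLp (M.condMean P β) 2 (P : Measure (X × Y)).fst) ∧
  ∀ β ∈ M.space, (∀ᵐ x ∂(P : Measure (X × Y)).fst, M.condMean P β x = 0) ↔ β = α

/-- Regularity of the parts of the model that do not depend on the weighting matrix. -/
structure Model.Regular : Prop where
  compact_Θ : IsCompact M.Θ
  interior_θ : M.α₀.1 ∈ interior M.Θ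
  sieve_mono : Monotone M.sieve
  sieve_finite : ∀ j, FiniteDimensional ℝ (M.sieve j)
  sieve_dense : Dense (⋃ j, (M.sieve j : Set H))
  k_tendsto : Tendsto M.k atTop atTop
  proj_mem : ∀ n, M.proj n ∈ M.sieve (M.k n)
  proj_tendsto : Tendsto (fun n => ‖M.proj n - M.α₀.2‖) atTop (𝓝 0)
  pen_compact : ∀ C : ℝ, IsCompact {h | (M.Pen h : ℝ) ≤ C}
  residual_measurable : ∀ α, Measurable fun z => M.residual z α
  identified : M.IdentifiedAt M.law M.α₀
  residual_memLp : MemLp (fun z => M.residual z M.α₀) 2 (M.law : Measure (X × Y))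
  φ_continuous : Continuous M.φ
  φ_deriv : ∀ v, HasDerivAt (fun τ : ℝ => M.φ (M.α₀ + τ • v)) (M.dφ v) 0
  dm_measurable : ∀ v ∈ M.V, Measurable (M.dm v)
  dm_memLp : ∀ v ∈ M.V, MemLp (M.dm v) 2 (M.law : Measure (X × Y)).fst
  dm_deriv : ∀ v ∈ M.V, ∀ᵐ x ∂(M.law : Measure (X × Y)).fst,
    HasDerivAt (fun τ : ℝ => M.condMean M.law (M.α₀ + τ • v) x) (M.dm v x) 0
  dm_linear : ∀ v ∈ M.V, ∀ w ∈ M.V, ∀ a b : ℝ, ∀ᵐ x ∂(M.law : Measure (X × Y)).fst,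
    M.dm (a • v + b • w) x = a • M.dm v x + b • M.dm w x

/-! ### Population objects attached to a weighting matrix -/

/-- The population criterion `E[m(X, α)' Σ(X)⁻¹ m(X, α)]` when `Z` has law `P`. -/
noncomputable def Weighting.Q (P : ProbabilityMeasure (X × Y)) (α : Param dθ H) : ℝ :=
  ∫ x, wprod (W.Sig x) (M.condMean P α x) (M.condMean P α x) ∂(P : Measure (X × Y)).fst

/-- `⟨v, w⟩ = E[(dm(X, α₀)/dα [v])' Σ(X)⁻¹ (dm(X, α₀)/dα [w])]`, under the law at `α₀`. -/
noncomputable def Weighting.ip (v w : Param dθ H) : ℝ :=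
  ∫ x, wprod (W.Sig x) (M.dm v x) (M.dm w x) ∂(M.law : Measure (X × Y)).fst

/-- The weak norm `‖v‖ = ⟨v, v⟩^{1/2}`. -/
noncomputable def Weighting.weakNorm (v : Param dθ H) : ℝ := √(W.ip M v v)

/-- The score `(dm(X, α₀)/dα [v])' Σ(X)⁻¹ ρ(Z; α)`. -/
noncomputable def Weighting.score (v α : Param dθ H) (z : X × Y) : ℝ :=
  wprod (W.Sig z.1) (M.dm v z.1) (M.residual z α)

/-- The sieve standard deviation norm: `‖v‖_sd²` is the variance, under the law at `α₀`, of the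
score at `α₀` in the direction `v`. -/
noncomputable def Weighting.sdNorm (v : Param dθ H) : ℝ :=
  √(variance (W.score M v M.α₀) (M.law : Measure (X × Y)))

/-- The scaled sieve Riesz representer `u_n^* = v_n^* / ‖v_n^*‖_sd`. -/
noncomputable def Weighting.u (n : ℕ) : Param dθ H := (W.sdNorm M (W.riesz n))⁻¹ • W.riesz n

/-- The sieve measure of local ill-posedness `τ_n`: the supremum of `‖v‖_s / ‖v‖` over the
directions of the sieve space. -/
noncomputable def Weighting.ill (n : ℕ) : ℝ :=
  sSup {r | ∃ v ∈ M.tangent n, W.weakNorm M v ≠ 0 ∧ r = strongNorm v / W.weakNorm M v}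

/-- `δ_{s,n} = ‖h₀ - Π_n h₀‖_s + τ_n δ_n`. -/
noncomputable def Weighting.δs (n : ℕ) : ℝ := ‖M.α₀.2 - M.proj n‖ + W.ill M n * W.δ n

/-- `M_n = min {log log (n + 1), log (δ_{s,n}⁻¹ + 1)}`. -/
noncomputable def Weighting.slow (n : ℕ) : ℝ :=
  min (Real.log (Real.log (n + 1))) (Real.log ((W.δs M n)⁻¹ + 1))

/-- The set `T_n = {t : |t| ≤ 4 M_n² δ_n}`. -/
def Weighting.T (n : ℕ) : Set ℝ := {t | |t| ≤ 4 * W.slow M n ^ 2 * W.δ n}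

/-- The shrinking neighbourhood `N_osn` of `α₀` in the sieve space. -/
def Weighting.N (n : ℕ) : Set (Param dθ H) :=
  {α ∈ M.sieveSpace n | W.weakNorm M (α - M.α₀) ≤ W.slow M n * W.δ n ∧
    strongNorm (α - M.α₀) ≤ W.slow M n * W.δs M n ∧ (M.Pen α.2 : ℝ) ≤ W.M₀}

/-- The subset `A_{k(n)}^{M₀}` of the sieve space on which the penalty is at most `M₀`. -/
def Weighting.sieveSpaceM (n : ℕ) : Set (Param dθ H) :=
  {α ∈ M.sieveSpace n | (M.Pen α.2 : ℝ) ≤ W.M₀}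

/-- The fixed neighbourhood `A_osn` of `α₀` in the sieve space, of strong radius `r`. -/
def Weighting.sieveNhd (r : ℝ) (n : ℕ) : Set (Param dθ H) :=
  {α ∈ W.sieveSpaceM M n | strongNorm (α - M.α₀) < r}

/-! ### Sample objects -/

/-- The linear smoother `m̂(x, α) = ∑ i, ρ(Z_i; α) A_n(X_i, x)`. -/
noncomputable def Model.mHat (n : ℕ) (z : Fin n → X × Y) (α : Param dθ H) (x : X) :
    Fin dρ → ℝ :=
  ∑ i, M.smoother n (fun j => (z j).1) i x • M.residual (z i) α

/-- The sample criterion `Q̂_n(α) = n⁻¹ ∑ i, m̂(X_i, α)' Σ̂(X_i)⁻¹ m̂(X_i, α)`. -/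
noncomputable def Weighting.QHat (n : ℕ) (z : Fin n → X × Y) (α : Param dθ H) : ℝ :=
  (n : ℝ)⁻¹ * ∑ i, wprod (W.SigHat n z (z i).1) (M.mHat n z α (z i).1) (M.mHat n z α (z i).1)

/-- The penalized sample criterion. -/
noncomputable def Weighting.QPen (n : ℕ) (z : Fin n → X × Y) (α : Param dθ H) : ℝ :=
  W.QHat M n z α + W.lam n * M.Pen α.2

/-- The sieve quasi likelihood ratio statistic `n (Q̂_n(α̂_n^R) - Q̂_n(α̂_n))` for `φ₀ = φ(α₀)`. -/
noncomputable def Weighting.QLR (n : ℕ) (z : Fin n → X × Y) : ℝ :=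
  n * (W.QHat M n z (W.estR n z) - W.QHat M n z (W.est n z))

/-- `e` minimizes the penalized sample criterion over `C n` up to `o_P(n⁻¹)`. -/
def Weighting.IsApproxMin (P : ℕ → ProbabilityMeasure (X × Y)) (C : ℕ → Set (Param dθ H))
    (e : (n : ℕ) → (Fin n → X × Y) → Param dθ H) : Prop :=
  ∃ η : (n : ℕ) → (Fin n → X × Y) → ℝ, LittleOP P η (fun n => (n : ℝ)⁻¹) ∧
    ∀ᶠ n in atTop, ∀ z, e n z ∈ C n ∧
      ∀ α ∈ C n, W.QPen M n z (e n z) ≤ W.QPen M n z α + η n z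

/-- The scaled sample score `Z_n(α) = n⁻¹ ∑ i, (dm(X_i, α₀)/dα [u_n^*])' Σ(X_i)⁻¹ ρ(Z_i; α)`. -/
noncomputable def Weighting.Zn (n : ℕ) (α : Param dθ H) (z : Fin n → X × Y) : ℝ :=
  (n : ℝ)⁻¹ * ∑ i, W.score M (W.u M n) α (z i)

/-! ### The local alternatives -/

/-- The true parameter `α_n = α₀ + d_n Δ_n`. -/
def LocalAlt.param (n : ℕ) : Param dθ H := M.α₀ + L.d n • L.dir n

/-- The sieve approximation `Π_n α_n = (θ₀, Π_n h₀) + d_n Δ_n` of the true parameter. -/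
def LocalAlt.sieveParam (n : ℕ) : Param dθ H := (M.α₀.1, M.proj n) + L.d n • L.dir n

/-- The data generating processes are those of the model at `α_n = α₀ + d_n Δ_n`, with `Δ_n` in
the sieve tangent space and `dφ(α₀)/dα [Δ_n] → κ ≠ 0`. -/
structure LocalAlt.Along : Prop where
  dir_mem : ∀ n, L.dir n ∈ M.tangent n
  dφ_tendsto : Tendsto (fun n => M.dφ (L.dir n)) atTop (𝓝 L.κ)
  κ_ne : L.κ ≠ 0
  identified : ∀ᶠ n in atTop, M.IdentifiedAt (L.P n) (L.param M n)

/-- Basic conditions on the weighting matrix, the rates and the sieve Riesz representer. -/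
structure Weighting.Basic : Prop where
  Sig_measurable : ∀ i j, Measurable fun x => W.Sig x i j
  Sig_symm : ∀ x, (W.Sig x).IsSymm
  Sig_eigen : ∃ c C : ℝ, 0 < c ∧ ∀ x, ∀ a : Fin dρ → ℝ,
    c * (a ⬝ᵥ a) ≤ a ⬝ᵥ (W.Sig x *ᵥ a) ∧ a ⬝ᵥ (W.Sig x *ᵥ a) ≤ C * (a ⬝ᵥ a)
  lam_pos : ∀ n, 0 < W.lam n
  δ_pos : ∀ n, 0 < W.δ n
  δ_tendsto : Tendsto W.δ atTop (𝓝 0)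
  δbar_tendsto : Tendsto W.δbar atTop (𝓝 0)
  δs_tendsto : Tendsto (W.δs M) atTop (𝓝 0)
  /-- directions of the sieve space that vanish in the weak norm vanish -/
  weakNorm_ne : ∀ n, ∀ v ∈ M.tangent n, W.weakNorm M v = 0 → v = 0
  riesz_mem : ∀ n, W.riesz n ∈ M.tangent n
  riesz_spec : ∀ n, ∀ v ∈ M.tangent n, M.dφ v = W.ip M (W.riesz n) v
  approx_mem : ∀ n, W.approx n ∈ M.tangent n
  approx_min : ∀ n, ∀ α ∈ M.tangent n,
    W.weakNorm M (W.approx n - M.α₀) ≤ W.weakNorm M (α - M.α₀)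

/-- The local alternatives stay inside the shrinking neighbourhoods of `α₀`. -/
structure Weighting.Near : Prop where
  rate : ∃ c : ℝ, c < 1 ∧ ∀ᶠ n in atTop,
    L.d n * W.weakNorm M (L.dir n) ≤ c * (W.slow M n * W.δ n) ∧
    L.d n * strongNorm (L.dir n) ≤ c * (W.slow M n * W.δs M n)
  pen : ∀ᶠ n in atTop, (M.Pen (L.param M n).2 : ℝ) ≤ W.M₀

/-- Conditions for the convergence rate of the penalized sieve minimum distance estimator when
the data come from the local alternatives. -/
structure Weighting.RateConditions : Prop where
  est_min : W.IsApproxMin M L.P M.sieveSpace W.est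
  /-- choice of the constant `M₀` -/
  est_pen : WPA1 L.P fun n => {z | (M.Pen (W.est n z).2 : ℝ) ≤ W.M₀}
  sieveParam_mem : ∀ᶠ n in atTop, L.sieveParam M n ∈ W.sieveSpaceM M n
  /-- lower semicontinuity of the population criterion along the alternatives -/
  Q_lsc : ∀ a ∈ M.space, ∀ ε : ℝ, 0 < ε → ∃ r : ℝ, 0 < r ∧ ∀ᶠ n in atTop,
    ∀ α ∈ M.space, strongNorm (α - a) < r → W.Q M M.law a - ε ≤ W.Q M (L.P n) α
  /-- `Q̂_n(Π_n α_n) ≤ c₀ Q(Π_n α_n) + O_P(δ_n²) + o_P(n⁻¹)` -/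
  upper : ∃ c₀ : ℝ, 0 < c₀ ∧ ∃ R₁ R₂ : (n : ℕ) → (Fin n → X × Y) → ℝ,
    BigOP L.P R₁ (fun n => W.δ n ^ 2) ∧ LittleOP L.P R₂ (fun n => (n : ℝ)⁻¹) ∧
    ∀ᶠ n in atTop, ∀ z, W.QHat M n z (L.sieveParam M n) ≤
      c₀ * W.Q M (L.P n) (L.sieveParam M n) + R₁ n z + R₂ n z
  /-- `Q̂_n(α) ≥ c Q(α) - O_P(δ̄_{m,n}²)` uniformly over `A_{k(n)}^{M₀}` -/
  lower : ∃ c : ℝ, 0 < c ∧ ∀ ε : ℝ, 0 < ε → ∃ C : ℝ, ∀ᶠ n in atTop,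
    sampleLaw (L.P n) n {z | ∃ α ∈ W.sieveSpaceM M n,
      W.QHat M n z α < c * W.Q M (L.P n) α - C * W.δbar n ^ 2} ≤ ENNReal.ofReal ε
  /-- local curvature of the population criterion, and `Q̂_n(α) ≥ c Q(α) - O_P(δ_n²)` uniformly
  over `A_osn` -/
  near : ∃ r : ℝ, 0 < r ∧
    (∃ c₁ c₂ : ℝ, 0 < c₁ ∧ ∀ᶠ n in atTop, ∀ α ∈ W.sieveNhd M r n,
      c₁ * W.weakNorm M (α - L.param M n) ^ 2 ≤ W.Q M (L.P n) α ∧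
      W.Q M (L.P n) α ≤ c₂ * W.weakNorm M (α - L.param M n) ^ 2) ∧
    (∃ c : ℝ, 0 < c ∧ ∀ ε : ℝ, 0 < ε → ∃ C : ℝ, ∀ᶠ n in atTop,
      sampleLaw (L.P n) n {z | ∃ α ∈ W.sieveNhd M r n,
        W.QHat M n z α < c * W.Q M (L.P n) α - C * W.δ n ^ 2} ≤ ENNReal.ofReal ε)
  /-- `δ_n²` dominates `Q(Π_n α_n)` and `λ_n` -/
  δ_dom : ∃ C : ℝ, ∀ᶠ n in atTop,
    W.Q M (L.P n) (L.sieveParam M n) ≤ C * W.δ n ^ 2 ∧ W.lam n ≤ C * W.δ n ^ 2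
  /-- the penalty is negligible locally -/
  pen_negl : ∀ ε : ℝ, 0 < ε → ∀ᶠ n in atTop, ∀ α ∈ W.N M n, ∀ β ∈ W.N M n, ∀ t ∈ W.T M n,
    W.lam n * |(M.Pen (α + t • W.u M n).2 : ℝ) - M.Pen β.2| ≤ ε * (n : ℝ)⁻¹

/-- Conditions on the restricted estimator. -/
structure Weighting.RestrictedConditions : Prop where
  estR_min : W.IsApproxMin M L.P M.sieveSpaceR W.estR
  estR_mem : WPA1 L.P fun n => {z | W.estR n z ∈ W.N M n}

/-- Local behaviour of `φ`. -/
structure Weighting.PhiConditions : Prop where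
  riesz_growth : Tendsto (fun n : ℕ => W.weakNorm M (W.riesz n) / √n) atTop (𝓝 0)
  nonlinear : ∀ ε : ℝ, 0 < ε → ∀ᶠ n : ℕ in atTop, ∀ α ∈ W.N M n, ∀ t ∈ W.T M n,
    √n * |M.φ (α + t • W.u M n) - M.φ M.α₀ - M.dφ (α + t • W.u M n - M.α₀)| ≤
      ε * W.weakNorm M (W.riesz n)
  bias : Tendsto (fun n : ℕ => √n * |M.dφ (W.approx n - M.α₀)| / W.weakNorm M (W.riesz n))
    atTop (𝓝 0)

/-- Local quadratic approximation of the sample criterion along `u_n^*`, centred at the true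
parameter `α_n`, under the local alternatives. -/
structure Weighting.LQA : Prop where
  stays : ∀ᶠ n in atTop, ∀ α ∈ W.N M n, ∀ t ∈ W.T M n, α + t • W.u M n ∈ M.sieveSpace n
  B_measurable : ∀ n, Measurable (W.B n)
  B_pos : ∀ n z, 0 < W.B n z
  B_lim : LittleOP L.P (fun n z => W.B n z - W.weakNorm M (W.u M n) ^ 2) (fun _ => 1)
  s_nonneg : ∀ n, 0 ≤ W.s n
  s_small : Tendsto (fun n : ℕ => n * W.s n) atTop (𝓝 0)
  expansion : ∀ ε : ℝ, 0 < ε → Tendsto (fun n : ℕ => sampleLaw (L.P n) n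
    {z | ∃ α ∈ W.N M n, ∃ t ∈ W.T M n,
      ε * max (max (t ^ 2) (|t| * (√n)⁻¹)) (W.s n) <
        |(W.QHat M n z (α + t • W.u M n) - W.QHat M n z α) / 2
          - t * (W.Zn M n (L.param M n) z + W.ip M (W.u M n) (α - L.param M n))
          - W.B n z / 2 * t ^ 2|}) atTop (𝓝 0)
  clt : TendstoStdNormal L.P fun n z => √n * W.Zn M n (L.param M n) z

/-- All conditions that involve one weighting matrix, under the local alternatives. -/
structure Weighting.Conditions : Prop where
  basic : W.Basic M
  near : W.Near M L
  rate : W.RateConditions M L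
  restricted : W.RestrictedConditions M L
  phi : W.PhiConditions M
  lqa : W.LQA M L

end

end SieveQLR

/-! Write `G` for `√n · Zn` at the true parameter minus `shift`, where `shift = √n ⟨u, α_n - α₀⟩`,
and `U` for the weak norm of `u`. The local quadratic approximation says that moving a point `α`
near `α₀` by `s/√n` along `u` changes `n · QHat` by about `2s(G + √n⟨u, α - α₀⟩) + U²s²`. The
restriction makes `√n⟨u, α - α₀⟩` negligible at the restricted estimator, so the constrained and
unconstrained minima differ by about `G²/U²`, and `U² · QLR` behaves like `G²`, the square of an
asymptotically normal variable shifted by `shift`.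

This is proved as two one-sided bounds. `le_QLR` perturbs the restricted estimator toward the
minimum of the parabola. `QLR_le` moves the unrestricted estimator into the restricted set, by the
intermediate value theorem (`exists_restricted`). Both require the unrestricted estimator to lie in
the shrinking neighbourhood, which is derived from the rate conditions (`est_mem_N`).

With `d_n = n^{-1/2} ‖v*‖_sd` the shift for `W` equals `dφ(Δ_n)`, which tends to `κ`, so the left
side converges to `1 - normalWindow κ √t`. For the optimal weighting `U = 1` eventually, and the
shift is `dφ(Δ_n)` times `‖v*‖_sd / ‖v₀*‖`, where `v₀*` is the representer for `W₀`. This ratio is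
at least one by a Gauss–Markov inequality (`weakNorm_riesz_le`). Since `normalWindow` decreases in
the size of its centre, a larger shift means more power. The ratio need not converge; it is only
bounded (`exists_weakNorm_riesz_le`), so the limit inferior is treated along subsequences on which
the shift converges, and only the lower bound for the statistic is needed there. -/

namespace SieveQLR

/-! ### Bounds and measurability for inverse weighting matrices. -/

section MatrixBounds

variable {d : ℕ} {A : Matrix (Fin d) (Fin d) ℝ} {c C : ℝ}

/-- A symmetric matrix whose quadratic form lies between `c |a|²` and `C |a|²`. -/
structure WellConditioned (A : Matrix (Fin d) (Fin d) ℝ) (c C : ℝ) : Prop where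
  pos : 0 < c
  symm : A.IsSymm
  lower : ∀ a : Fin d → ℝ, c * (a ⬝ᵥ a) ≤ a ⬝ᵥ (A *ᵥ a)
  upper : ∀ a : Fin d → ℝ, a ⬝ᵥ (A *ᵥ a) ≤ C * (a ⬝ᵥ a)

theorem dotProduct_self_nonneg' (a : Fin d → ℝ) : 0 ≤ a ⬝ᵥ a :=
  Finset.sum_nonneg fun i _ => mul_self_nonneg (a i)

theorem symm_dotProduct_mulVec (hA : A.IsSymm) (a b : Fin d → ℝ) :
    a ⬝ᵥ (A *ᵥ b) = b ⬝ᵥ (A *ᵥ a) := by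
  rw [Matrix.dotProduct_mulVec, ← Matrix.mulVec_transpose, hA.eq, dotProduct_comm]

namespace WellConditioned

theorem isUnit_det (h : WellConditioned A c C) : IsUnit A.det := by
  rw [isUnit_iff_ne_zero]
  intro h0
  obtain ⟨v, hv, hv0⟩ := Matrix.exists_mulVec_eq_zero_iff.2 h0
  have h1 := h.lower v
  rw [hv0, dotProduct_zero] at h1
  have h2 : v ⬝ᵥ v = 0 :=
    le_antisymm (nonpos_of_mul_nonpos_right h1 h.pos) (dotProduct_self_nonneg' v)
  exact hv (dotProduct_self_eq_zero.1 h2)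

theorem mulVec_inv (h : WellConditioned A c C) (a : Fin d → ℝ) : A *ᵥ (A⁻¹ *ᵥ a) = a := by
  rw [Matrix.mulVec_mulVec, Matrix.mul_nonsing_inv _ h.isUnit_det, Matrix.one_mulVec]

theorem inv_symm (h : WellConditioned A c C) : (A⁻¹).IsSymm := by
  rw [Matrix.IsSymm, Matrix.transpose_nonsing_inv, h.symm.eq]

theorem wprod_comm (h : WellConditioned A c C) (a b : Fin d → ℝ) :
    wprod A a b = wprod A b a := symm_dotProduct_mulVec h.inv_symm a b

theorem wprod_eq (h : WellConditioned A c C) (a b : Fin d → ℝ) :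
    wprod A a b = (A⁻¹ *ᵥ a) ⬝ᵥ b := by
  rw [h.wprod_comm, wprod, dotProduct_comm]

theorem wprod_self (h : WellConditioned A c C) (a : Fin d → ℝ) :
    wprod A a a = (A⁻¹ *ᵥ a) ⬝ᵥ (A *ᵥ (A⁻¹ *ᵥ a)) := by
  rw [h.mulVec_inv, h.wprod_eq]

theorem upper_pos (h : WellConditioned A c C) : WellConditioned A c (max C 1) :=
  ⟨h.pos, h.symm, h.lower, fun a => (h.upper a).trans
    (mul_le_mul_of_nonneg_right (le_max_left _ _) (dotProduct_self_nonneg' a))⟩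

/-- Expanding `|c A⁻¹a - a|² ≥ 0` and bounding `c |A⁻¹a|²` by the lower eigenvalue condition at
`A⁻¹a` avoids any diagonalization. -/
theorem wprod_self_le (h : WellConditioned A c C) (a : Fin d → ℝ) :
    wprod A a a ≤ c⁻¹ * (a ⬝ᵥ a) := by
  have h1 := h.lower (A⁻¹ *ᵥ a)
  rw [← h.wprod_self] at h1
  have h2 := dotProduct_self_nonneg' (c • (A⁻¹ *ᵥ a) - a)
  have h3 : (c • (A⁻¹ *ᵥ a) - a) ⬝ᵥ (c • (A⁻¹ *ᵥ a) - a) =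
      c * (c * ((A⁻¹ *ᵥ a) ⬝ᵥ (A⁻¹ *ᵥ a))) - 2 * c * wprod A a a + a ⬝ᵥ a := by
    rw [h.wprod_eq]
    simp only [sub_dotProduct, dotProduct_sub, smul_dotProduct, dotProduct_smul, smul_eq_mul,
      dotProduct_comm a (A⁻¹ *ᵥ a)]
    ring
  rw [inv_mul_eq_div, le_div_iff₀ h.pos]
  nlinarith [mul_le_mul_of_nonneg_left h1 h.pos.le]

/-- The same argument, with the form of `A` evaluated at `C A⁻¹a - a`. -/
theorem le_wprod_self (h : WellConditioned A c C) (hC : 0 < C) (a : Fin d → ℝ) :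
    C⁻¹ * (a ⬝ᵥ a) ≤ wprod A a a := by
  have h1 := h.upper a
  have h2 := h.lower (C • (A⁻¹ *ᵥ a) - a)
  have h2' := mul_nonneg h.pos.le (dotProduct_self_nonneg' (C • (A⁻¹ *ᵥ a) - a))
  have h3 : (C • (A⁻¹ *ᵥ a) - a) ⬝ᵥ (A *ᵥ (C • (A⁻¹ *ᵥ a) - a)) =
      C * (C * wprod A a a) - 2 * C * (a ⬝ᵥ a) + a ⬝ᵥ (A *ᵥ a) := by
    have e1 : (A⁻¹ *ᵥ a) ⬝ᵥ (A *ᵥ a) = a ⬝ᵥ a := by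
      rw [symm_dotProduct_mulVec h.symm, h.mulVec_inv]
    have e2 : (A⁻¹ *ᵥ a) ⬝ᵥ a = wprod A a a := (h.wprod_eq a a).symm
    simp only [Matrix.mulVec_sub, Matrix.mulVec_smul, h.mulVec_inv, sub_dotProduct, dotProduct_sub,
      smul_dotProduct, dotProduct_smul, smul_eq_mul, e1, e2]
    ring
  rw [inv_mul_eq_div, div_le_iff₀ hC]
  have h4 : 0 ≤ C * (C * wprod A a a - a ⬝ᵥ a) := by nlinarith
  nlinarith [nonneg_of_mul_nonneg_right h4 hC]

theorem wprod_self_nonneg (h : WellConditioned A c C) (a : Fin d → ℝ) : 0 ≤ wprod A a a := by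
  rw [h.wprod_self]
  exact (mul_nonneg h.pos.le (dotProduct_self_nonneg' _)).trans (h.lower _)

theorem inv_dotProduct_inv_le (h : WellConditioned A c C) (a : Fin d → ℝ) :
    (A⁻¹ *ᵥ a) ⬝ᵥ (A⁻¹ *ᵥ a) ≤ c⁻¹ * wprod A a a := by
  rw [inv_mul_eq_div, le_div_iff₀ h.pos, h.wprod_self, mul_comm]
  exact h.lower _

theorem le_inv_dotProduct_inv (h : WellConditioned A c C) (hC : 0 < C) (a : Fin d → ℝ) :
    C⁻¹ * wprod A a a ≤ (A⁻¹ *ᵥ a) ⬝ᵥ (A⁻¹ *ᵥ a) := by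
  rw [inv_mul_eq_div, div_le_iff₀ hC, h.wprod_self, mul_comm]
  exact h.upper _

/-- An entry is at most the length of its column `A⁻¹ e_j`, whose square is at most `c⁻¹ · c⁻¹`. -/
theorem abs_inv_apply_le (h : WellConditioned A c C) (i j : Fin d) : |A⁻¹ i j| ≤ c⁻¹ := by
  have h1 := h.inv_dotProduct_inv_le (Pi.single j 1)
  have h2 := h.wprod_self_le (Pi.single j 1)
  have e : (Pi.single j (1 : ℝ) : Fin d → ℝ) ⬝ᵥ Pi.single j 1 = 1 := by simp
  rw [e, mul_one] at h2
  have hc : 0 < c⁻¹ := inv_pos.2 h.pos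
  have h3 : A⁻¹ i j ^ 2 ≤ (A⁻¹ *ᵥ Pi.single j 1) ⬝ᵥ (A⁻¹ *ᵥ Pi.single j 1) := by
    rw [Matrix.mulVec_single_one]
    refine le_trans (le_of_eq (sq _)) ?_
    exact Finset.single_le_sum (f := fun i => A⁻¹.col j i * A⁻¹.col j i)
      (fun i _ => mul_self_nonneg _) (Finset.mem_univ i)
  refine abs_le_of_sq_le_sq ?_ hc.le
  nlinarith [mul_le_mul_of_nonneg_left h2 hc.le]

/-- The form is nonnegative at `e_i ± e_j` and the diagonal entries are at most `C`; the factor 2 is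
slack. -/
theorem abs_apply_le (h : WellConditioned A c C) (hC : 0 < C) (i j : Fin d) : |A i j| ≤ 2 * C := by
  have key : ∀ t : ℝ, 0 ≤ A i i + t * (2 * A i j) + t ^ 2 * A j j := by
    intro t
    have h0 := (mul_nonneg h.pos.le (dotProduct_self_nonneg' _)).trans
      (h.lower (Pi.single i 1 + t • Pi.single j 1))
    have e : A j i = A i j := h.symm.apply i j
    simp [Matrix.mulVec_add, Matrix.mulVec_smul, add_dotProduct, dotProduct_add, e] at h0
    linarith
  have hd : ∀ i, A i i ≤ C := by
    intro i
    have h0 := h.upper (Pi.single i 1)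
    simpa using h0
  have := key 1
  have := key (-1)
  rw [abs_le]
  constructor <;> linarith [hd i, hd j]

end WellConditioned

/-- By the adjugate formula the entries of the inverse are polynomials in the entries divided by the
determinant. -/
theorem measurable_inv_apply {X : Type*} [MeasurableSpace X]
    {S : X → Matrix (Fin d) (Fin d) ℝ} (hS : ∀ i j, Measurable fun x => S x i j) (i j : Fin d) :
    Measurable fun x => (S x)⁻¹ i j := by
  have hdet : ∀ T : X → Matrix (Fin d) (Fin d) ℝ, (∀ i j, Measurable fun x => T x i j) →
      Measurable fun x => (T x).det := by
    intro T hT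
    simp only [Matrix.det_apply]
    exact Finset.measurable_sum _ fun σ _ => (Finset.measurable_prod _ fun i _ => hT _ _).const_smul _
  simp only [Matrix.inv_def, Matrix.smul_apply, Ring.inverse_eq_inv', smul_eq_mul,
    Matrix.adjugate_apply]
  refine (hdet S hS).inv.mul (hdet _ fun k l => ?_)
  by_cases hk : k = j
  · subst hk; simp
  · simpa [Matrix.updateRow_ne hk] using hS k l

theorem MemLp.mulVec_of_bounded {X : Type*} [MeasurableSpace X] {μ : Measure X}
    {S : X → Matrix (Fin d) (Fin d) ℝ} {K : ℝ} (hS : ∀ i j, Measurable fun x => S x i j)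
    (hK : ∀ x i j, |S x i j| ≤ K) {f : X → Fin d → ℝ} (hf : MemLp f 2 μ) :
    MemLp (fun x => S x *ᵥ f x) 2 μ := by
  rw [memLp_pi_iff] at hf ⊢
  intro i
  simp only [Matrix.mulVec, dotProduct]
  refine memLp_finsetSum _ fun j _ => ?_
  refine MemLp.of_le_mul (c := K) (hf j) ((hS i j).aestronglyMeasurable.mul (hf j).1) ?_
  refine Eventually.of_forall fun x => ?_
  rw [norm_mul]
  exact mul_le_mul_of_nonneg_right (hK x i j) (norm_nonneg _)

theorem MemLp.integrable_dotProduct {X : Type*} [MeasurableSpace X] {μ : Measure X}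
    {f g : X → Fin d → ℝ} (hf : MemLp f 2 μ) (hg : MemLp g 2 μ) :
    Integrable (fun x => f x ⬝ᵥ g x) μ := by
  simp only [dotProduct]
  exact integrable_finsetSum _ fun i _ => (hf.eval i).integrable_mul (hg.eval i)

end MatrixBounds

/-! ### Geometry of the weak norm, ill-posedness, and efficiency of the optimal weighting. -/

section Population

set_option linter.unusedSectionVars false

variable {dθ dρ : ℕ} {X Y H : Type*} [MeasurableSpace X] [MeasurableSpace Y]
  [StandardBorelSpace Y] [Nonempty Y] [NormedAddCommGroup H] [NormedSpace ℝ H]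
  {M : Model dθ dρ X Y H} {W W₀ : Weighting dθ dρ X Y H}

theorem Weighting.Basic.wellConditioned (hW : W.Basic M) :
    ∃ c C : ℝ, 0 < C ∧ ∀ x, WellConditioned (W.Sig x) c C := by
  obtain ⟨c, C, hc, h⟩ := hW.Sig_eigen
  refine ⟨c, max C 1, lt_max_of_lt_right one_pos, fun x => ?_⟩
  exact WellConditioned.upper_pos
    ⟨hc, hW.Sig_symm x, fun a => (h x a).1, fun a => (h x a).2⟩

theorem Weighting.Basic.memLp_inv_mulVec (hW : W.Basic M) {μ : Measure X} {f : X → Fin dρ → ℝ}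
    (hf : MemLp f 2 μ) : MemLp (fun x => (W.Sig x)⁻¹ *ᵥ f x) 2 μ := by
  obtain ⟨c, C, hC, h⟩ := hW.wellConditioned
  exact MemLp.mulVec_of_bounded (measurable_inv_apply hW.Sig_measurable)
    (fun x i j => (h x).abs_inv_apply_le i j) hf

theorem Weighting.Basic.memLp_mulVec (hW : W.Basic M) {μ : Measure X} {f : X → Fin dρ → ℝ}
    (hf : MemLp f 2 μ) : MemLp (fun x => W.Sig x *ᵥ f x) 2 μ := by
  obtain ⟨c, C, hC, h⟩ := hW.wellConditioned
  exact MemLp.mulVec_of_bounded hW.Sig_measurable (fun x i j => (h x).abs_apply_le hC i j) hf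

theorem Weighting.Basic.integrable_wprod (hW : W.Basic M) {μ : Measure X}
    {f g : X → Fin dρ → ℝ} (hf : MemLp f 2 μ) (hg : MemLp g 2 μ) :
    Integrable (fun x => wprod (W.Sig x) (f x) (g x)) μ :=
  MemLp.integrable_dotProduct hf (hW.memLp_inv_mulVec hg)

theorem Model.sub_mem_V {α : Param dθ H} {j : ℕ} (h : α.2 ∈ M.sieve j) : α - M.α₀ ∈ M.V :=
  Submodule.subset_span ⟨α, ⟨j, h⟩, rfl⟩

/-- `α₀` need not lie in any sieve, but `0` does, so `-α₀` is one of the generating differences.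
Consequently all sieve tangent spaces lie in `V`. -/
theorem Model.α₀_mem_V : M.α₀ ∈ M.V := by
  have h : (0 : Param dθ H) - M.α₀ ∈ M.V :=
    M.sub_mem_V (j := 0) (by rw [Prod.snd_zero]; exact zero_mem _)
  simpa using neg_mem h

theorem Model.tangent_le_V (n : ℕ) : M.tangent n ≤ M.V := by
  intro v hv
  have h : v - M.α₀ ∈ M.V := M.sub_mem_V (j := M.k n) (Submodule.mem_prod.1 hv).2
  simpa using add_mem h M.α₀_mem_V

theorem Model.sieveSpace_subset_tangent (n : ℕ) {α : Param dθ H} (h : α ∈ M.sieveSpace n) :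
    α ∈ M.tangent n :=
  Submodule.mem_prod.2 ⟨trivial, h.2⟩

theorem Weighting.ip_comm (hW : W.Basic M) (v w : Param dθ H) : W.ip M v w = W.ip M w v := by
  obtain ⟨c, C, hC, h⟩ := hW.wellConditioned
  exact integral_congr_ae (Eventually.of_forall fun x => (h x).wprod_comm _ _)

theorem Weighting.ip_add_smul (hM : M.Regular) (hW : W.Basic M) {v w y : Param dθ H}
    (hv : v ∈ M.V) (hw : w ∈ M.V) (hy : y ∈ M.V) (a b : ℝ) :
    W.ip M y (a • v + b • w) = a * W.ip M y v + b * W.ip M y w := by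
  unfold Weighting.ip
  rw [← integral_const_mul, ← integral_const_mul, ← integral_add]
  · refine integral_congr_ae ?_
    filter_upwards [hM.dm_linear v hv w hw a b] with x hx
    simp only [hx, wprod, Matrix.mulVec_add, Matrix.mulVec_smul, dotProduct_add, dotProduct_smul,
      smul_eq_mul]
  · exact (hW.integrable_wprod (hM.dm_memLp y hy) (hM.dm_memLp v hv)).const_mul _
  · exact (hW.integrable_wprod (hM.dm_memLp y hy) (hM.dm_memLp w hw)).const_mul _

/-- The bilinear form `⟨v, w⟩` on `V`. -/
noncomputable def Weighting.form (hM : M.Regular) (hW : W.Basic M) : LinearMap.BilinForm ℝ M.V :=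
  LinearMap.mk₂ ℝ (fun v w => W.ip M v w)
    (fun v w y => by
      have := W.ip_add_smul hM hW v.2 w.2 y.2 1 1
      simp only [one_smul, one_mul] at this
      rw [W.ip_comm hW, W.ip_comm hW v, W.ip_comm hW w]
      exact this)
    (fun a v y => by
      have := W.ip_add_smul hM hW v.2 v.2 y.2 a 0
      simp only [zero_smul, add_zero, zero_mul] at this
      rw [W.ip_comm hW, W.ip_comm hW v]
      exact this)
    (fun y v w => by
      have := W.ip_add_smul hM hW v.2 w.2 y.2 1 1
      simp only [one_smul, one_mul] at this
      exact this)
    (fun a y v => by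
      have := W.ip_add_smul hM hW v.2 v.2 y.2 a 0
      simp only [zero_smul, add_zero, zero_mul] at this
      exact this)

theorem Weighting.ip_self_nonneg (hW : W.Basic M) (v : Param dθ H) : 0 ≤ W.ip M v v := by
  obtain ⟨c, C, hC, h⟩ := hW.wellConditioned
  exact integral_nonneg fun x => (h x).wprod_self_nonneg _

theorem Weighting.weakNorm_nonneg (v : Param dθ H) : 0 ≤ W.weakNorm M v := Real.sqrt_nonneg _

theorem Weighting.weakNorm_sq (hW : W.Basic M) (v : Param dθ H) :
    W.weakNorm M v ^ 2 = W.ip M v v := Real.sq_sqrt (W.ip_self_nonneg hW v)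

theorem Weighting.sdNorm_nonneg (v : Param dθ H) : 0 ≤ W.sdNorm M v := Real.sqrt_nonneg _

section
variable (hM : M.Regular) (hW : W.Basic M) {v w y : Param dθ H}
include hM hW

theorem Weighting.ip_add (hv : v ∈ M.V) (hw : w ∈ M.V) (hy : y ∈ M.V) :
    W.ip M y (v + w) = W.ip M y v + W.ip M y w :=
  (W.form hM hW ⟨y, hy⟩).map_add ⟨v, hv⟩ ⟨w, hw⟩

theorem Weighting.ip_sub (hv : v ∈ M.V) (hw : w ∈ M.V) (hy : y ∈ M.V) :
    W.ip M y (v - w) = W.ip M y v - W.ip M y w :=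
  (W.form hM hW ⟨y, hy⟩).map_sub ⟨v, hv⟩ ⟨w, hw⟩

theorem Weighting.ip_smul (hv : v ∈ M.V) (hy : y ∈ M.V) (a : ℝ) :
    W.ip M y (a • v) = a * W.ip M y v :=
  (W.form hM hW ⟨y, hy⟩).map_smul a ⟨v, hv⟩

/-- Cauchy–Schwarz for a positive semidefinite form: definiteness is assumed only on the sieve
tangent spaces, not on `V`. -/
theorem Weighting.abs_ip_le (hv : v ∈ M.V) (hw : w ∈ M.V) :
    |W.ip M v w| ≤ W.weakNorm M v * W.weakNorm M w := by
  refine abs_le_of_sq_le_sq ?_ (mul_nonneg (W.weakNorm_nonneg _) (W.weakNorm_nonneg _))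
  rw [mul_pow, W.weakNorm_sq hW, W.weakNorm_sq hW]
  exact LinearMap.BilinForm.apply_sq_le_of_symm (W.form hM hW)
    (fun x => W.ip_self_nonneg hW x) ⟨fun x y => W.ip_comm hW x y⟩ ⟨v, hv⟩ ⟨w, hw⟩

theorem Weighting.weakNorm_smul (hv : v ∈ M.V) (a : ℝ) :
    W.weakNorm M (a • v) = |a| * W.weakNorm M v := by
  unfold Weighting.weakNorm
  rw [W.ip_smul hM hW hv (M.V.smul_mem a hv), W.ip_comm hW, W.ip_smul hM hW hv hv,
    ← mul_assoc, Real.sqrt_mul (mul_self_nonneg a), Real.sqrt_mul_self_eq_abs]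

theorem Weighting.weakNorm_add_le (hv : v ∈ M.V) (hw : w ∈ M.V) :
    W.weakNorm M (v + w) ≤ W.weakNorm M v + W.weakNorm M w := by
  refine abs_le_of_sq_le_sq' ?_
    (add_nonneg (W.weakNorm_nonneg _) (W.weakNorm_nonneg _)) |>.2
  have h : W.ip M (v + w) (v + w) = W.ip M v v + 2 * W.ip M v w + W.ip M w w := by
    rw [W.ip_add hM hW hv hw (add_mem hv hw), W.ip_comm hW _ v, W.ip_comm hW _ w,
      W.ip_add hM hW hv hw hv, W.ip_add hM hW hv hw hw, W.ip_comm hW w v]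
    ring
  rw [W.weakNorm_sq hW, h, add_sq, W.weakNorm_sq hW, W.weakNorm_sq hW]
  nlinarith [le_abs_self (W.ip M v w), W.abs_ip_le hM hW hv hw]

theorem Weighting.weakNorm_neg (hv : v ∈ M.V) : W.weakNorm M (-v) = W.weakNorm M v := by
  simpa using W.weakNorm_smul hM hW hv (-1)

theorem Weighting.weakNorm_sub_le (hv : v ∈ M.V) (hw : w ∈ M.V) :
    W.weakNorm M (v - w) ≤ W.weakNorm M v + W.weakNorm M w := by
  rw [sub_eq_add_neg, ← W.weakNorm_neg hM hW hw]
  exact W.weakNorm_add_le hM hW hv (neg_mem hw)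

theorem Weighting.weakNorm_zero : W.weakNorm M 0 = 0 := by
  simpa using W.weakNorm_smul hM hW (M.V.zero_mem) 0

/-- The best approximation is the orthogonal projection. -/
theorem Weighting.ip_approx (n : ℕ) (hv : v ∈ M.tangent n) :
    W.ip M v (W.approx n - M.α₀) = 0 := by
  have hvV := M.tangent_le_V n hv
  have ha : W.approx n - M.α₀ ∈ M.V :=
    sub_mem (M.tangent_le_V n (hW.approx_mem n)) M.α₀_mem_V
  have key : ∀ t : ℝ,
      0 ≤ 2 * t * W.ip M v (W.approx n - M.α₀) + t ^ 2 * W.ip M v v := by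
    intro t
    have h1 := hW.approx_min n (W.approx n + t • v)
      (add_mem (hW.approx_mem n) ((M.tangent n).smul_mem t hv))
    have h2 := pow_le_pow_left₀ (W.weakNorm_nonneg _) h1 2
    have e : W.approx n + t • v - M.α₀ = (W.approx n - M.α₀) + t • v := by abel
    have htv := M.V.smul_mem t hvV
    rw [W.weakNorm_sq hW, W.weakNorm_sq hW, e, W.ip_add hM hW ha htv (add_mem ha htv),
      W.ip_comm hW (W.approx n - M.α₀ + t • v) (W.approx n - M.α₀),
      W.ip_comm hW (W.approx n - M.α₀ + t • v) (t • v), W.ip_add hM hW ha htv ha,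
      W.ip_add hM hW ha htv htv, W.ip_comm hW (t • v) (W.approx n - M.α₀),
      W.ip_smul hM hW hvV ha, W.ip_smul hM hW hvV htv, W.ip_comm hW (t • v) v,
      W.ip_smul hM hW hvV hvV, W.ip_comm hW (W.approx n - M.α₀) v] at h2
    linarith
  set p := W.ip M v (W.approx n - M.α₀)
  set q := W.ip M v v
  have hq : 0 ≤ q := W.ip_self_nonneg hW v
  -- This `t` makes `2tp + t²q` negative unless `p = 0`; dividing by `q + 1` rather than `q` covers
  -- `q = 0`.
  have h3 := key (-(p / (q + 1)))
  have h4 : 2 * (-(p / (q + 1))) * p + (-(p / (q + 1))) ^ 2 * q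
      = -(p ^ 2 * (q + 2) / (q + 1) ^ 2) := by
    field_simp
    ring
  rw [h4] at h3
  have h5 : p ^ 2 * (q + 2) / (q + 1) ^ 2 ≤ 0 := by linarith
  rw [div_le_iff₀ (by positivity), zero_mul] at h5
  have h6 : p ^ 2 ≤ 0 := nonpos_of_mul_nonpos_left h5 (by linarith)
  exact pow_eq_zero_iff two_ne_zero |>.1 (le_antisymm h6 (sq_nonneg p))

/-- A vanishing criterion forces the conditional mean to vanish almost surely, because the
eigenvalues of `Σ` are bounded; identification then gives `a = α₀`. -/
theorem Weighting.Q_pos {a : Param dθ H} (ha : a ∈ M.space) (hne : a ≠ M.α₀) :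
    0 < W.Q M M.law a := by
  obtain ⟨c, C, hC, h⟩ := hW.wellConditioned
  obtain ⟨-, h2, h3⟩ := hM.identified
  have hn : 0 ≤ W.Q M M.law a := integral_nonneg fun x => (h x).wprod_self_nonneg _
  refine hn.lt_of_ne fun h0 => hne ((h3 a ha).1 ?_)
  have h4 := (integral_eq_zero_iff_of_nonneg (fun x => (h x).wprod_self_nonneg _)
    (hW.integrable_wprod (h2 a ha).2 (h2 a ha).2)).1 h0.symm
  filter_upwards [h4] with x hx
  have h5 := (h x).le_wprod_self hC (M.condMean M.law a x)
  simp only [Pi.zero_apply] at hx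
  rw [hx] at h5
  have h6 : M.condMean M.law a x ⬝ᵥ M.condMean M.law a x = 0 :=
    le_antisymm (nonpos_of_mul_nonpos_right h5 (inv_pos.2 hC)) (dotProduct_self_nonneg' _)
  exact dotProduct_self_eq_zero.1 h6

end

/-- In finite dimension a seminorm is continuous, being convex, and a definite one has a positive
minimum on the unit sphere. -/
theorem exists_norm_le_seminorm {E : Type*} [NormedAddCommGroup E] [NormedSpace ℝ E]
    [FiniteDimensional ℝ E] (p : Seminorm ℝ E) (hp : ∀ x, p x = 0 → x = 0) :
    ∃ C : ℝ, ∀ x, ‖x‖ ≤ C * p x := by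
  have hcont : Continuous p := by
    rw [← continuousOn_univ]
    exact p.convexOn.continuousOn isOpen_univ
  have := FiniteDimensional.proper ℝ E
  rcases (Metric.sphere (0 : E) 1).eq_empty_or_nonempty with h | h
  · refine ⟨0, fun x => ?_⟩
    by_contra! hx
    rw [zero_mul] at hx
    have : (‖x‖⁻¹ • x) ∈ Metric.sphere (0 : E) 1 := by
      simp [norm_smul, hx.ne']
    rw [h] at this
    exact this
  · obtain ⟨y, hy, hmin⟩ := (isCompact_sphere (0 : E) 1).exists_isMinOn h hcont.continuousOn
    have hy1 : ‖y‖ = 1 := by simpa using hy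
    have hpy : 0 < p y := (apply_nonneg p y).lt_of_ne fun h0 => by
      rw [hp y h0.symm, norm_zero] at hy1
      exact zero_ne_one hy1
    refine ⟨(p y)⁻¹, fun x => ?_⟩
    by_cases hx : x = 0
    · simp [hx]
    have hx' : 0 < ‖x‖ := norm_pos_iff.2 hx
    have : (‖x‖⁻¹ • x) ∈ Metric.sphere (0 : E) 1 := by
      simp [norm_smul, hx]
    have h2 : p y ≤ p (‖x‖⁻¹ • x) := hmin this
    rw [map_smul_eq_mul, norm_inv, norm_norm, inv_mul_eq_div, le_div_iff₀ hx'] at h2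
    rw [inv_mul_eq_div, le_div_iff₀ hpy, mul_comm]
    exact h2

theorem strongNorm_nonneg (v : Param dθ H) : 0 ≤ strongNorm v :=
  add_nonneg (norm_nonneg _) (norm_nonneg _)

theorem strongNorm_add_le (v w : Param dθ H) :
    strongNorm (v + w) ≤ strongNorm v + strongNorm w := by
  have h1 := norm_add_le v.1 w.1
  have h2 := norm_add_le v.2 w.2
  simp only [strongNorm, Prod.fst_add, Prod.snd_add]
  linarith

theorem strongNorm_smul (a : ℝ) (v : Param dθ H) : strongNorm (a • v) = |a| * strongNorm v := by
  simp only [strongNorm, Prod.smul_fst, Prod.smul_snd, norm_smul, Real.norm_eq_abs]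
  ring

theorem strongNorm_pos {v : Param dθ H} (hv : v ≠ 0) : 0 < strongNorm v := by
  refine (strongNorm_nonneg v).lt_of_ne fun h => hv ?_
  have h1 : ‖v.1‖ = 0 := by
    have := norm_nonneg v.1; have := norm_nonneg v.2; unfold strongNorm at h; linarith
  have h2 : ‖v.2‖ = 0 := by
    have := norm_nonneg v.1; have := norm_nonneg v.2; unfold strongNorm at h; linarith
  exact Prod.ext (norm_eq_zero.1 h1) (norm_eq_zero.1 h2)

theorem Weighting.strongNorm_le_ill (hM : M.Regular) (hW : W.Basic M) (n : ℕ) {v : Param dθ H}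
    (hv : v ∈ M.tangent n) : strongNorm v ≤ W.ill M n * W.weakNorm M v := by
  by_cases h0 : W.weakNorm M v = 0
  · rw [hW.weakNorm_ne n v hv h0, W.weakNorm_zero hM hW]
    simp [strongNorm]
  have hpos : 0 < W.weakNorm M v := (W.weakNorm_nonneg v).lt_of_ne (Ne.symm h0)
  have : FiniteDimensional ℝ (M.tangent n) :=
    Module.Finite.iff_fg.2 (Submodule.FG.prod (Module.Finite.fg_top)
      (Module.Finite.iff_fg.1 (hM.sieve_finite (M.k n))))
  let p : Seminorm ℝ (M.tangent n) := Seminorm.of (fun v => W.weakNorm M v)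
    (fun v w => W.weakNorm_add_le hM hW (M.tangent_le_V n v.2) (M.tangent_le_V n w.2))
    (fun a v => W.weakNorm_smul hM hW (M.tangent_le_V n v.2) a)
  obtain ⟨C, hC⟩ := exists_norm_le_seminorm p
    (fun x hx => Subtype.ext (hW.weakNorm_ne n x x.2 hx))
  rw [← div_le_iff₀ hpos]
  -- Boundedness must be shown, as a real `sSup` of an unbounded set would be `0`; it comes from
  -- finite dimensionality of the sieve tangent space.
  refine le_csSup ⟨2 * C, ?_⟩ ⟨v, hv, h0, rfl⟩
  rintro r ⟨w, hw, hw0, rfl⟩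
  have hwpos : 0 < W.weakNorm M w := (W.weakNorm_nonneg w).lt_of_ne (Ne.symm hw0)
  rw [div_le_iff₀ hwpos]
  have h1 : ‖w‖ ≤ C * W.weakNorm M w := hC ⟨w, hw⟩
  have h2 : strongNorm w ≤ 2 * ‖w‖ := by
    have := norm_fst_le w; have := norm_snd_le w; unfold strongNorm; linarith
  linarith

theorem Weighting.ill_nonneg (n : ℕ) : 0 ≤ W.ill M n := by
  refine Real.sSup_nonneg ?_
  rintro r ⟨w, -, -, rfl⟩
  exact div_nonneg (strongNorm_nonneg _) (W.weakNorm_nonneg _)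

theorem Weighting.δs_nonneg (hW : W.Basic M) (n : ℕ) : 0 ≤ W.δs M n :=
  add_nonneg (norm_nonneg _) (mul_nonneg (W.ill_nonneg n) (hW.δ_pos n).le)

/-! ### The sieve standard deviation norm -/

/-- The conditional mean of the residual at `α₀` vanishes, so the centring in `Sig₀` drops out and
second moments remain. The null set does not depend on `b`, so `b` may later depend on `x`. -/
theorem Model.Sig₀_quadratic (hM : M.Regular) :
    ∀ᵐ x ∂(M.law : Measure (X × Y)).fst, ∀ b : Fin dρ → ℝ,
      ∫ y, (b ⬝ᵥ M.residual (x, y) M.α₀) ^ 2 ∂((M.law : Measure (X × Y)).condKernel x) =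
        b ⬝ᵥ (M.Sig₀ x *ᵥ b) ∧
      Integrable (fun y => (b ⬝ᵥ M.residual (x, y) M.α₀) ^ 2)
        ((M.law : Measure (X × Y)).condKernel x) := by
  have hint : ∀ i j, Integrable (fun z => M.residual z M.α₀ i * M.residual z M.α₀ j)
      (M.law : Measure (X × Y)) := fun i j =>
    (hM.residual_memLp.eval i).integrable_mul (hM.residual_memLp.eval j)
  have h1 : ∀ᵐ x ∂(M.law : Measure (X × Y)).fst, ∀ i j,
      Integrable (fun y => M.residual (x, y) M.α₀ i * M.residual (x, y) M.α₀ j)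
        ((M.law : Measure (X × Y)).condKernel x) := by
    rw [ae_all_iff]; intro i; rw [ae_all_iff]; intro j
    exact (hint i j).condKernel_ae
  have h0 := (hM.identified.2.2 M.α₀ hM.identified.1).2 rfl
  filter_upwards [h1, h0] with x hx hx0 b
  have e : ∀ y, (b ⬝ᵥ M.residual (x, y) M.α₀) ^ 2 =
      ∑ i, ∑ j, b i * b j * (M.residual (x, y) M.α₀ i * M.residual (x, y) M.α₀ j) := by
    intro y
    rw [sq, dotProduct, Finset.sum_mul_sum]
    exact Finset.sum_congr rfl fun i _ => Finset.sum_congr rfl fun j _ => by ring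
  have hi : ∀ i j, Integrable (fun y => b i * b j *
      (M.residual (x, y) M.α₀ i * M.residual (x, y) M.α₀ j))
        ((M.law : Measure (X × Y)).condKernel x) := fun i j => (hx i j).const_mul _
  simp only [e]
  refine ⟨?_, integrable_finsetSum _ fun i _ => integrable_finsetSum _ fun j _ => hi i j⟩
  rw [integral_finsetSum _ fun i _ => integrable_finsetSum _ fun j _ => hi i j]
  simp only [dotProduct, Matrix.mulVec, Finset.mul_sum]
  refine Finset.sum_congr rfl fun i _ => ?_
  rw [integral_finsetSum _ fun j _ => hi i j]
  refine Finset.sum_congr rfl fun j _ => ?_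
  rw [integral_const_mul]
  simp only [Model.Sig₀, Matrix.of_apply, hx0, Pi.zero_apply, sub_zero]
  ring

theorem Weighting.measurable_score (hM : M.Regular) (hW : W.Basic M) {v : Param dθ H}
    (hv : v ∈ M.V) (α : Param dθ H) : Measurable (W.score M v α) := by
  unfold Weighting.score
  simp only [wprod, Matrix.mulVec, dotProduct]
  refine Finset.measurable_sum _ fun i _ => Measurable.mul ?_ (Finset.measurable_sum _ fun j _ =>
    ((measurable_inv_apply hW.Sig_measurable i j).comp measurable_fst).mul ?_)
  · exact (measurable_pi_apply i).comp ((hM.dm_measurable v hv).comp measurable_fst)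
  · exact (measurable_pi_apply j).comp (hM.residual_measurable α)

/-- The variance norm as a quadratic form in the conditional variance of the residual. -/
theorem Weighting.sdNorm_sq (hM : M.Regular) (hW : W.Basic M) (hW₀ : W₀.Basic M)
    (hopt : ∀ᵐ x ∂(M.law : Measure (X × Y)).fst, W₀.Sig x = M.Sig₀ x) {v : Param dθ H}
    (hv : v ∈ M.V) :
    W.sdNorm M v ^ 2 = ∫ x, ((W.Sig x)⁻¹ *ᵥ M.dm v x) ⬝ᵥ
      (W₀.Sig x *ᵥ ((W.Sig x)⁻¹ *ᵥ M.dm v x)) ∂(M.law : Measure (X × Y)).fst := by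
  obtain ⟨c, C, hC, h⟩ := hW.wellConditioned
  obtain ⟨c₀, C₀, hC₀, h₀⟩ := hW₀.wellConditioned
  set b : X → Fin dρ → ℝ := fun x => (W.Sig x)⁻¹ *ᵥ M.dm v x with hb
  have hbL : MemLp b 2 (M.law : Measure (X × Y)).fst := hW.memLp_inv_mulVec (hM.dm_memLp v hv)
  have hscore : W.score M v M.α₀ = fun z => b z.1 ⬝ᵥ M.residual z M.α₀ := by
    funext z
    exact (h z.1).wprod_eq _ _
  have hmeas : Measurable (W.score M v M.α₀) := W.measurable_score hM hW hv M.α₀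
  have hquad : ∀ᵐ x ∂(M.law : Measure (X × Y)).fst,
      ∫ y, W.score M v M.α₀ (x, y) ^ 2 ∂((M.law : Measure (X × Y)).condKernel x) =
        b x ⬝ᵥ (W₀.Sig x *ᵥ b x) ∧
      Integrable (fun y => W.score M v M.α₀ (x, y) ^ 2)
        ((M.law : Measure (X × Y)).condKernel x) := by
    filter_upwards [M.Sig₀_quadratic hM, hopt] with x hx hx0
    rw [hscore, hx0]
    exact hx (b x)
  have hbint : Integrable (fun x => b x ⬝ᵥ (W₀.Sig x *ᵥ b x)) (M.law : Measure (X × Y)).fst :=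
    MemLp.integrable_dotProduct hbL (hW₀.memLp_mulVec hbL)
  -- A product of two square integrable factors need not be square integrable. Here the conditional
  -- second moment is controlled by `Σ₀`, which is bounded since it agrees almost everywhere with
  -- `W₀.Sig`.
  have hsq : Integrable (fun z => W.score M v M.α₀ z ^ 2) (M.law : Measure (X × Y)) := by
    rw [← AEStronglyMeasurable.ae_integrable_condKernel_iff (hmeas.pow_const 2).aestronglyMeasurable]
    refine ⟨hquad.mono fun x hx => hx.2, hbint.congr ?_⟩
    filter_upwards [hquad] with x hx
    rw [← hx.1]
    exact integral_congr_ae (Eventually.of_forall fun y => by simp)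
  have hL2 : MemLp (W.score M v M.α₀) 2 (M.law : Measure (X × Y)) :=
    (memLp_two_iff_integrable_sq hmeas.aestronglyMeasurable).2 hsq
  have hmean : ∫ z, W.score M v M.α₀ z ∂(M.law : Measure (X × Y)) = 0 := by
    rw [← Measure.integral_condKernel (hL2.integrable one_le_two)]
    rw [← integral_zero X ℝ (μ := (M.law : Measure (X × Y)).fst)]
    refine integral_congr_ae ?_
    have hres := hM.residual_memLp.integrable one_le_two
    filter_upwards [(hM.identified.2.2 M.α₀ hM.identified.1).2 rfl, hres.condKernel_ae] with x hx hi
    rw [hscore]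
    simp only [dotProduct]
    rw [integral_finsetSum _ fun i _ => (hi.eval i).const_mul _]
    refine Finset.sum_eq_zero fun i _ => ?_
    rw [integral_const_mul]
    have : ∫ y, M.residual (x, y) M.α₀ i ∂((M.law : Measure (X × Y)).condKernel x)
        = M.condMean M.law M.α₀ x i := (eval_integral (fun i => hi.eval i) i).symm
    rw [this, hx]
    simp
  unfold Weighting.sdNorm
  rw [Real.sq_sqrt (variance_nonneg _ _), variance_of_integral_eq_zero hmeas.aemeasurable hmean,
    ← Measure.integral_condKernel hsq]
  exact integral_congr_ae (hquad.mono fun x hx => hx.1)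

/-- The variance norm and the weak norm are equivalent. -/
theorem Weighting.exists_sdNorm_equiv (hM : M.Regular) (hW : W.Basic M) (hW₀ : W₀.Basic M)
    (hopt : ∀ᵐ x ∂(M.law : Measure (X × Y)).fst, W₀.Sig x = M.Sig₀ x) :
    ∃ a b : ℝ, 0 < a ∧ 0 < b ∧ ∀ v ∈ M.V, a * W.sdNorm M v ≤ W.weakNorm M v ∧
      W.weakNorm M v ≤ b * W.sdNorm M v := by
  obtain ⟨c, C, hC, h⟩ := hW.wellConditioned
  obtain ⟨c₀, C₀, hC₀, h₀⟩ := hW₀.wellConditioned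
  -- Positivity of `c` and `c₀` is a field of `WellConditioned`, hence available only at a point of
  -- `X`.
  by_cases hX : Nonempty X
  swap
  · refine ⟨1, 1, one_pos, one_pos, fun v hv => ?_⟩
    have e : (M.law : Measure (X × Y)).fst = 0 := by
      have := not_nonempty_iff.1 hX
      exact Measure.eq_zero_of_isEmpty _
    have h1 : W.sdNorm M v ^ 2 = 0 := by rw [W.sdNorm_sq hM hW hW₀ hopt hv, e]; simp
    have h2 : W.weakNorm M v ^ 2 = 0 := by rw [W.weakNorm_sq hW, Weighting.ip, e]; simp
    rw [pow_eq_zero_iff two_ne_zero] at h1 h2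
    rw [h1, h2]; simp
  obtain ⟨x₀⟩ := hX
  have hc := (h x₀).pos
  have hc₀ := (h₀ x₀).pos
  have key : ∀ v ∈ M.V, W.sdNorm M v ^ 2 ≤ C₀ * c⁻¹ * W.weakNorm M v ^ 2 ∧
      c₀ * C⁻¹ * W.weakNorm M v ^ 2 ≤ W.sdNorm M v ^ 2 := by
    intro v hv
    have hL := hM.dm_memLp v hv
    have hbL := hW.memLp_inv_mulVec hL
    have hi1 := hW.integrable_wprod hL hL
    have hi2 := MemLp.integrable_dotProduct hbL (hW₀.memLp_mulVec hbL)
    rw [W.sdNorm_sq hM hW hW₀ hopt hv, W.weakNorm_sq hW, Weighting.ip, ← integral_const_mul,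
      ← integral_const_mul]
    constructor
    · refine integral_mono hi2 (hi1.const_mul _) fun x => ?_
      have h1 := (h₀ x).upper ((W.Sig x)⁻¹ *ᵥ M.dm v x)
      have h2 := mul_le_mul_of_nonneg_left ((h x).inv_dotProduct_inv_le (M.dm v x)) hC₀.le
      simp only [mul_assoc] at *
      exact h1.trans h2
    · refine integral_mono (hi1.const_mul _) hi2 fun x => ?_
      have h1 := (h₀ x).lower ((W.Sig x)⁻¹ *ᵥ M.dm v x)
      have h2 := mul_le_mul_of_nonneg_left ((h x).le_inv_dotProduct_inv hC (M.dm v x)) hc₀.le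
      simp only [mul_assoc] at *
      exact h2.trans h1
  refine ⟨√((C₀ * c⁻¹)⁻¹), √((c₀ * C⁻¹)⁻¹), by positivity, by positivity, fun v hv => ?_⟩
  obtain ⟨h1, h2⟩ := key v hv
  have hs : 0 ≤ W.sdNorm M v := Real.sqrt_nonneg _
  have hw := W.weakNorm_nonneg (M := M) v
  constructor
  · refine abs_le_of_sq_le_sq' ?_ hw |>.2
    rw [mul_pow, Real.sq_sqrt (by positivity), inv_mul_eq_div, div_le_iff₀ (by positivity),
      mul_comm (W.weakNorm M v ^ 2)]
    exact h1
  · refine abs_le_of_sq_le_sq' ?_ (by positivity) |>.2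
    rw [mul_pow, Real.sq_sqrt (by positivity), inv_mul_eq_div, le_div_iff₀ (by positivity),
      mul_comm (W.weakNorm M v ^ 2)]
    exact h2

/-- The sandwich `Σ⁻¹ Σ₀ Σ⁻¹` collapses to `Σ₀⁻¹` when the weighting is optimal. -/
theorem Weighting.sdNorm_eq_weakNorm (hM : M.Regular) (hW₀ : W₀.Basic M)
    (hopt : ∀ᵐ x ∂(M.law : Measure (X × Y)).fst, W₀.Sig x = M.Sig₀ x) {v : Param dθ H}
    (hv : v ∈ M.V) : W₀.sdNorm M v = W₀.weakNorm M v := by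
  obtain ⟨c₀, C₀, hC₀, h₀⟩ := hW₀.wellConditioned
  have h : W₀.sdNorm M v ^ 2 = W₀.weakNorm M v ^ 2 := by
    rw [W₀.sdNorm_sq hM hW₀ hW₀ hopt hv, W₀.weakNorm_sq hW₀]
    exact integral_congr_ae (Eventually.of_forall fun x => ((h₀ x).wprod_self _).symm)
  exact (pow_left_inj₀ (Real.sqrt_nonneg _) (Real.sqrt_nonneg _) two_ne_zero).1 h

/-- Efficiency of the optimal weighting matrix. -/
theorem Weighting.weakNorm_riesz_le (hM : M.Regular) (hW : W.Basic M) (hW₀ : W₀.Basic M)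
    (hopt : ∀ᵐ x ∂(M.law : Measure (X × Y)).fst, W₀.Sig x = M.Sig₀ x) (n : ℕ) :
    W₀.weakNorm M (W₀.riesz n) ≤ W.sdNorm M (W.riesz n) := by
  obtain ⟨c, C, hC, h⟩ := hW.wellConditioned
  obtain ⟨c₀, C₀, hC₀, h₀⟩ := hW₀.wellConditioned
  set v := W.riesz n
  set w := W₀.riesz n
  have hv : v ∈ M.V := M.tangent_le_V n (hW.riesz_mem n)
  have hw : w ∈ M.V := M.tangent_le_V n (hW₀.riesz_mem n)
  -- Both sides equal `dφ w`, since each representer represents the same functional.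
  have e : W.ip M v w = W₀.ip M w w :=
    (hW.riesz_spec n w (hW₀.riesz_mem n)).symm.trans (hW₀.riesz_spec n w (hW₀.riesz_mem n))
  refine abs_le_of_sq_le_sq' ?_ (Real.sqrt_nonneg _) |>.2
  have hLv := hM.dm_memLp v hv
  have hLw := hM.dm_memLp w hw
  have hb := hW.memLp_inv_mulVec hLv
  have hi1 := MemLp.integrable_dotProduct hb (hW₀.memLp_mulVec hb)
  have hi2 := hW.integrable_wprod hLv hLw
  have hi3 := hW₀.integrable_wprod hLw hLw
  -- The integrand is `(b - a)' Σ₀ (b - a)` with `b = Σ⁻¹ dm[v]` and `a = Σ₀⁻¹ dm[w]`. Its integral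
  -- is `‖v‖_sd² - 2⟨v, w⟩ + ‖w‖₀²`, which equals `‖v‖_sd² - ‖w‖₀²` by `e`.
  have h0 : 0 ≤ ∫ x, ((W.Sig x)⁻¹ *ᵥ M.dm v x) ⬝ᵥ (W₀.Sig x *ᵥ ((W.Sig x)⁻¹ *ᵥ M.dm v x))
      - 2 * wprod (W.Sig x) (M.dm v x) (M.dm w x) + wprod (W₀.Sig x) (M.dm w x) (M.dm w x)
      ∂(M.law : Measure (X × Y)).fst := by
    refine integral_nonneg fun x => ?_
    set b := (W.Sig x)⁻¹ *ᵥ M.dm v x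
    set a := (W₀.Sig x)⁻¹ *ᵥ M.dm w x
    have h1 := (mul_nonneg (h₀ x).pos.le (dotProduct_self_nonneg' _)).trans ((h₀ x).lower (b - a))
    have e2 : wprod (W.Sig x) (M.dm v x) (M.dm w x) = b ⬝ᵥ (W₀.Sig x *ᵥ a) := by
      rw [(h x).wprod_eq, (h₀ x).mulVec_inv]
    have e3 : a ⬝ᵥ (W₀.Sig x *ᵥ b) = b ⬝ᵥ (W₀.Sig x *ᵥ a) := symm_dotProduct_mulVec (h₀ x).symm _ _
    rw [Matrix.mulVec_sub, sub_dotProduct, dotProduct_sub, dotProduct_sub, e3] at h1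
    simp only [Pi.zero_apply]
    rw [e2, (h₀ x).wprod_self]
    linarith
  have hi12 : Integrable (fun x => ((W.Sig x)⁻¹ *ᵥ M.dm v x) ⬝ᵥ
      (W₀.Sig x *ᵥ ((W.Sig x)⁻¹ *ᵥ M.dm v x)) - 2 * wprod (W.Sig x) (M.dm v x) (M.dm w x))
      (M.law : Measure (X × Y)).fst := hi1.sub (hi2.const_mul 2)
  rw [integral_add hi12 hi3, integral_sub hi1 (hi2.const_mul 2),
    integral_const_mul, ← W.sdNorm_sq hM hW hW₀ hopt hv] at h0
  change 0 ≤ W.sdNorm M v ^ 2 - 2 * W.ip M v w + W₀.ip M w w at h0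
  change _ ≤ W.sdNorm M v ^ 2
  rw [W₀.weakNorm_sq hW₀]
  linarith

/-- The Riesz representers of two weighting matrices have comparable norms. -/
theorem Weighting.exists_weakNorm_riesz_le (hM : M.Regular) (hW : W.Basic M) (hW₀ : W₀.Basic M) :
    ∃ K : ℝ, 0 ≤ K ∧ ∀ n, W.weakNorm M (W.riesz n) ≤ K * W₀.weakNorm M (W₀.riesz n) := by
  obtain ⟨c, C, hC, h⟩ := hW.wellConditioned
  obtain ⟨c₀, C₀, hC₀, h₀⟩ := hW₀.wellConditioned
  have key : ∃ k : ℝ, 0 ≤ k ∧ ∀ v ∈ M.V, W₀.weakNorm M v ≤ k * W.weakNorm M v := by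
    refine ⟨√(max (c₀⁻¹ * C) 0), Real.sqrt_nonneg _, fun v hv => ?_⟩
    rw [Weighting.weakNorm, Weighting.weakNorm, ← Real.sqrt_mul (le_max_right _ _)]
    refine Real.sqrt_le_sqrt ?_
    have hL := hM.dm_memLp v hv
    rw [Weighting.ip, Weighting.ip, ← integral_const_mul]
    refine integral_mono (hW₀.integrable_wprod hL hL) ((hW.integrable_wprod hL hL).const_mul _)
      fun x => ?_
    have h1 := (h₀ x).wprod_self_le (M.dm v x)
    have h2 := (h x).le_wprod_self hC (M.dm v x)
    rw [inv_mul_eq_div, div_le_iff₀ hC] at h2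
    refine h1.trans ((mul_le_mul_of_nonneg_left h2 (inv_pos.2 (h₀ x).pos).le).trans ?_)
    have := mul_le_mul_of_nonneg_right (le_max_left (c₀⁻¹ * C) 0)
      ((h x).wprod_self_nonneg (M.dm v x))
    calc _ = c₀⁻¹ * C * wprod (W.Sig x) (M.dm v x) (M.dm v x) := by ring
      _ ≤ _ := this
  obtain ⟨k, hk, hkv⟩ := key
  refine ⟨k, hk, fun n => ?_⟩
  have hv := M.tangent_le_V n (hW.riesz_mem n)
  have hw := M.tangent_le_V n (hW₀.riesz_mem n)
  -- Both sides are `dφ (W.riesz n)`; Cauchy–Schwarz for `W₀` and equivalence of the weak norms then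
  -- allow cancelling one factor.
  have e : W.weakNorm M (W.riesz n) ^ 2 = W₀.ip M (W₀.riesz n) (W.riesz n) := by
    rw [W.weakNorm_sq hW]
    exact (hW.riesz_spec n _ (hW.riesz_mem n)).symm.trans (hW₀.riesz_spec n _ (hW.riesz_mem n))
  have h1 := (le_abs_self _).trans (W₀.abs_ip_le hM hW₀ hw hv)
  rw [← e] at h1
  rcases (W.weakNorm_nonneg (M := M) (W.riesz n)).eq_or_lt with h0 | h0
  · rw [← h0]; exact mul_nonneg hk (W₀.weakNorm_nonneg _)
  · have h2 := mul_le_mul_of_nonneg_left (hkv _ hv) (W₀.weakNorm_nonneg (M := M) (W₀.riesz n))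
    refine le_of_mul_le_mul_right ?_ h0
    nlinarith

end Population

/-! ### The filter of events with probability approaching one. -/

section WithProbabilityApproachingOne

variable {Z : Type*} [MeasurableSpace Z] {P : ℕ → ProbabilityMeasure Z}

instance (P : ProbabilityMeasure Z) (n : ℕ) : IsProbabilityMeasure (sampleLaw P n) := by
  unfold sampleLaw; infer_instance

/-- The filter of events that hold with probability approaching one, for pairs of a sample size
and a sample. -/
def wp (P : ℕ → ProbabilityMeasure Z) : Filter (Σ n : ℕ, (Fin n → Z)) where
  sets := {S | Tendsto (fun n => sampleLaw (P n) n {z | ¬ (⟨n, z⟩ : Σ n : ℕ, (Fin n → Z)) ∈ S})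
    atTop (𝓝 0)}
  univ_sets := by simp
  sets_of_superset := by
    intro S T hS hST
    refine tendsto_of_tendsto_of_tendsto_of_le_of_le tendsto_const_nhds hS
      (fun _ => zero_le) fun n => measure_mono fun z hz h => hz (hST h)
  inter_sets := by
    intro S T hS hT
    have h := Tendsto.add hS hT
    rw [add_zero] at h
    refine tendsto_of_tendsto_of_tendsto_of_le_of_le tendsto_const_nhds h
      (fun _ => zero_le) fun n => ?_
    refine (measure_mono fun z hz => ?_).trans (measure_union_le _ _)
    by_contra hc
    simp only [Set.mem_union, Set.mem_ofPred_eq, not_or, not_not] at hc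
    exact hz ⟨hc.1, hc.2⟩

theorem eventually_wp {q : (n : ℕ) → (Fin n → Z) → Prop} :
    (∀ᶠ p in wp P, q p.1 p.2) ↔
      Tendsto (fun n => sampleLaw (P n) n {z | ¬ q n z}) atTop (𝓝 0) := Iff.rfl

theorem eventually_wp_of_eventually {q : (n : ℕ) → (Fin n → Z) → Prop}
    (h : ∀ᶠ n in atTop, ∀ z, q n z) : ∀ᶠ p in wp P, q p.1 p.2 := by
  rw [eventually_wp]
  refine tendsto_const_nhds.congr' ?_
  filter_upwards [h] with n hn
  simp [hn]

theorem tendsto_fst_wp : Tendsto Sigma.fst (wp P) atTop := fun S hS =>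
  eventually_wp_of_eventually (q := fun n _ => n ∈ S) (Filter.mem_of_superset hS fun _ h _ => h)

theorem WPA1.eventually {S : (n : ℕ) → Set (Fin n → Z)} (h : WPA1 P S) :
    ∀ᶠ p in wp P, p.2 ∈ S p.1 := h

theorem LittleOP.eventually {R : (n : ℕ) → (Fin n → Z) → ℝ} {a : ℕ → ℝ} (h : LittleOP P R a)
    {ε : ℝ} (hε : 0 < ε) : ∀ᶠ p in wp P, |R p.1 p.2| ≤ ε * a p.1 := by
  rw [eventually_wp (q := fun n z => |R n z| ≤ ε * a n)]
  simpa only [not_le] using h ε hε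

/-- A property that holds with probability close to one for large constants holds with
probability approaching one for constants that diverge. -/
theorem eventually_wp_of_tight {q : ℝ → (n : ℕ) → (Fin n → Z) → Prop}
    (hq : ∀ n z C C', C ≤ C' → q C n z → q C' n z)
    (h : ∀ ε : ℝ, 0 < ε → ∃ C : ℝ, ∀ᶠ n in atTop,
      sampleLaw (P n) n {z | ¬ q C n z} ≤ ENNReal.ofReal ε)
    {K : ℕ → ℝ} (hK : Tendsto K atTop atTop) : ∀ᶠ p in wp P, q (K p.1) p.1 p.2 := by
  rw [eventually_wp (q := fun n z => q (K n) n z), ENNReal.tendsto_nhds_zero]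
  intro ε hε
  by_cases hε' : ε = ∞
  · simp [hε']
  obtain ⟨C, hC⟩ := h ε.toReal (ENNReal.toReal_pos hε.ne' hε')
  filter_upwards [hC, hK.eventually_ge_atTop C] with n hn hCK
  rw [ENNReal.ofReal_toReal hε'] at hn
  refine (measure_mono fun z hz => ?_).trans hn
  simp only [Set.mem_ofPred_eq] at hz ⊢
  exact fun hc => hz (hq n z _ _ hCK hc)

theorem BigOP.eventually {R : (n : ℕ) → (Fin n → Z) → ℝ} {a : ℕ → ℝ} (h : BigOP P R a)
    (ha : ∀ n, 0 ≤ a n) {K : ℕ → ℝ} (hK : Tendsto K atTop atTop) :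
    ∀ᶠ p in wp P, |R p.1 p.2| ≤ K p.1 * a p.1 := by
  refine eventually_wp_of_tight (q := fun C n z => |R n z| ≤ C * a n) ?_ ?_ hK
  · exact fun n z C C' hCC hC => hC.trans (mul_le_mul_of_nonneg_right hCC (ha n))
  · simp only [not_le]
    exact h

/-- A sequence bounded in probability at a vanishing rate tends to zero in probability. -/
theorem BigOP.eventually_le {R : (n : ℕ) → (Fin n → Z) → ℝ} {a : ℕ → ℝ} (h : BigOP P R a)
    (ha0 : Tendsto a atTop (𝓝 0)) {ε : ℝ} (hε : 0 < ε) : ∀ᶠ p in wp P, |R p.1 p.2| ≤ ε := by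
  rw [eventually_wp (q := fun n z => |R n z| ≤ ε), ENNReal.tendsto_nhds_zero]
  intro η hη
  by_cases hη' : η = ∞
  · simp [hη']
  obtain ⟨C, hC⟩ := h η.toReal (ENNReal.toReal_pos hη.ne' hη')
  have h1 : Tendsto (fun n => C * a n) atTop (𝓝 0) := by simpa using ha0.const_mul C
  filter_upwards [hC, h1.eventually_lt_const hε] with n hn hCn
  rw [ENNReal.ofReal_toReal hη'] at hn
  refine (measure_mono fun z hz => ?_).trans hn
  simp only [not_le, Set.mem_ofPred_eq] at hz ⊢
  exact hCn.trans hz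

/-- If one event implies another with probability approaching one, then its probability is
asymptotically at most that of the other. -/
theorem eventually_real_le_of_imp {q r : (n : ℕ) → (Fin n → Z) → Prop}
    (h : ∀ᶠ p in wp P, q p.1 p.2 → r p.1 p.2) {η : ℝ} (hη : 0 < η) :
    ∀ᶠ n in atTop, (sampleLaw (P n) n).real {z | q n z} ≤
      (sampleLaw (P n) n).real {z | r n z} + η := by
  rw [eventually_wp (q := fun n z => q n z → r n z)] at h
  have h2 := (ENNReal.tendsto_toReal ENNReal.zero_ne_top).comp h
  rw [ENNReal.toReal_zero] at h2
  filter_upwards [h2.eventually_lt_const hη] with n hn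
  -- Only monotonicity and subadditivity enter, so the events need not be measurable.
  have h3 : (sampleLaw (P n) n).real {z | q n z} ≤ (sampleLaw (P n) n).real
      ({z | r n z} ∪ {z | ¬ (q n z → r n z)}) := by
    refine measureReal_mono fun z hz => ?_
    by_cases hr : r n z
    · exact Or.inl hr
    · exact Or.inr fun hc => hr (hc hz)
  refine h3.trans ((measureReal_union_le _ _).trans ?_)
  have h4 : (sampleLaw (P n) n).real {z | ¬ (q n z → r n z)} < η := hn
  linarith

end WithProbabilityApproachingOne

/-! ### Normal window probabilities and tails of shifted squares. -/

section Normal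

/-- The probability that a standard normal variable lies within `s` of `k`. -/
noncomputable def normalWindow (k s : ℝ) : ℝ := ∫ x in (k - s)..(k + s), gaussianPDFReal 0 1 x

theorem continuous_gaussianPDFReal : Continuous (gaussianPDFReal 0 1) := by
  unfold gaussianPDFReal
  fun_prop

theorem hasDerivAt_normalPrimitive (x : ℝ) :
    HasDerivAt (fun x => ∫ y in (0 : ℝ)..x, gaussianPDFReal 0 1 y) (gaussianPDFReal 0 1 x) x :=
  continuous_gaussianPDFReal.integral_hasStrictDerivAt 0 x |>.hasDerivAt

theorem continuous_normalPrimitive :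
    Continuous fun x => ∫ y in (0 : ℝ)..x, gaussianPDFReal 0 1 y :=
  continuous_iff_continuousAt.2 fun x => (hasDerivAt_normalPrimitive x).continuousAt

theorem normalWindow_eq (k s : ℝ) : normalWindow k s =
    (∫ y in (0 : ℝ)..(k + s), gaussianPDFReal 0 1 y) -
      ∫ y in (0 : ℝ)..(k - s), gaussianPDFReal 0 1 y :=
  (intervalIntegral.integral_interval_sub_left
    (continuous_gaussianPDFReal.intervalIntegrable _ _)
    (continuous_gaussianPDFReal.intervalIntegrable _ _)).symm

theorem continuous_normalWindow : Continuous fun p : ℝ × ℝ => normalWindow p.1 p.2 := by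
  simp only [normalWindow_eq]
  exact (continuous_normalPrimitive.comp (continuous_fst.add continuous_snd)).sub
    (continuous_normalPrimitive.comp (continuous_fst.sub continuous_snd))

theorem normalWindow_neg (k s : ℝ) : normalWindow (-k) s = normalWindow k s := by
  have h : ∀ x, gaussianPDFReal 0 1 (-x) = gaussianPDFReal 0 1 x := by
    intro x; simp [gaussianPDFReal]
  unfold normalWindow
  have := intervalIntegral.integral_comp_neg (a := -k - s) (b := -k + s) (gaussianPDFReal 0 1)
  simp only [h] at this
  rw [this]
  congr 1 <;> ring

theorem normalWindow_abs (k s : ℝ) : normalWindow |k| s = normalWindow k s := by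
  rcases abs_choice k with h | h <;> rw [h]
  exact normalWindow_neg k s

/-- Off-centre windows have smaller probability. -/
theorem normalWindow_anti {k k' s : ℝ} (hs : 0 ≤ s) (h : |k| ≤ |k'|) :
    normalWindow k' s ≤ normalWindow k s := by
  rw [← normalWindow_abs k, ← normalWindow_abs k']
  have hd : ∀ x, HasDerivAt (fun k => normalWindow k s)
      (gaussianPDFReal 0 1 (x + s) - gaussianPDFReal 0 1 (x - s)) x := by
    intro x
    simp only [normalWindow_eq]
    exact ((hasDerivAt_normalPrimitive _).comp_add_const x s).sub
      ((hasDerivAt_normalPrimitive _).comp_sub_const x s)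
  have hanti : AntitoneOn (fun k => normalWindow k s) (Set.Ici 0) := by
    refine antitoneOn_of_deriv_nonpos (convex_Ici 0)
      (fun x _ => (hd x).continuousAt.continuousWithinAt)
      (fun x _ => (hd x).differentiableAt.differentiableWithinAt) fun x hx => ?_
    rw [interior_Ici, Set.mem_Ioi] at hx
    -- For `x, s ≥ 0` the right end of the window is at least as far from the origin as the left
    -- one, so the density there is no larger.
    rw [(hd x).deriv, sub_nonpos]
    unfold gaussianPDFReal
    gcongr ?_ * Real.exp (-?_ / _)
    nlinarith
  exact hanti (abs_nonneg k) (abs_nonneg k') h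

theorem gaussianReal_real_Iic_sub (a b : ℝ) :
    (gaussianReal 0 1).real (Set.Iic b) - (gaussianReal 0 1).real (Set.Iic a) =
      ∫ x in a..b, gaussianPDFReal 0 1 x := by
  have h : ∀ b, (gaussianReal 0 1).real (Set.Iic b) =
      ∫ x in Set.Iic b, gaussianPDFReal 0 1 x := by
    intro b
    rw [measureReal_def, gaussianReal_apply_eq_integral 0 one_ne_zero, ENNReal.toReal_ofReal]
    exact integral_nonneg fun x => gaussianPDFReal_nonneg _ _ _
  rw [h, h]
  exact intervalIntegral.integral_Iic_sub_Iic (integrable_gaussianPDFReal 0 1).integrableOn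
    (integrable_gaussianPDFReal 0 1).integrableOn

theorem continuous_gaussianReal_Iic : Continuous fun x => (gaussianReal 0 1).real (Set.Iic x) := by
  have h : (fun x => (gaussianReal 0 1).real (Set.Iic x)) =
      fun x => (gaussianReal 0 1).real (Set.Iic 0) + ∫ y in (0 : ℝ)..x, gaussianPDFReal 0 1 y := by
    funext x
    rw [← gaussianReal_real_Iic_sub]
    ring
  rw [h]
  exact continuous_const.add continuous_normalPrimitive

variable {ι : Type*} {l : Filter ι} {Ω : ι → Type*} [∀ i, MeasurableSpace (Ω i)]
  {μ : (i : ι) → Measure (Ω i)} [∀ i, IsProbabilityMeasure (μ i)] {R : (i : ι) → Ω i → ℝ}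

/-- Moving thresholds are sandwiched between fixed ones `x₀ ± δ`; continuity of the normal
distribution function closes the gap and also makes strict and weak inequalities agree in the limit.
-/
theorem tendsto_real_le_of_tendsto
    (hR : ∀ x : ℝ, Tendsto (fun i => (μ i).real {ω | R i ω ≤ x}) l
      (𝓝 ((gaussianReal 0 1).real (Set.Iic x)))) {x : ι → ℝ} {x₀ : ℝ} (hx : Tendsto x l (𝓝 x₀)) :
    Tendsto (fun i => (μ i).real {ω | R i ω ≤ x i}) l
      (𝓝 ((gaussianReal 0 1).real (Set.Iic x₀))) ∧
    Tendsto (fun i => (μ i).real {ω | R i ω < x i}) l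
      (𝓝 ((gaussianReal 0 1).real (Set.Iic x₀))) := by
  have hc := continuous_gaussianReal_Iic.tendsto x₀
  have up : ∀ b, (gaussianReal 0 1).real (Set.Iic x₀) < b →
      ∀ᶠ i in l, (μ i).real {ω | R i ω ≤ x i} < b := by
    intro b hb
    obtain ⟨δ, hδ, hδb⟩ : ∃ δ > 0, (gaussianReal 0 1).real (Set.Iic (x₀ + δ)) < b := by
      have h1 : Tendsto (fun δ : ℝ => x₀ + δ) (𝓝[>] 0) (𝓝 x₀) := by
        have : Tendsto (fun δ : ℝ => x₀ + δ) (𝓝 0) (𝓝 (x₀ + 0)) := tendsto_const_nhds.add tendsto_id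
        rw [add_zero] at this
        exact this.mono_left nhdsWithin_le_nhds
      obtain ⟨δ, h2, h3⟩ := (((hc.comp h1).eventually_lt_const hb).and self_mem_nhdsWithin).exists
      exact ⟨δ, h3, h2⟩
    filter_upwards [(hR (x₀ + δ)).eventually_lt_const hδb,
      hx.eventually_lt_const (lt_add_of_pos_right x₀ hδ)] with i h1 h2
    exact (measureReal_mono fun ω hω => le_trans hω h2.le).trans_lt h1
  have lo : ∀ b, b < (gaussianReal 0 1).real (Set.Iic x₀) →
      ∀ᶠ i in l, b < (μ i).real {ω | R i ω < x i} := by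
    intro b hb
    obtain ⟨δ, hδ, hδb⟩ : ∃ δ > 0, b < (gaussianReal 0 1).real (Set.Iic (x₀ - δ)) := by
      have h1 : Tendsto (fun δ : ℝ => x₀ - δ) (𝓝[>] 0) (𝓝 x₀) := by
        have : Tendsto (fun δ : ℝ => x₀ - δ) (𝓝 0) (𝓝 (x₀ - 0)) := tendsto_const_nhds.sub tendsto_id
        rw [sub_zero] at this
        exact this.mono_left nhdsWithin_le_nhds
      obtain ⟨δ, h2, h3⟩ := (((hc.comp h1).eventually_const_lt hb).and self_mem_nhdsWithin).exists
      exact ⟨δ, h3, h2⟩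
    filter_upwards [(hR (x₀ - δ)).eventually_const_lt hδb,
      hx.eventually_const_lt (sub_lt_self x₀ hδ)] with i h1 h2
    exact h1.trans_le (measureReal_mono fun ω hω => lt_of_le_of_lt hω h2)
  have mono : ∀ i, (μ i).real {ω | R i ω < x i} ≤ (μ i).real {ω | R i ω ≤ x i} :=
    fun i => measureReal_mono fun ω (hω : R i ω < x i) => hω.le
  exact ⟨tendsto_order.2 ⟨fun b hb => (lo b hb).mono fun i hi => hi.trans_le (mono i), up⟩,
    tendsto_order.2 ⟨lo, fun b hb => (up b hb).mono fun i hi => (mono i).trans_lt hi⟩⟩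

/-- Limit of the upper tail probabilities of the square of a shifted asymptotically standard
normal sequence. -/
theorem tendsto_real_le_sq (hm : ∀ i, Measurable (R i))
    (hR : ∀ x : ℝ, Tendsto (fun i => (μ i).real {ω | R i ω ≤ x}) l
      (𝓝 ((gaussianReal 0 1).real (Set.Iic x)))) {k : ι → ℝ} {k₀ : ℝ} (hk : Tendsto k l (𝓝 k₀))
    (t : ℝ) : Tendsto (fun i => (μ i).real {ω | t ≤ (R i ω - k i) ^ 2}) l
      (𝓝 (1 - normalWindow k₀ √t)) := by
  rcases le_or_gt t 0 with ht | ht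
  · have h1 : normalWindow k₀ √t = 0 := by
      rw [Real.sqrt_eq_zero_of_nonpos ht]
      simp [normalWindow]
    rw [h1, sub_zero]
    refine tendsto_const_nhds.congr fun i => ?_
    have : {ω | t ≤ (R i ω - k i) ^ 2} = Set.univ :=
      Set.eq_univ_of_forall fun ω => ht.trans (sq_nonneg _)
    rw [this, probReal_univ]
  have hs : 0 < √t := Real.sqrt_pos.2 ht
  have h1 := (tendsto_real_le_of_tendsto hR (hk.add_const √t)).2
  have h2 := (tendsto_real_le_of_tendsto hR (hk.sub_const √t)).1
  have h3 := (h1.sub h2).const_sub 1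
  rw [gaussianReal_real_Iic_sub] at h3
  refine h3.congr fun i => ?_
  have hm1 : MeasurableSet {ω | R i ω < k i + √t} := measurableSet_lt (hm i) measurable_const
  have hm2 : MeasurableSet {ω | R i ω ≤ k i - √t} := measurableSet_le (hm i) measurable_const
  have hsub : {ω | R i ω ≤ k i - √t} ⊆ {ω | R i ω < k i + √t} :=
    fun ω (hω : R i ω ≤ k i - √t) => lt_of_le_of_lt hω (by linarith)
  have e : {ω | t ≤ (R i ω - k i) ^ 2} =
      ({ω | R i ω < k i + √t} \ {ω | R i ω ≤ k i - √t})ᶜ := by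
    ext ω
    simp only [Set.mem_ofPred_eq, Set.mem_compl_iff, Set.mem_sdiff]
    rw [← not_lt, not_iff_not, ← sq_abs, ← Real.lt_sqrt (abs_nonneg _), abs_lt]
    constructor
    · rintro ⟨h1, h2⟩; exact ⟨by linarith, by linarith⟩
    · rintro ⟨h1, h2⟩; exact ⟨by linarith, by linarith⟩
  rw [e, probReal_compl_eq_one_sub (hm1.diff hm2), measureReal_sdiff hsub hm2]

end Normal

/-! ### From bounds on a statistic to bounds on its tail probabilities. -/

section Limits

variable {Z : Type*} [MeasurableSpace Z] {P : ℕ → ProbabilityMeasure Z}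

theorem TendstoStdNormal.real {R : (n : ℕ) → (Fin n → Z) → ℝ} (h : TendstoStdNormal P R) (x : ℝ) :
    Tendsto (fun n => (sampleLaw (P n) n).real {z | R n z ≤ x}) atTop
      (𝓝 ((gaussianReal 0 1).real (Set.Iic x))) :=
  (ENNReal.tendsto_toReal (measure_ne_top _ _)).comp (h x)

variable {R : (n : ℕ) → (Fin n → Z) → ℝ} {k : ℕ → ℝ} {A : (n : ℕ) → (Fin n → Z) → ℝ}

theorem continuous_normalTail (k₀ : ℝ) : Continuous fun t => 1 - normalWindow k₀ √t :=
  continuous_const.sub (continuous_normalWindow.comp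
    (continuous_const.prodMk Real.continuous_sqrt))

/-- A statistic which is asymptotically at least the square of a shifted asymptotically normal
one has asymptotically at least its upper tail probabilities. -/
theorem eventually_lt_tail (hm : ∀ n, Measurable (R n)) (hR : TendstoStdNormal P R) {k₀ B : ℝ}
    (hk : ∀ᶠ n in atTop, |k n| ≤ B) (hk₀ : ∀ a < |k₀|, ∀ᶠ n in atTop, a < |k n|)
    (hA : ∀ K ε : ℝ, 0 < ε → ∀ᶠ p in wp P,
      min ((R p.1 p.2 - k p.1) ^ 2) (K ^ 2) - ε ≤ A p.1 p.2) (t : ℝ) {b : ℝ}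
    (hb : b < 1 - normalWindow k₀ √t) :
    ∀ᶠ n in atTop, b < (sampleLaw (P n) n).real {z | t ≤ A n z} := by
  obtain ⟨ε, hε, hεb⟩ : ∃ ε > 0, b < 1 - normalWindow k₀ √(t + ε) := by
    have h1 : Tendsto (fun δ : ℝ => t + δ) (𝓝[>] 0) (𝓝 t) := by
      have : Tendsto (fun δ : ℝ => t + δ) (𝓝 0) (𝓝 (t + 0)) := tendsto_const_nhds.add tendsto_id
      rw [add_zero] at this
      exact this.mono_left nhdsWithin_le_nhds
    obtain ⟨δ, h2, h3⟩ := (((((continuous_normalTail k₀).tendsto t).comp h1).eventually_const_lt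
      hb).and self_mem_nhdsWithin).exists
    exact ⟨δ, h3, h2⟩
  obtain ⟨b', hb1, hb2⟩ := exists_between hεb
  have hG : ∀ᶠ n in atTop, b' < (sampleLaw (P n) n).real {z | t + ε ≤ (R n z - k n) ^ 2} := by
    by_contra hcon
    rw [not_eventually] at hcon
    obtain ⟨χ, hχ, hχb⟩ := extraction_of_frequently_atTop hcon
    -- The shifts are bounded but need not converge. Along a bad subsequence with limit `k'`, where
    -- `|k₀| ≤ |k'|`, the tail limit would be at most `b'`, contradicting `normalWindow_anti`.
    obtain ⟨k', -, φ, hφ, hlim⟩ := tendsto_subseq_of_frequently_bounded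
      (s := Metric.closedBall (0 : ℝ) B) Metric.isBounded_closedBall (x := fun n => k (χ n))
      ((hχ.tendsto_atTop.eventually hk).mono fun n hn => by simpa using hn).frequently
    set ψ : ℕ → ℕ := fun j => χ (φ j)
    have hψ : Tendsto ψ atTop atTop := (hχ.comp hφ).tendsto_atTop
    have hbad : ∀ j, ¬ b' < (sampleLaw (P (ψ j)) (ψ j)).real
        {z | t + ε ≤ (R (ψ j) z - k (ψ j)) ^ 2} := fun j => hχb (φ j)
    have hT := tendsto_real_le_sq (l := atTop) (μ := fun j => sampleLaw (P (ψ j)) (ψ j))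
      (R := fun j => R (ψ j)) (fun j => hm _) (fun x => (hR.real x).comp hψ)
      (k := fun j => k (ψ j)) hlim (t + ε)
    have h1 : 1 - normalWindow k' √(t + ε) ≤ b' :=
      le_of_tendsto hT (Eventually.of_forall fun j => not_lt.1 (hbad j))
    have h2 : |k₀| ≤ |k'| := le_of_forall_lt fun a ha => by
      obtain ⟨a', ha1, ha2⟩ := exists_between ha
      refine ha1.trans_le (ge_of_tendsto (hlim.abs) ?_)
      exact (hψ.eventually (hk₀ a' ha2)).mono fun j hj => hj.le
    have h3 := normalWindow_anti (Real.sqrt_nonneg (t + ε)) h2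
    linarith
  have himp : ∀ᶠ p in wp P, t + ε ≤ (R p.1 p.2 - k p.1) ^ 2 → t ≤ A p.1 p.2 := by
    -- The truncation level satisfies `K² ≥ t + ε`, so truncating the square does not affect the
    -- event.
    filter_upwards [hA (√(max (t + ε) 0)) ε hε] with p hp h
    have h2 : t + ε ≤ min ((R p.1 p.2 - k p.1) ^ 2) (√(max (t + ε) 0) ^ 2) := by
      refine le_min h ?_
      rw [Real.sq_sqrt (le_max_right _ _)]
      exact le_max_left _ _
    linarith
  filter_upwards [hG, eventually_real_le_of_imp
    (q := fun n z => t + ε ≤ (R n z - k n) ^ 2) (r := fun n z => t ≤ A n z) himp (sub_pos.2 hb1)] with n h1 h2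
  linarith

/-- The event `t ≤ A` forces the shifted square above `(t - ε)/(1 + ε)`, a threshold that tends to
`t`; the limiting tail is continuous in the threshold. -/
theorem eventually_tail_lt (hm : ∀ n, Measurable (R n)) (hR : TendstoStdNormal P R) {k₀ : ℝ}
    (hk : Tendsto k atTop (𝓝 k₀))
    (hA : ∀ ε : ℝ, 0 < ε → ∀ᶠ p in wp P,
      A p.1 p.2 ≤ (1 + ε) * (R p.1 p.2 - k p.1) ^ 2 + ε) (t : ℝ) {b : ℝ}
    (hb : 1 - normalWindow k₀ √t < b) :
    ∀ᶠ n in atTop, (sampleLaw (P n) n).real {z | t ≤ A n z} < b := by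
  obtain ⟨ε, hε, hεb⟩ : ∃ ε > 0, 1 - normalWindow k₀ √((t - ε) / (1 + ε)) < b := by
    have h1 : Tendsto (fun δ : ℝ => (t - δ) / (1 + δ)) (𝓝[>] 0) (𝓝 t) := by
      have : Tendsto (fun δ : ℝ => (t - δ) / (1 + δ)) (𝓝 0) (𝓝 ((t - 0) / (1 + 0))) :=
        (tendsto_const_nhds.sub tendsto_id).div (tendsto_const_nhds.add tendsto_id) (by norm_num)
      rw [sub_zero, add_zero, div_one] at this
      exact this.mono_left nhdsWithin_le_nhds
    obtain ⟨δ, h2, h3⟩ := (((((continuous_normalTail k₀).tendsto t).comp h1).eventually_lt_const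
      hb).and self_mem_nhdsWithin).exists
    exact ⟨δ, h3, h2⟩
  obtain ⟨b', hb1, hb2⟩ := exists_between hεb
  have hG := (tendsto_real_le_sq (l := atTop) (μ := fun n => sampleLaw (P n) n) hm hR.real hk
    ((t - ε) / (1 + ε))).eventually_lt_const hb1
  have himp : ∀ᶠ p in wp P, t ≤ A p.1 p.2 → (t - ε) / (1 + ε) ≤ (R p.1 p.2 - k p.1) ^ 2 := by
    filter_upwards [hA ε hε] with p hp h
    rw [div_le_iff₀ (add_pos one_pos hε)]
    linarith
  filter_upwards [hG, eventually_real_le_of_imp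
    (q := fun n z => t ≤ A n z) (r := fun n z => (t - ε) / (1 + ε) ≤ (R n z - k n) ^ 2)
    himp (sub_pos.2 hb2)] with n h1 h2
  linarith

end Limits

/-! ### Consistency and rate of the unrestricted estimator under the alternatives. -/

section Rates

set_option linter.unusedSectionVars false

variable {dθ dρ : ℕ} {X Y H : Type*} [MeasurableSpace X] [MeasurableSpace Y]
  [StandardBorelSpace Y] [Nonempty Y] [NormedAddCommGroup H] [NormedSpace ℝ H]
  {M : Model dθ dρ X Y H} {W : Weighting dθ dρ X Y H} {L : LocalAlt dθ X Y H}

/-- The shift `√n ⟨u_n^*, α_n - α₀⟩` of the score caused by the local alternative. -/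
noncomputable def Weighting.shift (M : Model dθ dρ X Y H) (W : Weighting dθ dρ X Y H)
    (L : LocalAlt dθ X Y H) (n : ℕ) : ℝ :=
  √n * (L.d n * W.ip M (W.u M n) (L.dir n))

/-- The scaled Riesz representers are bounded away from zero and infinity, and the local
alternatives shift the score by a non-negligible amount. -/
structure Weighting.Scaling (M : Model dθ dρ X Y H) (W : Weighting dθ dρ X Y H)
    (L : LocalAlt dθ X Y H) (a b k₀ : ℝ) : Prop where
  a_pos : 0 < a
  b_pos : 0 < b
  k_pos : 0 < k₀
  d_nonneg : ∀ n, 0 ≤ L.d n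
  u_bounds : ∀ᶠ n in atTop, a ≤ W.weakNorm M (W.u M n) ∧ W.weakNorm M (W.u M n) ≤ b
  shift_ge : ∀ᶠ n in atTop, k₀ ≤ |W.shift M L n|

theorem Weighting.u_mem (hW : W.Basic M) (n : ℕ) : W.u M n ∈ M.tangent n :=
  (M.tangent n).smul_mem _ (hW.riesz_mem n)

theorem Weighting.u_mem_V (hW : W.Basic M) (n : ℕ) : W.u M n ∈ M.V :=
  M.tangent_le_V n (W.u_mem hW n)

theorem Model.sieveSpace_sub_mem_V {n : ℕ} {α : Param dθ H} (h : α ∈ M.sieveSpace n) :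
    α - M.α₀ ∈ M.V := M.sub_mem_V h.2

theorem LocalAlt.Along.dir_mem_V (hL : L.Along M) (n : ℕ) : L.dir n ∈ M.V :=
  M.tangent_le_V n (hL.dir_mem n)

theorem LocalAlt.param_sub_mem_V (hL : L.Along M) (n : ℕ) : L.param M n - M.α₀ ∈ M.V := by
  rw [LocalAlt.param, add_sub_cancel_left]
  exact M.V.smul_mem _ (hL.dir_mem_V n)

theorem Model.sieveSpace_sub_param_mem_V (hL : L.Along M) {n : ℕ} {α : Param dθ H}
    (h : α ∈ M.sieveSpace n) : α - L.param M n ∈ M.V := by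
  rw [← sub_sub_sub_cancel_right α _ M.α₀]
  exact sub_mem (M.sieveSpace_sub_mem_V h) (L.param_sub_mem_V hL n)

theorem Weighting.slow_nonneg (hW : W.Basic M) : ∀ᶠ n in atTop, 0 ≤ W.slow M n := by
  have h1 : Tendsto (fun n : ℕ => Real.log (Real.log (n + 1))) atTop atTop :=
    Real.tendsto_log_atTop.comp (Real.tendsto_log_atTop.comp
      (tendsto_natCast_atTop_atTop.atTop_add tendsto_const_nhds))
  filter_upwards [h1.eventually_ge_atTop 0] with n hn
  refine le_min hn (Real.log_nonneg ?_)
  linarith [inv_nonneg.2 (W.δs_nonneg hW n)]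

/-- From `x⁻¹ + 1 ≤ (1 + x^{-1/2})²` and `log (1 + y) ≤ y`. It makes the strong radius `M_n δ_{s,n}`
vanish. -/
theorem Weighting.slow_mul_δs_le (hW : W.Basic M) (n : ℕ) :
    W.slow M n * W.δs M n ≤ 2 * √(W.δs M n) := by
  rcases (W.δs_nonneg hW n).eq_or_lt with h | h
  · rw [← h]; simp
  have h1 : W.slow M n ≤ Real.log ((W.δs M n)⁻¹ + 1) := min_le_right _ _
  set x := W.δs M n
  have hs : 0 < √x := Real.sqrt_pos.2 h
  have e : √x * √x = x := Real.mul_self_sqrt h.le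
  have h2 : Real.log (x⁻¹ + 1) ≤ 2 * (√x)⁻¹ := by
    have h3 : x⁻¹ + 1 ≤ (1 + (√x)⁻¹) ^ 2 := by
      have : x⁻¹ = (√x)⁻¹ * (√x)⁻¹ := by rw [← mul_inv, e]
      rw [this]
      nlinarith [inv_pos.2 hs]
    have h4 : Real.log ((1 + (√x)⁻¹) ^ 2) = 2 * Real.log (1 + (√x)⁻¹) := by
      rw [Real.log_pow]; norm_num
    have h5 := Real.log_le_sub_one_of_pos (x := 1 + (√x)⁻¹) (by positivity)
    have h6 := Real.log_le_log (by positivity) h3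
    linarith
  calc W.slow M n * x ≤ 2 * (√x)⁻¹ * x := mul_le_mul_of_nonneg_right (h1.trans h2) h.le
    _ = 2 * ((√x)⁻¹ * √x * √x) := by rw [mul_assoc, mul_assoc, e]
    _ = 2 * √x := by rw [inv_mul_cancel₀ hs.ne', one_mul]

namespace Weighting.Scaling

variable {a b k₀ : ℝ}

/-- A nonzero shift needs `d_n Δ_n ≠ 0`, whose strong norm is at most a multiple of `δ_{s,n}`.
Positivity matters because `0⁻¹ = 0` would make `M_n` at most `log 1 = 0`. -/
theorem δs_pos (hM : M.Regular) (hW : W.Conditions M L)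
    (h : W.Scaling M L a b k₀) : ∀ᶠ n in atTop, 0 < W.δs M n := by
  obtain ⟨c, -, hnear⟩ := hW.near.rate
  filter_upwards [hnear, h.shift_ge] with n hn hk
  have hs : W.shift M L n ≠ 0 := fun h0 => by
    rw [h0, abs_zero] at hk; exact hk.not_gt h.k_pos
  have hd : L.d n ≠ 0 := fun h0 => hs (by simp [Weighting.shift, h0])
  have hdir : L.dir n ≠ 0 := fun h0 => hs (by
    have : W.ip M (W.u M n) 0 = 0 := by
      simpa using W.ip_smul hM hW.basic M.V.zero_mem (W.u_mem_V hW.basic n) 0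
    simp [Weighting.shift, h0, this])
  have hpos : 0 < L.d n * strongNorm (L.dir n) :=
    mul_pos ((h.d_nonneg n).lt_of_ne hd.symm) (strongNorm_pos hdir)
  refine (W.δs_nonneg hW.basic n).lt_of_ne fun h0 => ?_
  have := hn.2
  rw [← h0] at this
  simp only [mul_zero] at this
  linarith

theorem tendsto_slow (hM : M.Regular) (hW : W.Conditions M L)
    (h : W.Scaling M L a b k₀) : Tendsto (W.slow M) atTop atTop := by
  have h1 : Tendsto (fun n : ℕ => Real.log (Real.log (n + 1))) atTop atTop :=
    Real.tendsto_log_atTop.comp (Real.tendsto_log_atTop.comp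
      (tendsto_natCast_atTop_atTop.atTop_add tendsto_const_nhds))
  have h2 : Tendsto (W.δs M) atTop (𝓝[>] 0) :=
    tendsto_nhdsWithin_iff.2 ⟨hW.basic.δs_tendsto, δs_pos hM hW h⟩
  have h3 : Tendsto (fun n => Real.log ((W.δs M n)⁻¹ + 1)) atTop atTop :=
    Real.tendsto_log_atTop.comp ((tendsto_inv_nhdsGT_zero.comp h2).atTop_add tendsto_const_nhds)
  refine tendsto_atTop.2 fun K => ?_
  filter_upwards [h1.eventually_ge_atTop K, h3.eventually_ge_atTop K] with n a b
  exact le_min a b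

/-- Cauchy–Schwarz bounds the shift by `√n · b · d_n ‖Δ_n‖`, and the alternatives stay within weak
radius `M_n δ_n`. Thus `n^{-1/2} = O(M_n δ_n)`, which lets `n⁻¹` errors be absorbed and steps of
order `n^{-1/2}` be taken. -/
theorem rate_ge (hM : M.Regular) (hL : L.Along M) (hW : W.Conditions M L)
    (h : W.Scaling M L a b k₀) :
    ∀ᶠ n : ℕ in atTop, k₀ ≤ √n * (b * (W.slow M n * W.δ n)) := by
  obtain ⟨c, hc, hnear⟩ := hW.near.rate
  filter_upwards [hnear, h.shift_ge, W.slow_nonneg hW.basic, h.u_bounds] with n hn hk hs hu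
  refine hk.trans ?_
  rw [Weighting.shift, abs_mul, abs_mul, abs_of_nonneg (Real.sqrt_nonneg _),
    abs_of_nonneg (h.d_nonneg n)]
  refine mul_le_mul_of_nonneg_left ?_ (Real.sqrt_nonneg _)
  have hsδ : 0 ≤ W.slow M n * W.δ n := mul_nonneg hs (hW.basic.δ_pos n).le
  calc L.d n * |W.ip M (W.u M n) (L.dir n)|
      ≤ L.d n * (W.weakNorm M (W.u M n) * W.weakNorm M (L.dir n)) :=
        mul_le_mul_of_nonneg_left (W.abs_ip_le hM hW.basic (W.u_mem_V hW.basic n)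
          (hL.dir_mem_V n)) (h.d_nonneg n)
    _ = W.weakNorm M (W.u M n) * (L.d n * W.weakNorm M (L.dir n)) := by ring
    _ ≤ b * (L.d n * W.weakNorm M (L.dir n)) :=
        mul_le_mul_of_nonneg_right hu.2 (mul_nonneg (h.d_nonneg n) (W.weakNorm_nonneg _))
    _ ≤ b * (W.slow M n * W.δ n) := by
        refine mul_le_mul_of_nonneg_left (hn.1.trans ?_) h.b_pos.le
        exact mul_le_of_le_one_left hsδ hc.le

/-- By `rate_ge` the `1` is at most a multiple of `√n M_n δ_n`, and the second factor `M_n` in the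
radius of `T` eventually exceeds any constant. -/
theorem mem_T (hM : M.Regular) (hL : L.Along M) (hW : W.Conditions M L)
    (h : W.Scaling M L a b k₀) {K : ℝ} (hK : 0 ≤ K) : ∀ᶠ n : ℕ in atTop, ∀ t : ℝ,
      √n * |t| ≤ K * (1 + √n * (W.slow M n * W.δ n)) → t ∈ W.T M n := by
  filter_upwards [rate_ge hM hL hW h, (tendsto_slow hM hW h).eventually_ge_atTop
    (K * (b / k₀ + 1)), eventually_gt_atTop 0] with n h1 h2 hn t ht
  have hn' : 0 < √(n : ℝ) := Real.sqrt_pos.2 (by exact_mod_cast hn)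
  set r := √n * (W.slow M n * W.δ n) with hr
  have h3 : 1 ≤ b / k₀ * r := by
    rw [div_mul_eq_mul_div, le_div_iff₀ h.k_pos]
    linarith [h1]
  have hr0 : 0 ≤ r := by
    by_contra! hneg
    have := mul_neg_of_pos_of_neg (div_pos h.b_pos h.k_pos) hneg
    linarith
  have h4 : √n * |t| ≤ √n * (4 * W.slow M n ^ 2 * W.δ n) := by
    calc √n * |t| ≤ K * (1 + r) := ht
      _ ≤ K * (b / k₀ * r + r) := by gcongr
      _ = K * (b / k₀ + 1) * r := by ring
      _ ≤ W.slow M n * r := mul_le_mul_of_nonneg_right h2 hr0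
      _ ≤ 4 * (W.slow M n * r) := by
        have : 0 ≤ W.slow M n * r := mul_nonneg ((mul_nonneg hK (by
          have := div_pos h.b_pos h.k_pos; linarith)).trans h2) hr0
        linarith
      _ = _ := by rw [hr]; ring
  exact le_of_mul_le_mul_left h4 hn'

theorem inv_le (hM : M.Regular) (hL : L.Along M) (hW : W.Conditions M L)
    (h : W.Scaling M L a b k₀) :
    ∀ᶠ n : ℕ in atTop, (n : ℝ)⁻¹ ≤ (b / k₀) ^ 2 * (W.slow M n * W.δ n) ^ 2 := by
  filter_upwards [rate_ge hM hL hW h, eventually_gt_atTop 0] with n h1 hn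
  have hn' : 0 < (n : ℝ) := by exact_mod_cast hn
  have h2 := pow_le_pow_left₀ h.k_pos.le h1 2
  rw [mul_pow, Real.sq_sqrt hn'.le, mul_pow] at h2
  rw [inv_eq_one_div, div_le_iff₀ hn', div_pow, div_mul_eq_mul_div, div_mul_eq_mul_div,
    le_div_iff₀ (pow_pos h.k_pos 2)]
  linarith

end Weighting.Scaling

theorem LocalAlt.sieveParam_sub (n : ℕ) :
    L.sieveParam M n - M.α₀ = (0, M.proj n - M.α₀.2) + L.d n • L.dir n := by
  unfold LocalAlt.sieveParam
  ext <;> simp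
  all_goals abel

theorem Weighting.Conditions.strongNorm_sieveParam_sub (hW : W.Conditions M L)
    (hd : ∀ n, 0 ≤ L.d n) :
    ∃ c : ℝ, 0 ≤ c ∧ c < 1 ∧ ∀ᶠ n in atTop,
      L.d n * W.weakNorm M (L.dir n) ≤ c * (W.slow M n * W.δ n) ∧
      strongNorm (L.sieveParam M n - M.α₀) ≤ W.δs M n + c * (W.slow M n * W.δs M n) := by
  obtain ⟨c, hc, hnear⟩ := hW.near.rate
  refine ⟨max c 0, le_max_right _ _, max_lt hc one_pos, ?_⟩
  filter_upwards [hnear, W.slow_nonneg hW.basic] with n hn hs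
  have hsδ := mul_nonneg hs (hW.basic.δ_pos n).le
  have hsδs := mul_nonneg hs (W.δs_nonneg hW.basic n)
  refine ⟨hn.1.trans (mul_le_mul_of_nonneg_right (le_max_left _ _) hsδ), ?_⟩
  rw [L.sieveParam_sub]
  refine (strongNorm_add_le _ _).trans (add_le_add ?_ ?_)
  · have h1 : strongNorm ((0, M.proj n - M.α₀.2) : Param dθ H) = ‖M.α₀.2 - M.proj n‖ := by
      simp [strongNorm, norm_sub_rev]
    rw [h1, Weighting.δs]
    exact le_add_of_nonneg_right (mul_nonneg (W.ill_nonneg n) (hW.basic.δ_pos n).le)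
  · rw [strongNorm_smul, abs_of_nonneg (hd n)]
    exact hn.2.trans (mul_le_mul_of_nonneg_right (le_max_left _ _) hsδs)

theorem Weighting.Conditions.sieveParam_mem_sieveNhd (hW : W.Conditions M L)
    (hd : ∀ n, 0 ≤ L.d n) {r : ℝ} (hr : 0 < r) :
    ∀ᶠ n in atTop, L.sieveParam M n ∈ W.sieveNhd M r n := by
  obtain ⟨c, hc0, hc1, hn⟩ := hW.strongNorm_sieveParam_sub hd
  have h1 : Tendsto (fun n => W.δs M n + c * (2 * √(W.δs M n))) atTop (𝓝 0) := by
    have h2 := hW.basic.δs_tendsto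
    have h3 := h2.add (((Real.continuous_sqrt.tendsto 0).comp h2).const_mul 2 |>.const_mul c)
    simpa using h3
  filter_upwards [hn, hW.rate.sieveParam_mem, h1.eventually_lt_const hr] with n h2 h3 h4
  refine ⟨h3, h2.2.trans_lt (lt_of_le_of_lt ?_ h4)⟩
  have := mul_le_mul_of_nonneg_left (W.slow_mul_δs_le hW.basic n) hc0
  linarith

/-- The lower curvature bound is applied at `Π_n α_n` itself, where the criterion is `O(δ_n²)`. -/
theorem Weighting.Conditions.weakNorm_sieveParam_sub_param (hW : W.Conditions M L)
    (hd : ∀ n, 0 ≤ L.d n) :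
    ∃ C : ℝ, 0 ≤ C ∧ ∀ᶠ n in atTop,
      W.weakNorm M (L.sieveParam M n - L.param M n) ≤ C * W.δ n := by
  obtain ⟨r, hr, ⟨c₁, c₂, hc₁, hcurv⟩, -⟩ := hW.rate.near
  obtain ⟨C, hC⟩ := hW.rate.δ_dom
  refine ⟨√(max (C / c₁) 0), Real.sqrt_nonneg _, ?_⟩
  filter_upwards [hcurv, hC, hW.sieveParam_mem_sieveNhd hd hr] with n h1 h2 h3
  have h4 := (h1 _ h3).1.trans h2.1
  have hδ := (hW.basic.δ_pos n).le
  refine abs_le_of_sq_le_sq' ?_ (mul_nonneg (Real.sqrt_nonneg _) hδ) |>.2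
  rw [mul_pow, Real.sq_sqrt (le_max_right _ _)]
  refine le_trans ?_ (mul_le_mul_of_nonneg_right (le_max_left _ _) (sq_nonneg _))
  rw [div_mul_eq_mul_div, le_div_iff₀ hc₁]
  linarith

/-- The sample criterion at the estimator. -/
theorem Weighting.Conditions.exists_QHat_est_le (hW : W.Conditions M L) :
    ∃ C : ℝ, 0 ≤ C ∧ ∃ R₁ R₂ R₃ : (n : ℕ) → (Fin n → X × Y) → ℝ,
      BigOP L.P R₁ (fun n => W.δ n ^ 2) ∧ LittleOP L.P R₂ (fun n => (n : ℝ)⁻¹) ∧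
      LittleOP L.P R₃ (fun n => (n : ℝ)⁻¹) ∧
      ∀ᶠ n in atTop, ∀ z, W.QHat M n z (W.est n z) ≤
        C * W.δ n ^ 2 + |R₁ n z| + |R₂ n z| + |R₃ n z| := by
  obtain ⟨η, hη, hmin⟩ := hW.rate.est_min
  obtain ⟨c₀, hc₀, R₁, R₂, hR₁, hR₂, hup⟩ := hW.rate.upper
  obtain ⟨C, hC⟩ := hW.rate.δ_dom
  refine ⟨max (c₀ * C + C * W.M₀) 0, le_max_right _ _, R₁, R₂, η, hR₁, hR₂, hη, ?_⟩
  filter_upwards [hmin, hup, hC, hW.rate.sieveParam_mem] with n h1 h2 h3 h4 z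
  have h5 := (h1 z).2 _ h4.1
  unfold Weighting.QPen at h5
  have hl := hW.basic.lam_pos n
  have h6 : 0 ≤ W.lam n * (M.Pen (W.est n z).2 : ℝ) := mul_nonneg hl.le (NNReal.coe_nonneg _)
  have hM0 : 0 ≤ W.M₀ := (NNReal.coe_nonneg _).trans h4.2
  have h7 : W.lam n * (M.Pen (L.sieveParam M n).2 : ℝ) ≤ C * W.δ n ^ 2 * W.M₀ :=
    (mul_le_mul_of_nonneg_left h4.2 hl.le).trans (mul_le_mul_of_nonneg_right h3.2 hM0)
  have h8 := mul_le_mul_of_nonneg_left h3.1 hc₀.le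
  have h9 := mul_le_mul_of_nonneg_right (le_max_left (c₀ * C + C * W.M₀) 0) (sq_nonneg (W.δ n))
  have h10 := h2 z
  have := le_abs_self (R₁ n z)
  have := le_abs_self (R₂ n z)
  have := le_abs_self (η n z)
  nlinarith

theorem Weighting.Conditions.est_mem (hW : W.Conditions M L) :
    ∀ᶠ p in wp L.P, W.est p.1 p.2 ∈ W.sieveSpaceM M p.1 := by
  obtain ⟨η, -, hmin⟩ := hW.rate.est_min
  filter_upwards [hW.rate.est_pen.eventually,
    eventually_wp_of_eventually (P := L.P) (q := fun n z => W.est n z ∈ M.sieveSpace n)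
      (hmin.mono fun n h z => (h z).1)] with p h1 h2
  exact ⟨h2, h1⟩

theorem eventually_le_wp {c : ℝ} {f : ℕ → ℝ} {P : ℕ → ProbabilityMeasure (X × Y)}
    (hf : Tendsto f atTop (𝓝 0)) (hc : 0 < c) : ∀ᶠ p in wp P, f p.1 ≤ c :=
  tendsto_fst_wp.eventually ((hf.eventually_lt_const hc).mono fun _ h => h.le)

theorem tendsto_natCast_inv : Tendsto (fun n : ℕ => (n : ℝ)⁻¹) atTop (𝓝 0) :=
  tendsto_inv_atTop_nhds_zero_nat

theorem Weighting.Conditions.QHat_est_small (hW : W.Conditions M L) {ε : ℝ} (hε : 0 < ε) :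
    ∀ᶠ p in wp L.P, W.QHat M p.1 p.2 (W.est p.1 p.2) ≤ ε := by
  obtain ⟨C, hC, R₁, R₂, R₃, h1, h2, h3, h⟩ := hW.exists_QHat_est_le
  have hδ : Tendsto (fun n => W.δ n ^ 2) atTop (𝓝 0) := by
    simpa using hW.basic.δ_tendsto.pow 2
  have hCδ : Tendsto (fun n => C * W.δ n ^ 2) atTop (𝓝 0) := by simpa using hδ.const_mul C
  have hε4 : 0 < ε / 4 := by positivity
  filter_upwards [h1.eventually_le hδ hε4, h2.eventually hε4, h3.eventually hε4,
    eventually_le_wp (P := L.P) tendsto_natCast_inv one_pos, eventually_le_wp (P := L.P) hCδ hε4,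
    tendsto_fst_wp.eventually h] with p g1 g2 g3 g4 g5 g6
  have := g6 p.2
  have g7 := mul_le_mul_of_nonneg_left g4 hε4.le
  linarith

/-- The population criterion is bounded away from zero outside neighbourhoods of `α₀`. -/
theorem Weighting.Conditions.exists_Q_ge (hM : M.Regular) (hW : W.Conditions M L) {r : ℝ} :
    0 < r → ∃ η : ℝ, 0 < η ∧ ∀ᶠ n in atTop, ∀ α ∈ M.space, (M.Pen α.2 : ℝ) ≤ W.M₀ →
      r ≤ strongNorm (α - M.α₀) → η ≤ W.Q M (L.P n) α := by
  intro hr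
  have hcont : ∀ β : Param dθ H, Continuous fun α : Param dθ H => strongNorm (α - β) := by
    intro β
    unfold strongNorm
    fun_prop
  set S : Set (Param dθ H) := (M.Θ ×ˢ {h | (M.Pen h : ℝ) ≤ W.M₀}) ∩
    {α | r ≤ strongNorm (α - M.α₀)}
  have hS : IsCompact S := (hM.compact_Θ.prod (hM.pen_compact W.M₀)).inter_right
    (isClosed_le continuous_const (hcont _))
  have hloc : ∀ a : Param dθ H, ∃ ra ηa : ℝ, 0 < ηa ∧ 0 < ra ∧ (a ∈ S → ∀ᶠ n in atTop,
      ∀ α ∈ M.space, strongNorm (α - a) < ra → ηa ≤ W.Q M (L.P n) α) := by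
    intro a
    by_cases ha : a ∈ S
    swap
    · exact ⟨1, 1, one_pos, one_pos, fun h => absurd h ha⟩
    have hne : a ≠ M.α₀ := by
      rintro rfl
      have h0 : r ≤ strongNorm (M.α₀ - M.α₀) := ha.2
      rw [sub_self] at h0
      have : strongNorm (0 : Param dθ H) = 0 := by simp [strongNorm]
      linarith
    have hpos := W.Q_pos hM hW.basic (a := a) ha.1.1 hne
    obtain ⟨ra, hra, hev⟩ := hW.rate.Q_lsc a ha.1.1 (W.Q M M.law a / 2) (half_pos hpos)
    refine ⟨ra, W.Q M M.law a / 2, half_pos hpos, hra, fun _ => ?_⟩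
    filter_upwards [hev] with n hn α hα hα'
    linarith [hn α hα hα']
  choose ra ηa hηa hra hev using hloc
  -- Semicontinuity holds from a sample size that depends on the centre `a`; a finite subcover makes
  -- that size and the lower bound uniform.
  obtain ⟨t, hcov⟩ := hS.elim_nhds_subcover' (fun a _ => {α | strongNorm (α - a) < ra a})
    (fun a _ => (isOpen_lt (hcont a) continuous_const).mem_nhds (by
      simp [strongNorm, hra a]))
  obtain ⟨η, hη, hηle⟩ : ∃ η : ℝ, 0 < η ∧ ∀ a ∈ t, η ≤ ηa a := by
    rcases t.eq_empty_or_nonempty with h | h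
    · exact ⟨1, one_pos, by simp [h]⟩
    · obtain ⟨x, hx, hmin⟩ := t.exists_min_image (fun a => ηa a) h
      exact ⟨ηa x, hηa _, hmin⟩
  refine ⟨η, hη, ?_⟩
  have hall : ∀ᶠ n in atTop, ∀ a ∈ t, ∀ α ∈ M.space, strongNorm (α - (a : Param dθ H)) < ra a →
      ηa a ≤ W.Q M (L.P n) α :=
    (Filter.eventually_all_finset t).2 fun a _ => hev a a.2
  filter_upwards [hall] with n hn α hα hpen hrα
  have hαS : α ∈ S := ⟨⟨hα, hpen⟩, hrα⟩
  have hmem := hcov hαS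
  simp only [Set.mem_iUnion] at hmem
  obtain ⟨a, ha, haα⟩ := hmem
  exact (hηle a ha).trans (hn a ha α hα haα)

/-- Consistency of the estimator in the strong norm, along the local alternatives. -/
theorem Weighting.Conditions.est_consistent (hM : M.Regular) (hW : W.Conditions M L) {r : ℝ}
    (hr : 0 < r) : ∀ᶠ p in wp L.P, W.est p.1 p.2 ∈ W.sieveNhd M r p.1 := by
  obtain ⟨η, hη, hQ⟩ := hW.exists_Q_ge hM hr
  obtain ⟨c, hc, hlow⟩ := hW.rate.lower
  have hlow' : ∀ᶠ p in wp L.P, ∀ α ∈ W.sieveSpaceM M p.1,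
      c * W.Q M (L.P p.1) α - c * η / 3 ≤ W.QHat M p.1 p.2 α := by
    rw [eventually_wp (q := fun n z => ∀ α ∈ W.sieveSpaceM M n,
      c * W.Q M (L.P n) α - c * η / 3 ≤ W.QHat M n z α), ENNReal.tendsto_nhds_zero]
    intro ε hε
    by_cases hε' : ε = ∞
    · simp [hε']
    obtain ⟨C, hC⟩ := hlow ε.toReal (ENNReal.toReal_pos hε.ne' hε')
    have h1 : Tendsto (fun n => C * W.δbar n ^ 2) atTop (𝓝 0) := by
      simpa using (hW.basic.δbar_tendsto.pow 2).const_mul C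
    filter_upwards [hC, h1.eventually_lt_const (show 0 < c * η / 3 by positivity)] with n hn hCn
    rw [ENNReal.ofReal_toReal hε'] at hn
    refine (measure_mono fun z hz => ?_).trans hn
    simp only [Set.mem_ofPred_eq] at hz ⊢
    push Not at hz
    obtain ⟨α, hα, hlt⟩ := hz
    exact ⟨α, hα, by linarith⟩
  filter_upwards [hlow', hW.est_mem, hW.QHat_est_small (show 0 < c * η / 3 by positivity),
    tendsto_fst_wp.eventually hQ] with p h1 h2 h3 h4
  refine ⟨h2, ?_⟩
  by_contra! hcon
  have h5 := h4 _ h2.1.1 h2.2 hcon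
  have h6 := h1 _ h2
  have h7 := mul_le_mul_of_nonneg_left h5 hc.le
  have : 0 < c * η := by positivity
  linarith

/-- The `O_P(δ_n²)` terms gain an arbitrarily small constant against `(M_n δ_n)²` since `M_n → ∞`;
the `o_P(n⁻¹)` terms are absorbed by `inv_le`. -/
theorem Weighting.Conditions.QHat_est_rate {a b k₀ : ℝ} (hM : M.Regular) (hL : L.Along M)
    (hW : W.Conditions M L) (hS : W.Scaling M L a b k₀) {ε : ℝ} (hε : 0 < ε) :
    ∀ᶠ p in wp L.P, W.QHat M p.1 p.2 (W.est p.1 p.2) ≤ ε * (W.slow M p.1 * W.δ p.1) ^ 2 := by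
  obtain ⟨C, hC, R₁, R₂, R₃, h1, h2, h3, h⟩ := hW.exists_QHat_est_le
  have hslow := Scaling.tendsto_slow hM hW hS
  set B := (b / k₀) ^ 2 with hB
  have hB0 : 0 < B := pow_pos (div_pos hS.b_pos hS.k_pos) 2
  have hε4 : 0 < ε / (4 * B) := by positivity
  filter_upwards [h1.eventually (fun n => sq_nonneg _) hslow, h2.eventually hε4,
    h3.eventually hε4, tendsto_fst_wp.eventually h,
    tendsto_fst_wp.eventually (Scaling.inv_le hM hL hW hS),
    tendsto_fst_wp.eventually (hslow.eventually_ge_atTop (max 1 ((C + 1) * (2 / ε))))]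
    with p g1 g2 g3 g4 g5 g6
  have g7 := g4 p.2
  set m := W.slow M p.1
  have hm1 : 1 ≤ m := (le_max_left _ _).trans g6
  have hm2 : (C + 1) * (2 / ε) ≤ m := (le_max_right _ _).trans g6
  have hm3 : C + 1 ≤ m * (ε / 2) := by
    rw [← div_le_iff₀ (by positivity)]
    calc (C + 1) / (ε / 2) = (C + 1) * (2 / ε) := by field_simp
      _ ≤ m := hm2
  have g8 : C * W.δ p.1 ^ 2 + m * W.δ p.1 ^ 2 ≤ ε / 2 * (m * W.δ p.1) ^ 2 := by
    have h1 : C + m ≤ m * (C + 1) := by nlinarith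
    have h2 : m * (C + 1) ≤ m * (m * (ε / 2)) := mul_le_mul_of_nonneg_left hm3 (by linarith)
    calc _ = (C + m) * W.δ p.1 ^ 2 := by ring
      _ ≤ m * (m * (ε / 2)) * W.δ p.1 ^ 2 :=
        mul_le_mul_of_nonneg_right (h1.trans h2) (sq_nonneg _)
      _ = _ := by ring
  have g9 : ε / (4 * B) * (p.1 : ℝ)⁻¹ ≤ ε / 4 * (m * W.δ p.1) ^ 2 := by
    calc _ ≤ ε / (4 * B) * (B * (m * W.δ p.1) ^ 2) := mul_le_mul_of_nonneg_left g5 hε4.le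
      _ = _ := by field_simp
  linarith

/-- Convergence rate of the estimator in the weak norm, along the local alternatives. -/
theorem Weighting.Conditions.est_rate {a b k₀ : ℝ} (hM : M.Regular) (hL : L.Along M)
    (hW : W.Conditions M L) (hS : W.Scaling M L a b k₀) {ε : ℝ} (hε : 0 < ε) :
    ∀ᶠ p in wp L.P,
      W.weakNorm M (W.est p.1 p.2 - L.param M p.1) ≤ ε * (W.slow M p.1 * W.δ p.1) := by
  obtain ⟨r, hr, ⟨c₁, c₂, hc₁, hcurv⟩, c, hc, hlow⟩ := hW.rate.near
  have hslow := Scaling.tendsto_slow hM hW hS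
  have hlow' : ∀ᶠ p in wp L.P, ∀ α ∈ W.sieveNhd M r p.1,
      c * W.Q M (L.P p.1) α - W.slow M p.1 * W.δ p.1 ^ 2 ≤ W.QHat M p.1 p.2 α := by
    refine eventually_wp_of_tight (q := fun C n z => ∀ α ∈ W.sieveNhd M r n,
      c * W.Q M (L.P n) α - C * W.δ n ^ 2 ≤ W.QHat M n z α) ?_ ?_ hslow
    · intro n z C C' hCC h α hα
      have := mul_le_mul_of_nonneg_right hCC (sq_nonneg (W.δ n))
      linarith [h α hα]
    · push Not
      exact hlow
  -- Half of `c c₁ (ε M_n δ_n)²` pays for the sample criterion at the estimator, the other half for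
  -- the uniform error `M_n δ_n²`.
  set ε' := c * c₁ * ε ^ 2 / 2 with hε'
  have hε'0 : 0 < ε' := by positivity
  filter_upwards [hlow', hW.est_consistent hM hr, hW.QHat_est_rate hM hL hS hε'0,
    tendsto_fst_wp.eventually hcurv,
    tendsto_fst_wp.eventually (hslow.eventually_ge_atTop (1 / ε' + 1))] with p h1 h2 h3 h4 h5
  have h6 := h1 _ h2
  have h7 := mul_le_mul_of_nonneg_left (h4 _ h2).1 hc.le
  have hinv : 0 < 1 / ε' := by positivity
  have hm0 : 0 ≤ W.slow M p.1 := by linarith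
  refine abs_le_of_sq_le_sq' ?_ (mul_nonneg hε.le (mul_nonneg hm0 (hW.basic.δ_pos _).le)) |>.2
  have h8 : W.slow M p.1 * W.δ p.1 ^ 2 ≤ ε' * (W.slow M p.1 * W.δ p.1) ^ 2 := by
    have h9 : 1 ≤ ε' * W.slow M p.1 := by
      rw [← div_le_iff₀' hε'0]; linarith
    have h10 := mul_le_mul_of_nonneg_right h9 (mul_nonneg hm0 (sq_nonneg (W.δ p.1)))
    calc _ = 1 * (W.slow M p.1 * W.δ p.1 ^ 2) := (one_mul _).symm
      _ ≤ _ := h10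
      _ = _ := by ring
  have h11 : c * c₁ * W.weakNorm M (W.est p.1 p.2 - L.param M p.1) ^ 2 ≤
      c * c₁ * (ε * (W.slow M p.1 * W.δ p.1)) ^ 2 := by
    have e : c * c₁ * (ε * (W.slow M p.1 * W.δ p.1)) ^ 2
      = 2 * (ε' * (W.slow M p.1 * W.δ p.1) ^ 2) := by rw [hε']; ring
    rw [e]
    linarith
  exact le_of_mul_le_mul_left h11 (mul_pos hc hc₁)

/-- The estimator lies in the shrinking neighbourhood of `α₀` with probability approaching
one, along the local alternatives. -/
theorem Weighting.Conditions.est_mem_N {a b k₀ : ℝ} (hM : M.Regular) (hL : L.Along M)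
    (hW : W.Conditions M L) (hS : W.Scaling M L a b k₀) :
    ∀ᶠ p in wp L.P, W.est p.1 p.2 ∈ W.N M p.1 := by
  obtain ⟨c, hc0, hc1, hnear⟩ := hW.strongNorm_sieveParam_sub hS.d_nonneg
  obtain ⟨C, hC0, hC⟩ := hW.weakNorm_sieveParam_sub_param hS.d_nonneg
  have hslow := Scaling.tendsto_slow hM hW hS
  -- The alternatives use a fraction `c < 1` of the radius, so a fraction `1 - c` is left for the
  -- estimation error.
  have hε : 0 < (1 - c) / 2 := by linarith
  filter_upwards [hW.est_rate hM hL hS hε, hW.est_mem, tendsto_fst_wp.eventually hnear,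
    tendsto_fst_wp.eventually hC, tendsto_fst_wp.eventually hW.rate.sieveParam_mem,
    tendsto_fst_wp.eventually (hslow.eventually_ge_atTop ((1 + C) / ((1 - c) / 2)))]
    with p h1 h2 h3 h4 h5 h6
  set n := p.1
  set e := W.est n p.2
  set m := W.slow M n
  have hV1 := M.sieveSpace_sub_param_mem_V hL h2.1
  have hV2 := M.sieveSpace_sub_param_mem_V hL h5.1
  have hm : 0 ≤ m := le_trans (by positivity) h6
  rw [div_le_iff₀ hε] at h6
  have hδ := (hW.basic.δ_pos n).le
  have hδs := W.δs_nonneg hW.basic n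
  have hill := W.ill_nonneg (M := M) n
  refine ⟨h2.1, ?_, ?_, h2.2⟩
  · have e1 : e - M.α₀ = (e - L.param M n) + L.d n • L.dir n := by
      unfold LocalAlt.param; abel
    rw [e1]
    have h7 := W.weakNorm_add_le hM hW.basic hV1 (M.V.smul_mem (L.d n) (hL.dir_mem_V n))
    rw [W.weakNorm_smul hM hW.basic (hL.dir_mem_V n), abs_of_nonneg (hS.d_nonneg n)] at h7
    have h8 := h3.1
    have h9 : ((1 - c) / 2 + c) * (m * W.δ n) ≤ 1 * (m * W.δ n) :=
      mul_le_mul_of_nonneg_right (by linarith) (mul_nonneg hm hδ)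
    linarith
  -- The ill-posedness bound applies only to sieve directions, and `α_n` may lie outside the sieve,
  -- so the strong norm goes through `Π_n α_n`.
  · have e1 : e - M.α₀ = (e - L.sieveParam M n) + (L.sieveParam M n - M.α₀) := by abel
    have e2 : e - L.sieveParam M n = (e - L.param M n) - (L.sieveParam M n - L.param M n) := by
      abel
    have h7 : W.weakNorm M (e - L.sieveParam M n) ≤ (1 - c) / 2 * (m * W.δ n) + C * W.δ n := by
      rw [e2]
      exact (W.weakNorm_sub_le hM hW.basic hV1 hV2).trans (add_le_add h1 h4)
    have h8 := W.strongNorm_le_ill hM hW.basic n (sub_mem (M.sieveSpace_subset_tangent n h2.1)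
      (M.sieveSpace_subset_tangent n h5.1))
    have h9 := mul_le_mul_of_nonneg_left h7 hill
    have h10 : W.ill M n * W.δ n ≤ W.δs M n := le_add_of_nonneg_left (norm_nonneg _)
    rw [e1]
    refine (strongNorm_add_le _ _).trans ((add_le_add (h8.trans h9) h3.2).trans ?_)
    have h11 : W.ill M n * ((1 - c) / 2 * (m * W.δ n) + C * W.δ n) ≤
        ((1 - c) / 2 * m + C) * W.δs M n := by
      calc _ = ((1 - c) / 2 * m + C) * (W.ill M n * W.δ n) := by ring
        _ ≤ _ := mul_le_mul_of_nonneg_left h10 (by positivity)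
    have h12 : (1 + C) * W.δs M n ≤ m * ((1 - c) / 2) * W.δs M n :=
      mul_le_mul_of_nonneg_right h6 hδs
    linarith

end Rates

/-! ### Two-sided quadratic bounds for the likelihood ratio statistic. -/

section QLR

set_option linter.unusedSectionVars false

variable {dθ dρ : ℕ} {X Y H : Type*} [MeasurableSpace X] [MeasurableSpace Y]
  [StandardBorelSpace Y] [Nonempty Y] [NormedAddCommGroup H] [NormedSpace ℝ H]
  {M : Model dθ dρ X Y H} {W : Weighting dθ dρ X Y H} {L : LocalAlt dθ X Y H}
  {a b k₀ : ℝ}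

theorem Weighting.ip_smul_left (hM : M.Regular) (hW : W.Basic M) {v y : Param dθ H}
    (hv : v ∈ M.V) (hy : y ∈ M.V) (c : ℝ) : W.ip M (c • v) y = c * W.ip M v y := by
  rw [W.ip_comm hW, W.ip_smul hM hW hv hy, W.ip_comm hW]

theorem Weighting.dφ_eq_mul_ip_u (hM : M.Regular) (hW : W.Basic M) {n : ℕ}
    (hsd : 0 < W.sdNorm M (W.riesz n)) {v : Param dθ H} (hv : v ∈ M.tangent n) :
    M.dφ v = W.sdNorm M (W.riesz n) * W.ip M (W.u M n) v := by
  rw [Weighting.u, W.ip_smul_left hM hW (M.tangent_le_V n (hW.riesz_mem n)) (M.tangent_le_V n hv),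
    ← mul_assoc, mul_inv_cancel₀ hsd.ne', one_mul, hW.riesz_spec n v hv]

theorem Weighting.weakNorm_riesz (hM : M.Regular) (hW : W.Basic M) {n : ℕ}
    (hsd : 0 < W.sdNorm M (W.riesz n)) :
    W.weakNorm M (W.riesz n) = W.sdNorm M (W.riesz n) * W.weakNorm M (W.u M n) := by
  rw [Weighting.u, W.weakNorm_smul hM hW (M.tangent_le_V n (hW.riesz_mem n)),
    abs_of_pos (inv_pos.2 hsd), ← mul_assoc, mul_inv_cancel₀ hsd.ne', one_mul]

namespace Weighting.Scaling

theorem sdNorm_pos (hM : M.Regular) (hW : W.Basic M) (h : W.Scaling M L a b k₀) :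
    ∀ᶠ n in atTop, 0 < W.sdNorm M (W.riesz n) := by
  filter_upwards [h.u_bounds] with n hn
  refine (Real.sqrt_nonneg _).lt_of_ne fun h0 => ?_
  have h1 : W.u M n = 0 := by
    change 0 = W.sdNorm M (W.riesz n) at h0
    rw [Weighting.u, ← h0, inv_zero, zero_smul]
  rw [h1, W.weakNorm_zero hM hW] at hn
  exact hn.1.not_gt h.a_pos

/-- Linearization of the functional on the shrinking neighbourhoods. -/
theorem φ_linear (hM : M.Regular) (hW : W.Conditions M L) (h : W.Scaling M L a b k₀) {ε : ℝ}
    (hε : 0 < ε) : ∀ᶠ n : ℕ in atTop, 0 < W.sdNorm M (W.riesz n) ∧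
      ∀ α ∈ W.N M n, ∀ t ∈ W.T M n,
      |√n * (M.φ (α + t • W.u M n) - M.φ M.α₀) - W.sdNorm M (W.riesz n) *
        (√n * W.ip M (W.u M n) (α - M.α₀) + √n * t * W.weakNorm M (W.u M n) ^ 2)| ≤
      ε * W.sdNorm M (W.riesz n) := by
  have hb := h.b_pos
  have hε' : 0 < ε / (2 * b) := by positivity
  filter_upwards [sdNorm_pos hM hW.basic h, hW.phi.nonlinear _ hε',
    hW.phi.bias.eventually_lt_const hε', h.u_bounds] with n hsd h1 h2 hu
  refine ⟨hsd, fun α hα t ht => ?_⟩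
  have h3 := h1 α hα t ht
  set sd := W.sdNorm M (W.riesz n)
  set u := W.u M n
  have huT := W.u_mem hW.basic n
  have huV := W.u_mem_V hW.basic n
  have hU : 0 < W.weakNorm M u := h.a_pos.trans_le hu.1
  have hr : W.weakNorm M (W.riesz n) = sd * W.weakNorm M u := W.weakNorm_riesz hM hW.basic hsd
  have hrle : ε / (2 * b) * W.weakNorm M (W.riesz n) ≤ ε / 2 * sd := by
    rw [hr]
    calc _ ≤ ε / (2 * b) * (sd * b) := by gcongr; exact hu.2
      _ = _ := by field_simp
  rw [div_lt_iff₀ (by rw [hr]; positivity)] at h2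
  have hαT := M.sieveSpace_subset_tangent n hα.1
  have ha := hW.basic.approx_mem n
  -- The representer acts only on the first and last terms, which are sieve directions. The middle
  -- one is the negligible bias, and by orthogonality (`ip_approx`) `approx` may be replaced by `α₀`
  -- in the inner product with `u`.
  have e1 : α + t • u - M.α₀ = (α - W.approx n) + (W.approx n - M.α₀) + t • u := by abel
  have e2 : M.dφ (α + t • u - M.α₀) = sd * (W.ip M u (α - M.α₀) + t * W.weakNorm M u ^ 2)
      + M.dφ (W.approx n - M.α₀) := by
    rw [e1, map_add, map_add, map_smul, W.dφ_eq_mul_ip_u hM hW.basic hsd (sub_mem hαT ha),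
      W.dφ_eq_mul_ip_u hM hW.basic hsd huT, W.weakNorm_sq hW.basic, smul_eq_mul]
    have e3 : W.ip M u (α - W.approx n) = W.ip M u (α - M.α₀) := by
      rw [← sub_sub_sub_cancel_right α _ M.α₀, W.ip_sub hM hW.basic
        (M.sieveSpace_sub_mem_V hα.1) (sub_mem (M.tangent_le_V n ha) M.α₀_mem_V) huV,
        W.ip_approx hM hW.basic n huT, sub_zero]
    rw [e3]
    ring
  rw [e2] at h3
  have e4 : √n * (M.φ (α + t • u) - M.φ M.α₀) -
      sd * (√n * W.ip M u (α - M.α₀) + √n * t * W.weakNorm M u ^ 2) =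
      √n * (M.φ (α + t • u) - M.φ M.α₀ - (sd * (W.ip M u (α - M.α₀) + t * W.weakNorm M u ^ 2)
      + M.dφ (W.approx n - M.α₀))) + √n * M.dφ (W.approx n - M.α₀) := by ring
  rw [e4]
  refine (abs_add_le _ _).trans ?_
  rw [abs_mul, abs_mul, abs_of_nonneg (Real.sqrt_nonneg (n : ℝ))]
  linarith

/-- The case `t = 0` of `φ_linear`. -/
theorem restricted_ip_le (hM : M.Regular) (hL : L.Along M) (hW : W.Conditions M L)
    (h : W.Scaling M L a b k₀) {ε : ℝ} (hε : 0 < ε) : ∀ᶠ n : ℕ in atTop, ∀ α ∈ W.N M n,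
      M.φ α = M.φ M.α₀ → |√n * W.ip M (W.u M n) (α - M.α₀)| ≤ ε := by
  filter_upwards [φ_linear hM hW h hε, mem_T hM hL hW h le_rfl] with n h1 hT α hα hφ
  have h2 := h1.2 α hα 0 (hT 0 (by simp))
  simp only [zero_smul, add_zero, hφ, sub_self, mul_zero, zero_mul, zero_sub, abs_neg] at h2
  rw [abs_mul, abs_of_pos h1.1, mul_comm] at h2
  exact le_of_mul_le_mul_right h2 h1.1

/-- Elements of the shrinking neighbourhood can be moved along `u_n^*` into the restricted set. -/
theorem exists_restricted (hM : M.Regular) (hL : L.Along M) (hW : W.Conditions M L)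
    (h : W.Scaling M L a b k₀) {ε : ℝ} (hε : 0 < ε) : ∀ᶠ n : ℕ in atTop, ∀ α ∈ W.N M n,
      ∃ t ∈ W.T M n, M.φ (α + t • W.u M n) = M.φ M.α₀ ∧
        |√n * W.ip M (W.u M n) (α - M.α₀) + √n * t * W.weakNorm M (W.u M n) ^ 2| ≤ ε := by
  have ha := h.a_pos
  have hb := h.b_pos
  filter_upwards [φ_linear hM hW h (half_pos hε),
    mem_T hM hL hW h (K := max b ε / a ^ 2) (by positivity), h.u_bounds, eventually_gt_atTop 0,
    W.slow_nonneg hW.basic] with n h1 hT hu hn hslow α hα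
  obtain ⟨hsd, h1⟩ := h1
  have hn' : 0 < √(n : ℝ) := Real.sqrt_pos.2 (by exact_mod_cast hn)
  set sd := W.sdNorm M (W.riesz n)
  set u := W.u M n
  set U := W.weakNorm M u
  set w := W.ip M u (α - M.α₀)
  have hU : 0 < U := ha.trans_le hu.1
  have hU2 : 0 < U ^ 2 := pow_pos hU 2
  have hr : 0 ≤ W.slow M n * W.δ n := mul_nonneg hslow (hW.basic.δ_pos n).le
  have hw : |√n * w| ≤ √n * (b * (W.slow M n * W.δ n)) := by
    rw [abs_mul, abs_of_pos hn']
    refine mul_le_mul_of_nonneg_left ?_ hn'.le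
    exact (W.abs_ip_le hM hW.basic (W.u_mem_V hW.basic n) (M.sieveSpace_sub_mem_V hα.1)).trans
      (mul_le_mul hu.2 hα.2.1 (W.weakNorm_nonneg _) hb.le)
  have hmem : ∀ t : ℝ, |√n * w + √n * t * U ^ 2| ≤ ε → t ∈ W.T M n := by
    intro t ht
    refine hT t ?_
    have h2 : √n * |t| * U ^ 2 ≤ ε + √n * (b * (W.slow M n * W.δ n)) := by
      have e : √n * |t| * U ^ 2 = |√n * t * U ^ 2| := by
        rw [abs_mul, abs_mul, abs_of_pos hn', abs_of_pos hU2]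
      rw [e]
      calc |√n * t * U ^ 2| = |(√n * w + √n * t * U ^ 2) - √n * w| := by ring_nf
        _ ≤ _ := (abs_sub _ _).trans (add_le_add ht hw)
    have h3 : √n * |t| * a ^ 2 ≤ √n * |t| * U ^ 2 := by
      have := pow_le_pow_left₀ ha.le hu.1 2
      gcongr
    rw [div_mul_eq_mul_div, le_div_iff₀ (by positivity)]
    have h4 : b * (√n * (W.slow M n * W.δ n)) ≤ max b ε * (√n * (W.slow M n * W.δ n)) :=
      mul_le_mul_of_nonneg_right (le_max_left _ _) (mul_nonneg hn'.le hr)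
    have h5 := le_max_right b ε
    nlinarith
  -- This reparametrizes `t` so that the linearized functional, divided by `sd`, is `x`. The
  -- linearization error is at most `ε/2` in this scale, so `φ - φ(α₀)` changes sign between `x =
  -- -ε` and `x = ε`.
  set τ : ℝ → ℝ := fun x => (x - √n * w) / (√n * U ^ 2) with hτdef
  have hτ : ∀ x, √n * w + √n * τ x * U ^ 2 = x := by
    intro x
    rw [hτdef]
    field_simp
    ring
  have hτT : ∀ x, |x| ≤ ε → τ x ∈ W.T M n := fun x hx => hmem _ (by rw [hτ]; exact hx)
  have hcont : Continuous fun x => M.φ (α + τ x • u) - M.φ M.α₀ := by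
    have h2 := hM.φ_continuous
    have h3 : Continuous τ := by fun_prop
    fun_prop
  have hlo : M.φ (α + τ (-ε) • u) - M.φ M.α₀ ≤ 0 := by
    have h2 := (abs_le.1 (h1 α hα _ (hτT (-ε) (by rw [abs_neg, abs_of_pos hε])))).2
    rw [hτ] at h2
    have h3 : √n * (M.φ (α + τ (-ε) • u) - M.φ M.α₀) ≤ √n * 0 := by nlinarith
    exact le_of_mul_le_mul_left h3 hn'
  have hhi : 0 ≤ M.φ (α + τ ε • u) - M.φ M.α₀ := by
    have h2 := (abs_le.1 (h1 α hα _ (hτT ε (by rw [abs_of_pos hε])))).1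
    rw [hτ] at h2
    have h3 : √n * 0 ≤ √n * (M.φ (α + τ ε • u) - M.φ M.α₀) := by nlinarith
    exact le_of_mul_le_mul_left h3 hn'
  obtain ⟨x, hx, hx0⟩ := intermediate_value_Icc (show -ε ≤ ε by linarith) hcont.continuousOn
    ⟨hlo, hhi⟩
  have hxε : |x| ≤ ε := abs_le.2 hx
  exact ⟨τ x, hτT x hxε, sub_eq_zero.1 hx0, by rw [hτ]; exact hxε⟩

/-- The local quadratic approximation in terms of the scaled deviation `√n t`. -/
theorem quadratic_approx (hM : M.Regular) (hL : L.Along M) (hW : W.Conditions M L)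
    {ε : ℝ} (hε : 0 < ε) : ∀ᶠ p in wp L.P, ∀ α ∈ W.N M p.1, ∀ t ∈ W.T M p.1,
      |p.1 * (W.QHat M p.1 p.2 (α + t • W.u M p.1) - W.QHat M p.1 p.2 α) -
        (2 * (√p.1 * t) * (√p.1 * W.Zn M p.1 (L.param M p.1) p.2 - W.shift M L p.1 +
          √p.1 * W.ip M (W.u M p.1) (α - M.α₀)) +
          W.weakNorm M (W.u M p.1) ^ 2 * (√p.1 * t) ^ 2)| ≤
      ε * ((√p.1 * t) ^ 2 + |√p.1 * t| + 1) := by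
  have hε3 : 0 < ε / 3 := by positivity
  have hexp : ∀ᶠ p in wp L.P, ∀ α ∈ W.N M p.1, ∀ t ∈ W.T M p.1,
      |(W.QHat M p.1 p.2 (α + t • W.u M p.1) - W.QHat M p.1 p.2 α) / 2
          - t * (W.Zn M p.1 (L.param M p.1) p.2 + W.ip M (W.u M p.1) (α - L.param M p.1))
          - W.B p.1 p.2 / 2 * t ^ 2| ≤ ε / 3 * max (max (t ^ 2) (|t| * (√p.1)⁻¹)) (W.s p.1) := by
    rw [eventually_wp (q := fun n z => ∀ α ∈ W.N M n, ∀ t ∈ W.T M n,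
      |(W.QHat M n z (α + t • W.u M n) - W.QHat M n z α) / 2
          - t * (W.Zn M n (L.param M n) z + W.ip M (W.u M n) (α - L.param M n))
          - W.B n z / 2 * t ^ 2| ≤ ε / 3 * max (max (t ^ 2) (|t| * (√n)⁻¹)) (W.s n))]
    push Not
    exact hW.lqa.expansion _ hε3
  filter_upwards [hexp, hW.lqa.B_lim.eventually hε3,
    tendsto_fst_wp.eventually (hW.lqa.s_small.eventually_lt_const one_pos),
    tendsto_fst_wp.eventually (eventually_gt_atTop 0)] with p h1 h2 h3 hn α hα t ht
  have h4 := h1 α hα t ht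
  set n := p.1
  set z := p.2
  set u := W.u M n
  have hn0 : 0 < (n : ℝ) := by exact_mod_cast hn
  have hn' : 0 < √(n : ℝ) := Real.sqrt_pos.2 hn0
  have hnn : √(n : ℝ) * √n = n := Real.mul_self_sqrt hn0.le
  have hip : W.ip M u (α - L.param M n) = W.ip M u (α - M.α₀) - L.d n * W.ip M u (L.dir n) := by
    rw [← W.ip_smul hM hW.basic (hL.dir_mem_V n) (W.u_mem_V hW.basic n),
      ← W.ip_sub hM hW.basic (M.sieveSpace_sub_mem_V hα.1) (M.V.smul_mem _ (hL.dir_mem_V n))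
        (W.u_mem_V hW.basic n), LocalAlt.param, sub_sub]
  rw [hip] at h4
  -- In the scaled deviation the three error rates become `s²`, `|s|` and `n s_n`, the last below
  -- `1` eventually.
  have hmax : n * max (max (t ^ 2) (|t| * (√n)⁻¹)) (W.s n) ≤ (√n * t) ^ 2 + |√n * t| + 1 := by
    have e1 : n * t ^ 2 = (√n * t) ^ 2 := by rw [mul_pow, Real.sq_sqrt hn0.le]
    have e2 : n * (|t| * (√n)⁻¹) = |√n * t| := by
      rw [abs_mul, abs_of_pos hn', mul_left_comm, ← div_eq_mul_inv, Real.div_sqrt, mul_comm]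
    rw [mul_max_of_nonneg _ _ hn0.le, mul_max_of_nonneg _ _ hn0.le, e1, e2]
    have := sq_nonneg (√n * t)
    have := abs_nonneg (√n * t)
    refine max_le (max_le ?_ ?_) ?_ <;> linarith
  set D := W.QHat M n z (α + t • u) - W.QHat M n z α
  set Zn := W.Zn M n (L.param M n) z
  set w := W.ip M u (α - M.α₀)
  set κ := W.ip M u (L.dir n)
  set r := D / 2 - t * (Zn + (w - L.d n * κ)) - W.B n z / 2 * t ^ 2 with hr
  have h5 : |(n : ℝ) * r| ≤ ε / 3 * ((√n * t) ^ 2 + |√n * t| + 1) := by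
    rw [abs_mul, abs_of_pos hn0]
    calc n * |r| ≤ n * (ε / 3 * max (max (t ^ 2) (|t| * (√n)⁻¹)) (W.s n)) := by gcongr
      _ = ε / 3 * (n * max (max (t ^ 2) (|t| * (√n)⁻¹)) (W.s n)) := by ring
      _ ≤ _ := mul_le_mul_of_nonneg_left hmax hε3.le
  have e : n * D - (2 * (√n * t) * (√n * Zn - W.shift M L n + √n * w) +
      W.weakNorm M u ^ 2 * (√n * t) ^ 2) =
      2 * (n * r) + (W.B n z - W.weakNorm M u ^ 2) * (√n * t) ^ 2 := by
    rw [hr, Weighting.shift, mul_pow, sq (√(n : ℝ)), hnn]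
    change n * D - (2 * (√n * t) * (√n * Zn - √n * (L.d n * κ) + √n * w) +
      W.weakNorm M u ^ 2 * (n * t ^ 2)) = _
    have e3 : 2 * (√n * t) * (√n * Zn - √n * (L.d n * κ) + √n * w) =
      (√n * √n) * (2 * t * (Zn - L.d n * κ + w)) := by ring
    rw [e3, hnn]
    ring
  rw [e]
  refine (abs_add_le _ _).trans ?_
  rw [abs_mul 2, abs_mul (W.B n z - W.weakNorm M u ^ 2), abs_of_pos (two_pos (α := ℝ)),
    abs_of_nonneg (sq_nonneg (√(n : ℝ) * t))]
  have h6 : |W.B n z - W.weakNorm M u ^ 2| * (√n * t) ^ 2 ≤ ε / 3 * (√n * t) ^ 2 := by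
    refine mul_le_mul_of_nonneg_right ?_ (sq_nonneg _)
    simpa using h2
  have := abs_nonneg (√n * t)
  nlinarith

/-- Perturbations of the restricted estimator do not improve on the estimator. -/
theorem est_le (hM : M.Regular) (hL : L.Along M) (hW : W.Conditions M L)
    (h : W.Scaling M L a b k₀) {ε : ℝ} (hε : 0 < ε) : ∀ᶠ p in wp L.P, ∀ t ∈ W.T M p.1,
      p.1 * (W.QHat M p.1 p.2 (W.est p.1 p.2) -
        W.QHat M p.1 p.2 (W.estR p.1 p.2 + t • W.u M p.1)) ≤ ε := by
  obtain ⟨η, hη, hmin⟩ := hW.rate.est_min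
  have hε2 : 0 < ε / 2 := half_pos hε
  filter_upwards [hW.est_mem_N hM hL h, hW.restricted.estR_mem.eventually, hη.eventually hε2,
    tendsto_fst_wp.eventually hmin, tendsto_fst_wp.eventually hW.lqa.stays,
    tendsto_fst_wp.eventually (hW.rate.pen_negl _ hε2),
    tendsto_fst_wp.eventually (eventually_gt_atTop 0)] with p h1 h2 h3 h4 h5 h6 hn t ht
  have hn0 : 0 < (p.1 : ℝ) := by exact_mod_cast hn
  have h7 := (h4 p.2).2 _ (h5 _ h2 t ht)
  have h8 := h6 _ h2 _ h1 t ht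
  unfold Weighting.QPen at h7
  have hl := hW.basic.lam_pos p.1
  have h9 := mul_le_mul_of_nonneg_left
    (le_abs_self ((M.Pen (W.estR p.1 p.2 + t • W.u M p.1).2 : ℝ) - M.Pen (W.est p.1 p.2).2)) hl.le
  have h10 := le_abs_self (η p.1 p.2)
  have h11 : W.QHat M p.1 p.2 (W.est p.1 p.2) -
      W.QHat M p.1 p.2 (W.estR p.1 p.2 + t • W.u M p.1) ≤ ε * (p.1 : ℝ)⁻¹ := by linarith
  calc _ ≤ p.1 * (ε * (p.1 : ℝ)⁻¹) := mul_le_mul_of_nonneg_left h11 hn0.le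
    _ = ε := by field_simp

/-- Perturbations of the estimator which satisfy the restriction do not improve on the
restricted estimator. -/
theorem estR_le (hM : M.Regular) (hL : L.Along M) (hW : W.Conditions M L)
    (h : W.Scaling M L a b k₀) {ε : ℝ} (hε : 0 < ε) : ∀ᶠ p in wp L.P, ∀ t ∈ W.T M p.1,
      M.φ (W.est p.1 p.2 + t • W.u M p.1) = M.φ M.α₀ →
      p.1 * (W.QHat M p.1 p.2 (W.estR p.1 p.2) -
        W.QHat M p.1 p.2 (W.est p.1 p.2 + t • W.u M p.1)) ≤ ε := by
  obtain ⟨η, hη, hmin⟩ := hW.restricted.estR_min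
  have hε2 : 0 < ε / 2 := half_pos hε
  filter_upwards [hW.est_mem_N hM hL h, hW.restricted.estR_mem.eventually, hη.eventually hε2,
    tendsto_fst_wp.eventually hmin, tendsto_fst_wp.eventually hW.lqa.stays,
    tendsto_fst_wp.eventually (hW.rate.pen_negl _ hε2),
    tendsto_fst_wp.eventually (eventually_gt_atTop 0)] with p h1 h2 h3 h4 h5 h6 hn t ht hφ
  have hn0 : 0 < (p.1 : ℝ) := by exact_mod_cast hn
  have h7 := (h4 p.2).2 _ ⟨h5 _ h1 t ht, hφ⟩
  have h8 := h6 _ h1 _ h2 t ht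
  unfold Weighting.QPen at h7
  have hl := hW.basic.lam_pos p.1
  have h9 := mul_le_mul_of_nonneg_left
    (le_abs_self ((M.Pen (W.est p.1 p.2 + t • W.u M p.1).2 : ℝ) - M.Pen (W.estR p.1 p.2).2)) hl.le
  have h10 := le_abs_self (η p.1 p.2)
  have h11 : W.QHat M p.1 p.2 (W.estR p.1 p.2) -
      W.QHat M p.1 p.2 (W.est p.1 p.2 + t • W.u M p.1) ≤ ε * (p.1 : ℝ)⁻¹ := by linarith
  calc _ ≤ p.1 * (ε * (p.1 : ℝ)⁻¹) := mul_le_mul_of_nonneg_left h11 hn0.le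
    _ = ε := by field_simp

/-- `c` is `g` truncated to `[-|K|, |K|]`. It keeps the perturbation in `le_QLR` bounded without any
tightness of the score. -/
theorem exists_clamp (g K : ℝ) : ∃ c : ℝ, |c| ≤ |K| ∧ c ^ 2 = min (g ^ 2) (K ^ 2) ∧
    c ^ 2 ≤ c * g := by
  rcases le_or_gt |g| |K| with h | h
  · exact ⟨g, h, (min_eq_left (sq_le_sq.2 h)).symm, (sq g).le⟩
  · have h2 : min (g ^ 2) (K ^ 2) = K ^ 2 := min_eq_right (sq_le_sq.2 h.le)
    rcases le_or_gt 0 g with hg | hg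
    · rw [abs_of_nonneg hg] at h
      refine ⟨|K|, (abs_abs K).le, by rw [h2, sq_abs], ?_⟩
      rw [sq]
      exact mul_le_mul_of_nonneg_left h.le (abs_nonneg K)
    · rw [abs_of_neg hg] at h
      refine ⟨-|K|, by rw [abs_neg, abs_abs], by rw [h2, neg_sq, sq_abs], ?_⟩
      nlinarith [abs_nonneg K]

/-- Asymptotic lower bound for the quasi likelihood ratio statistic. -/
theorem le_QLR (hM : M.Regular) (hL : L.Along M) (hW : W.Conditions M L)
    (h : W.Scaling M L a b k₀) (K : ℝ) {ε : ℝ} (hε : 0 < ε) : ∀ᶠ p in wp L.P,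
      min ((√p.1 * W.Zn M p.1 (L.param M p.1) p.2 - W.shift M L p.1) ^ 2) (K ^ 2) - ε ≤
        W.weakNorm M (W.u M p.1) ^ 2 * W.QLR M p.1 p.2 := by
  have ha := h.a_pos
  have hb := h.b_pos
  set S := |K| / a ^ 2 with hS
  have hS0 : 0 ≤ S := by positivity
  -- Errors in units of `ε₁`: `S² + S + 1` from the expansion, `2S` from the restriction and `1`
  -- from approximate minimization; `b²` accounts for the factor `U²`.
  set ε₁ := ε / (b ^ 2 * (S ^ 2 + 3 * S + 2)) with hε₁
  have hε₁0 : 0 < ε₁ := by positivity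
  obtain ⟨η, -, hmin⟩ := hW.restricted.estR_min
  filter_upwards [est_le hM hL hW h hε₁0, quadratic_approx hM hL hW hε₁0,
    hW.restricted.estR_mem.eventually, tendsto_fst_wp.eventually hmin,
    tendsto_fst_wp.eventually (restricted_ip_le hM hL hW h hε₁0),
    tendsto_fst_wp.eventually (mem_T hM hL hW h hS0), tendsto_fst_wp.eventually h.u_bounds,
    tendsto_fst_wp.eventually (eventually_gt_atTop 0),
    tendsto_fst_wp.eventually (W.slow_nonneg hW.basic)] with p h1 h2 h3 h4 h5 h6 hu hn hslow
  have hn' : 0 < √(p.1 : ℝ) := Real.sqrt_pos.2 (by exact_mod_cast hn)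
  have hw := h5 _ h3 (h4 p.2).1.2
  set G := √p.1 * W.Zn M p.1 (L.param M p.1) p.2 - W.shift M L p.1
  set U := W.weakNorm M (W.u M p.1)
  set w := √p.1 * W.ip M (W.u M p.1) (W.estR p.1 p.2 - M.α₀)
  have hU : 0 < U := ha.trans_le hu.1
  obtain ⟨c, hcK, hc2, hcG⟩ := exists_clamp G K
  -- The minimizer `-G/U²` of the parabola, with `G` truncated; `c² ≤ cG` then gives a decrease of
  -- at least `c²/U²`.
  set s := -(c / U ^ 2) with hs
  have hsS : |s| ≤ S := by
    rw [hs, abs_neg, abs_div, abs_of_pos (pow_pos hU 2), hS]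
    exact div_le_div₀ (abs_nonneg _) hcK (pow_pos ha 2) (pow_le_pow_left₀ ha.le hu.1 2)
  have e : √p.1 * (s / √p.1) = s := by field_simp
  have ht : s / √p.1 ∈ W.T M p.1 := by
    refine h6 _ ?_
    have e2 : √p.1 * |s / √p.1| = |s| := by
      rw [abs_div, abs_of_pos hn']; field_simp
    rw [e2]
    refine hsS.trans (le_mul_of_one_le_right hS0 ?_)
    have := mul_nonneg hn'.le (mul_nonneg hslow (hW.basic.δ_pos p.1).le)
    linarith
  have h7 := h1 _ ht
  have h8 := (abs_le.1 (h2 _ h3 _ ht)).2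
  rw [e] at h8
  have h9 : ε₁ * (s ^ 2 + |s| + 1) ≤ ε₁ * (S ^ 2 + S + 1) := by
    have : s ^ 2 ≤ S ^ 2 := by rw [← sq_abs s]; exact pow_le_pow_left₀ (abs_nonneg _) hsS 2
    gcongr
  have h10 : 2 * s * w ≤ 2 * S * ε₁ := by
    have : s * w ≤ S * ε₁ := (le_abs_self _).trans (by
      rw [abs_mul]; exact mul_le_mul hsS hw (abs_nonneg _) hS0)
    linarith
  have h11 : U ^ 2 * (2 * s * G + U ^ 2 * s ^ 2) ≤ -c ^ 2 := by
    have : U ^ 2 * (2 * s * G + U ^ 2 * s ^ 2) = -2 * (c * G) + c ^ 2 := by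
      rw [hs]; field_simp
    linarith
  have h12 : -(2 * s * G + U ^ 2 * s ^ 2) - ε₁ * (S ^ 2 + 3 * S + 2) ≤ W.QLR M p.1 p.2 := by
    unfold Weighting.QLR
    linarith
  have h13 := mul_le_mul_of_nonneg_left h12 (sq_nonneg U)
  have h14 : U ^ 2 * (ε₁ * (S ^ 2 + 3 * S + 2)) ≤ ε := by
    calc _ ≤ b ^ 2 * (ε₁ * (S ^ 2 + 3 * S + 2)) := by
          have := pow_le_pow_left₀ hU.le hu.2 2
          gcongr
      _ = ε := by rw [hε₁]; field_simp
  rw [← hc2]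
  linarith

/-- Asymptotic upper bound for the quasi likelihood ratio statistic. -/
theorem QLR_le (hM : M.Regular) (hL : L.Along M) (hW : W.Conditions M L)
    (h : W.Scaling M L a b k₀) {ε : ℝ} (hε : 0 < ε) : ∀ᶠ p in wp L.P,
      W.weakNorm M (W.u M p.1) ^ 2 * W.QLR M p.1 p.2 ≤
      (1 + ε) * (√p.1 * W.Zn M p.1 (L.param M p.1) p.2 - W.shift M L p.1) ^ 2 + ε := by
  have ha := h.a_pos
  have hb := h.b_pos
  -- The total error is at most `ε₁(s² + 3|s| + 2) ≤ ε₁(4s² + 5)`. The first bound lets the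
  -- curvature absorb `4 ε₁ s²`, the second makes the constant part at most `ε`.
  set ε₁ := min (ε * a ^ 2 / (4 * (1 + ε))) (ε / (5 * b ^ 2)) with hε₁
  have hε₁0 : 0 < ε₁ := by
    have h1 : 0 < ε * a ^ 2 / (4 * (1 + ε)) := by positivity
    have h2 : 0 < ε / (5 * b ^ 2) := by positivity
    exact lt_min h1 h2
  filter_upwards [estR_le hM hL hW h hε₁0, quadratic_approx hM hL hW hε₁0,
    hW.est_mem_N hM hL h, tendsto_fst_wp.eventually (exists_restricted hM hL hW h hε₁0),
    tendsto_fst_wp.eventually h.u_bounds] with p h1 h2 h3 h4 hu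
  obtain ⟨t, ht, hφ, hw⟩ := h4 _ h3
  have h5 := h1 t ht hφ
  have h6 := (abs_le.1 (h2 _ h3 t ht)).2
  set G := √p.1 * W.Zn M p.1 (L.param M p.1) p.2 - W.shift M L p.1
  set U := W.weakNorm M (W.u M p.1)
  set w := √p.1 * W.ip M (W.u M p.1) (W.est p.1 p.2 - M.α₀)
  set s := √p.1 * t
  have hU : 0 < U := ha.trans_le hu.1
  have hU2 : a ^ 2 ≤ U ^ 2 := pow_le_pow_left₀ ha.le hu.1 2
  have hb2 : U ^ 2 ≤ b ^ 2 := pow_le_pow_left₀ hU.le hu.2 2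
  have h7 : s * (w + s * U ^ 2) ≤ |s| * ε₁ := (le_abs_self _).trans (by
    rw [abs_mul]; exact mul_le_mul_of_nonneg_left hw (abs_nonneg _))
  have h8 : |s| ≤ s ^ 2 + 1 := by nlinarith [sq_abs s, sq_nonneg (|s| - 1)]
  have h8' := mul_le_mul_of_nonneg_left h8 hε₁0.le
  have h9 : W.QLR M p.1 p.2 ≤ 2 * s * G - (U ^ 2 - 4 * ε₁) * s ^ 2 + 5 * ε₁ := by
    unfold Weighting.QLR
    linarith
  have h10 := mul_le_mul_of_nonneg_left h9 (sq_nonneg U)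
  have h11 : 5 * ε₁ * U ^ 2 ≤ ε := by
    calc 5 * ε₁ * U ^ 2 ≤ 5 * (ε / (5 * b ^ 2)) * b ^ 2 := by
          have := min_le_right (ε * a ^ 2 / (4 * (1 + ε))) (ε / (5 * b ^ 2))
          gcongr
      _ = ε := by field_simp
  have h12 : 4 * ε₁ * (1 + ε) ≤ ε * U ^ 2 := by
    have h13 := min_le_left (ε * a ^ 2 / (4 * (1 + ε))) (ε / (5 * b ^ 2))
    rw [← hε₁, le_div_iff₀ (by positivity)] at h13
    have := mul_le_mul_of_nonneg_left hU2 hε.le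
    linarith
  -- Young's inequality with weight `1 + ε` leaves enough of the quadratic term to pay for `4 ε₁
  -- s²`, so `s` need not be bounded.
  have h13 : 2 * (U ^ 2 * s) * G ≤ (1 + ε) * G ^ 2 + (U ^ 2 * s) ^ 2 / (1 + ε) := by
    have e : (1 + ε) * G ^ 2 + (U ^ 2 * s) ^ 2 / (1 + ε) - 2 * (U ^ 2 * s) * G =
        ((1 + ε) * G - U ^ 2 * s) ^ 2 / (1 + ε) := by field_simp; ring
    have : 0 ≤ ((1 + ε) * G - U ^ 2 * s) ^ 2 / (1 + ε) := by positivity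
    linarith
  have h14 : (U ^ 2 * s) ^ 2 / (1 + ε) ≤ U ^ 2 * ((U ^ 2 - 4 * ε₁) * s ^ 2) := by
    rw [div_le_iff₀ (by positivity)]
    have : 0 ≤ U ^ 2 * s ^ 2 * (ε * U ^ 2 - 4 * ε₁ * (1 + ε)) :=
      mul_nonneg (by positivity) (by linarith)
    linarith
  linarith

end Weighting.Scaling

end QLR

/-! ### Shifts of the two tests and comparison of their power. -/

section Main

set_option linter.unusedSectionVars false

variable {dθ dρ : ℕ} {X Y H : Type*} [MeasurableSpace X] [MeasurableSpace Y]
  [StandardBorelSpace Y] [Nonempty Y] [NormedAddCommGroup H] [NormedSpace ℝ H]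
  {M : Model dθ dρ X Y H} {W W₀ : Weighting dθ dρ X Y H} {L : LocalAlt dθ X Y H}

theorem LocalAlt.Along.eventually_half_le (hL : L.Along M) :
    ∀ᶠ n in atTop, |L.κ| / 2 ≤ |M.dφ (L.dir n)| := by
  have h := hL.dφ_tendsto.abs
  filter_upwards [h.eventually_const_lt (half_lt_self (abs_pos.2 hL.κ_ne))] with n hn
  exact hn.le

/-- A representer of zero variance norm has zero weak norm, hence `dφ(Δ_n) = 0`, which is excluded
for large `n` by `κ ≠ 0`. -/
theorem Weighting.sdNorm_riesz_pos (hM : M.Regular) (hL : L.Along M) (hW : W.Basic M)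
    (hW₀ : W₀.Basic M) (hopt : ∀ᵐ x ∂(M.law : Measure (X × Y)).fst, W₀.Sig x = M.Sig₀ x) :
    ∀ᶠ n in atTop, 0 < W.sdNorm M (W.riesz n) := by
  obtain ⟨a, b, ha, hb, hab⟩ := W.exists_sdNorm_equiv hM hW hW₀ hopt
  filter_upwards [hL.eventually_half_le] with n hn
  refine (Real.sqrt_nonneg _).lt_of_ne fun h0 => ?_
  change 0 = W.sdNorm M (W.riesz n) at h0
  have hV := M.tangent_le_V n (hW.riesz_mem n)
  have h1 := (hab _ hV).2
  have h2 := W.abs_ip_le hM hW hV (hL.dir_mem_V n)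
  rw [← h0, mul_zero] at h1
  rw [← hW.riesz_spec n _ (hL.dir_mem n), le_antisymm h1 (W.weakNorm_nonneg _), zero_mul] at h2
  have := half_pos (abs_pos.2 hL.κ_ne)
  linarith

/-- The scale `σ` is kept free of `W`: with its own standard deviation norm the ratio is one, and
for the optimal weighting it is the relative inefficiency of the other one. -/
theorem Weighting.shift_eq (hM : M.Regular) (hL : L.Along M) (hW : W.Basic M) {σ : ℕ → ℝ}
    (hd : ∀ n : ℕ, L.d n = (√n)⁻¹ * σ n) {n : ℕ} (hn : 0 < n)
    (hsd : 0 < W.sdNorm M (W.riesz n)) :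
    W.shift M L n = σ n / W.sdNorm M (W.riesz n) * M.dφ (L.dir n) := by
  have hn' : 0 < √(n : ℝ) := Real.sqrt_pos.2 (by exact_mod_cast hn)
  rw [W.dφ_eq_mul_ip_u hM hW hsd (hL.dir_mem n), Weighting.shift, hd n]
  field_simp

theorem Weighting.measurable_sqrt_mul_Zn (hM : M.Regular) (hW : W.Basic M) (n : ℕ) :
    Measurable fun z : Fin n → X × Y => √n * W.Zn M n (L.param M n) z := by
  unfold Weighting.Zn
  refine Measurable.const_mul (Measurable.const_mul (Finset.measurable_sum _ fun i _ => ?_) _) _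
  exact (W.measurable_score hM hW (W.u_mem_V hW n) _).comp (measurable_pi_apply i)

/-- The limiting power of the quasi likelihood ratio test. -/
theorem Weighting.Conditions.tendsto_power (hM : M.Regular) (hL : L.Along M)
    (hW : W.Conditions M L) (hW₀ : W₀.Basic M)
    (hopt : ∀ᵐ x ∂(M.law : Measure (X × Y)).fst, W₀.Sig x = M.Sig₀ x)
    (hd : ∀ n : ℕ, L.d n = (√n)⁻¹ * W.sdNorm M (W.riesz n)) (t : ℝ) :
    Tendsto (fun n : ℕ => (sampleLaw (L.P n) n).real
      {z | t ≤ W.weakNorm M (W.u M n) ^ 2 * W.QLR M n z}) atTop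
      (𝓝 (1 - normalWindow L.κ √t)) := by
  obtain ⟨a, b, ha, hb, hab⟩ := W.exists_sdNorm_equiv hM hW.basic hW₀ hopt
  have hsd := W.sdNorm_riesz_pos hM hL hW.basic hW₀ hopt
  have hshift : ∀ᶠ n in atTop, M.dφ (L.dir n) = W.shift M L n := by
    filter_upwards [hsd, eventually_gt_atTop 0] with n h1 hn
    rw [W.shift_eq hM hL hW.basic hd hn h1, div_self h1.ne', one_mul]
  have hS : W.Scaling M L a b (|L.κ| / 2) := by
    refine ⟨ha, hb, half_pos (abs_pos.2 hL.κ_ne), fun n => ?_, ?_, ?_⟩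
    · rw [hd n]
      exact mul_nonneg (inv_nonneg.2 (Real.sqrt_nonneg _)) (W.sdNorm_nonneg _)
    · filter_upwards [hsd] with n h1
      have h2 := hab _ (M.tangent_le_V n (hW.basic.riesz_mem n))
      rw [W.weakNorm_riesz hM hW.basic h1, mul_comm a, mul_comm b] at h2
      exact ⟨le_of_mul_le_mul_left h2.1 h1, le_of_mul_le_mul_left h2.2 h1⟩
    · filter_upwards [hL.eventually_half_le, hshift] with n h1 h2
      rwa [← h2]
  have hk : Tendsto (W.shift M L) atTop (𝓝 L.κ) := hL.dφ_tendsto.congr' hshift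
  have hm := fun n => W.measurable_sqrt_mul_Zn (L := L) hM hW.basic n
  refine tendsto_order.2 ⟨fun c hc => ?_, fun c hc => ?_⟩
  · refine eventually_lt_tail (P := L.P) (k := W.shift M L) (B := |L.κ| + 1) hm hW.lqa.clt ?_
      (fun c' hc' => hk.abs.eventually_const_lt hc')
      (A := fun n z => W.weakNorm M (W.u M n) ^ 2 * W.QLR M n z)
      (fun K ε hε => Scaling.le_QLR hM hL hW hS K hε) t hc
    filter_upwards [hk.abs.eventually_lt_const (lt_add_one |L.κ|)] with n hn
    exact hn.le
  · exact eventually_tail_lt (P := L.P) hm hW.lqa.clt hk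
      (A := fun n z => W.weakNorm M (W.u M n) ^ 2 * W.QLR M n z)
      (fun ε hε => Scaling.QLR_le hM hL hW hS hε) t hc

/-- A lower bound for the asymptotic power of the optimally weighted test. -/
theorem Weighting.Conditions.eventually_lt_power (hM : M.Regular) (hL : L.Along M)
    (hW : W.Basic M) (hW₀ : W₀.Conditions M L)
    (hopt : ∀ᵐ x ∂(M.law : Measure (X × Y)).fst, W₀.Sig x = M.Sig₀ x)
    (hd : ∀ n : ℕ, L.d n = (√n)⁻¹ * W.sdNorm M (W.riesz n)) (t : ℝ) {c : ℝ}
    (hc : c < 1 - normalWindow L.κ √t) :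
    ∀ᶠ n in atTop, c < (sampleLaw (L.P n) n).real {z | t ≤ W₀.QLR M n z} := by
  have hsd₀ := W₀.sdNorm_riesz_pos hM hL hW₀.basic hW₀.basic hopt
  have heq : ∀ n, W₀.sdNorm M (W₀.riesz n) = W₀.weakNorm M (W₀.riesz n) := fun n =>
    W₀.sdNorm_eq_weakNorm hM hW₀.basic hopt (M.tangent_le_V n (hW₀.basic.riesz_mem n))
  have hU : ∀ᶠ n in atTop, W₀.weakNorm M (W₀.u M n) = 1 := by
    filter_upwards [hsd₀] with n h1
    have h2 := W₀.weakNorm_riesz hM hW₀.basic h1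
    rw [← heq n] at h2
    exact (mul_eq_left₀ h1.ne').1 h2.symm
  have hshift : ∀ᶠ n in atTop, |W₀.shift M L n| =
      W.sdNorm M (W.riesz n) / W₀.sdNorm M (W₀.riesz n) * |M.dφ (L.dir n)| := by
    filter_upwards [hsd₀, eventually_gt_atTop 0] with n h1 hn
    rw [W₀.shift_eq hM hL hW₀.basic hd hn h1, abs_mul,
      abs_of_nonneg (div_nonneg (W.sdNorm_nonneg _) h1.le)]
  have hge : ∀ᶠ n in atTop, |M.dφ (L.dir n)| ≤ |W₀.shift M L n| := by
    filter_upwards [hsd₀, hshift] with n h1 h2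
    rw [h2]
    refine le_mul_of_one_le_left (abs_nonneg _) ((one_le_div h1).2 ?_)
    rw [heq]
    exact Weighting.weakNorm_riesz_le hM hW hW₀.basic hopt n
  have hS : W₀.Scaling M L 1 1 (|L.κ| / 2) := by
    refine ⟨one_pos, one_pos, half_pos (abs_pos.2 hL.κ_ne), fun n => ?_, ?_, ?_⟩
    · rw [hd n]
      exact mul_nonneg (inv_nonneg.2 (Real.sqrt_nonneg _)) (W.sdNorm_nonneg _)
    · filter_upwards [hU] with n h1
      exact ⟨h1.ge, h1.le⟩
    · filter_upwards [hL.eventually_half_le, hge] with n h1 h2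
      exact h1.trans h2
  obtain ⟨a, b, ha, hb, hab⟩ := W.exists_sdNorm_equiv hM hW hW₀.basic hopt
  obtain ⟨K, hK, hKn⟩ := Weighting.exists_weakNorm_riesz_le hM hW hW₀.basic
  -- The inefficiency ratio is bounded by passing from the variance norm to the weak norm for `W`
  -- (constant `a`) and then comparing representers (constant `K`).
  have hbdd : ∀ᶠ n in atTop, |W₀.shift M L n| ≤ K / a * (|L.κ| + 1) := by
    filter_upwards [hsd₀, hshift,
      hL.dφ_tendsto.abs.eventually_lt_const (lt_add_one |L.κ|)] with n h1 h2 h3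
    rw [h2]
    refine mul_le_mul ?_ h3.le (abs_nonneg _) (div_nonneg hK ha.le)
    rw [div_le_div_iff₀ h1 ha, heq, mul_comm]
    exact (hab _ (M.tangent_le_V n (hW.riesz_mem n))).1.trans (hKn n)
  refine eventually_lt_tail (P := L.P)
    (fun n => W₀.measurable_sqrt_mul_Zn (L := L) hM hW₀.basic n) hW₀.lqa.clt hbdd
    (fun c' hc' => ?_) (A := fun n z => W₀.QLR M n z) (fun K ε hε => ?_) t hc
  · filter_upwards [hge, hL.dφ_tendsto.abs.eventually_const_lt hc'] with n h1 h2
    exact h2.trans_le h1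
  · filter_upwards [Scaling.le_QLR hM hL hW₀ hS K hε, tendsto_fst_wp.eventually hU] with p h1 h2
    rwa [h2, one_pow, one_mul] at h1

end Main

end SieveQLR

theorem mainTheorem8 {dθ dρ : ℕ} {X Y H : Type*} [MeasurableSpace X] [MeasurableSpace Y]
    [StandardBorelSpace Y] [Nonempty Y] [NormedAddCommGroup H] [NormedSpace ℝ H]
    (M : SieveQLR.Model dθ dρ X Y H) (hM : M.Regular)
    (L : SieveQLR.LocalAlt dθ X Y H) (hL : L.Along M)
    (W : SieveQLR.Weighting dθ dρ X Y H) (hW : W.Conditions M L)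
    (W₀ : SieveQLR.Weighting dθ dρ X Y H) (hW₀ : W₀.Conditions M L)
    (hopt : ∀ᵐ x ∂(M.law : Measure (X × Y)).fst, W₀.Sig x = M.Sig₀ x)
    (hd : ∀ n : ℕ, L.d n = (√n)⁻¹ * W.sdNorm M (W.riesz n)) :
    ∀ t : ℝ, ∃ ℓ : ℝ≥0∞,
      Tendsto (fun n : ℕ => SieveQLR.sampleLaw (L.P n) n
        {z | t ≤ W.weakNorm M (W.u M n) ^ 2 * W.QLR M n z}) atTop (𝓝 ℓ) ∧
      ℓ ≤ liminf (fun n : ℕ => SieveQLR.sampleLaw (L.P n) n {z | t ≤ W₀.QLR M n z}) atTop := by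
  intro t
  have hℝ := hW.tendsto_power hM hL hW₀.basic hopt hd t
  set p : ℝ := 1 - SieveQLR.normalWindow L.κ √t
  refine ⟨ENNReal.ofReal p, ?_, ?_⟩
  · refine (ENNReal.tendsto_ofReal hℝ).congr fun n => ?_
    exact ENNReal.ofReal_toReal (measure_ne_top _ _)
  · refine le_of_forall_lt fun c hc => ?_
    have hc' : c ≠ ∞ := ne_top_of_lt hc
    -- The intermediate `q` is finite, so the real-valued power bound applies to it, and it leaves a
    -- strict gap above `c` when the limit inferior is taken.
    obtain ⟨q, hcq, hqp⟩ := exists_between hc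
    have hq' : q ≠ ∞ := ne_top_of_lt hqp
    have hq : q.toReal < p := (ENNReal.lt_ofReal_iff_toReal_lt hq').1 hqp
    refine hcq.trans_le (le_liminf_of_le (by isBoundedDefault) ?_)
    filter_upwards [SieveQLR.Weighting.Conditions.eventually_lt_power hM hL hW.basic hW₀ hopt hd t
      hq] with n hn
    rw [← ENNReal.ofReal_toReal hq']
    exact ENNReal.ofReal_le_of_le_toReal hn.le
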